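/- \textbf{Setting.} Let $\mathcal B=[\underline\mu,\bar\mu]\times[\underline p,\bar p]$, $\vartheta=(\mu,p)$, and let $\|\cdot\|$ be the Euclidean norm. Let $\lambda(\cdot)$ (arrival rate) be positive and non-increasing on $[\underline p,\bar p]$ and let $c(\cdot)$ (staffing cost) be non-decreasing on $[\underline\mu,\bar\mu]$; both are continuously differentiable near these intervals, with derivatives Lipschitz on them, and $\lambda(\underline p)<\underline\mu$. Let $U$ and $V$ be nonnegative random variables with $\mathbb E U=\mathbb E V=1$, such that $V$ has a bounded density and, for some $\eta>0$, $\mathbb E e^{\eta U}<\infty$ and $\mathbb E e^{\eta V}<\infty$; moreover, there are $0<\theta<\eta/(2\bar\mu)$, $0<a<(\underline\mu-\lambda(\underline p))/(\underline\mu+\lambda(\underline p))$ and $\gamma>0$ with $\phi_U(-\theta/(1-a))<-\theta-\gamma/2$ and $\phi_V(\theta/(1+a))<\theta-\gamma/2$, where $\phi_U,\phi_V$ are the cumulant generating functions. In the GI/GI/1 queue with parameter $\vartheta$, the interarrival times are i.i.d. copies of $U/\lambda(p)$, the service times are i.i.d. copies of $V/\mu$, and the two sequences are independent. Let $P_\vartheta$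 be the transition kernel on $\mathcal X=[0,\infty)^2$ of the state $x=(w,y)$ (waiting time, observed busy period), given by $$w'=\Bigl(w-\tfrac{U}{\lambda(p)}+\tfrac{V}{\mu}\Bigr)_+,\qquad y'=\Bigl(y+\tfrac{U}{\lambda(p)}\Bigr)\mathbf 1(w'>0).$$ Let $f(\mu,p)=h_0\,\mathbb E[Q_\infty(\mu,p)]+c(\mu)-p\lambda(p)$, where $h_0$ is a constant and $\mathbb E[Q_\infty(\mu,p)]$ is the steady-state (long-run average) mean number of customers in the system, and let $\vartheta^*$ be a minimizer of $f$ over $\mathcal B$. Let $$H(\vartheta,x)=\Bigl(c'(\mu)-h_0\tfrac{\lambda(p)}{\mu}\bigl(w+y+\tfrac1\mu\bigr),\ -\lambda(p)-p\lambda'(p)+h_0\lambda'(p)\bigl(w+y+\tfrac1\mu\bigr)\Bigr),$$ $$U(\vartheta,x)=\sum_{n\ge0}\bigl(P_\vartheta^nH(\vartheta,\cdot)(x)-\nabla f(\vartheta)\bigr).$$ A SAMCMC trajectory starts from the empty state $(0,0)$ and a parameter $\vartheta_0\in\mathcal B$. At step $t\ge 0$, $x_{t+1}$ is obtained from $x_t$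 by the recursion above with parameter $\vartheta_t$ and $(U_t,V_t)$, where $(U_t)$ and $(V_t)$ are independent i.i.d. copies of $U$ and $V$, and $\vartheta_{t+1}=\Pi_{\mathcal B}(\vartheta_t-\eta_tH(\vartheta_t,\cdot))$, with $H$ evaluated throughout either at the current state $x_t$ or throughout at the new state $x_{t+1}$. Here $\Pi_{\mathcal B}$ is the Euclidean projection and $(\eta_t)$ is any step size sequence. \textbf{Proposition 2.} For every $\vartheta\in\mathcal B$, $\mathbb E[Q_\infty]$ exists as the limit of the expected time averages for the queue started empty, $f$ is differentiable at $\vartheta$, the series defining $U(\vartheta,x)$ converges absolutely for every $x\in\mathcal X$, $U(\vartheta,\cdot)$ is $P_\vartheta(x,\cdot)$-integrable for every $x\in\mathcal X$, and $U$ solves the Poisson equation $H(\vartheta,x)-\nabla f(\vartheta)=U(\vartheta,x)-P_\vartheta U(\vartheta,x)$. Moreover, there are measurable functions $L_H,L_U:\mathcal X\to[0,\infty)$ and constants $C_H,C_U,\sigma_H,\sigma_U>0$, not depending on the step sizes or on the trajectory, such that: (a) for all $x\in\mathcal X$ and $\vartheta\in\mathcal B$, $\Bigl(\int\|H(\vartheta^*,z)-H(\vartheta,z)\|^2P_\vartheta(x,dz)\Bigr)^{1/2}\le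 L_H(x)\,\|\vartheta-\vartheta^*\|$; (b) for all $x\in\mathcal X$ and $\vartheta,\vartheta'\in\mathcal B$, $\|P_\vartheta U(\vartheta,x)-P_{\vartheta'}U(\vartheta',x)\|\le L_U(x)\,\|\vartheta-\vartheta'\|$; (c) for every SAMCMC trajectory and $\alpha=1,\dots,4$, $\sup_t\mathbb E L_H^\alpha(x_t)\le C_H^\alpha$ and $\sup_t\mathbb E L_U^\alpha(x_t)\le C_U^\alpha$; (d) for every SAMCMC trajectory and $\alpha=1,\dots,4$, $\sup_t\mathbb E\|H(\vartheta^*,x_t)\|^\alpha\le\sigma_H^\alpha$ and $\sup_t\mathbb E\|P_{\vartheta^*}U(\vartheta^*,x_t)\|^\alpha\le\sigma_U^\alpha$. -/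

import Mathlib

open MeasureTheory ProbabilityTheory Filter Topology

universe u

noncomputable section

/-- Decision parameters `ϑ = (μ, p)` (service rate, price) with the Euclidean norm:
`ϑ 0 = μ` and `ϑ 1 = p`. Gradients are vectors of the same type, in the same order. -/
abbrev Param : Type := EuclideanSpace ℝ (Fin 2)

/-- System states `x = (w, y)`: waiting time and observed busy period. -/
abbrev QState : Type := ℝ × ℝ

/-- The state space `𝒳`: waiting time and observed busy period are nonnegative. -/
def stateSpace : Set QState := {x | 0 ≤ x.1 ∧ 0 ≤ x.2}

/-- The primitives of the pricing and capacity sizing problem for a GI/GI/1 queue. -/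
structure QueueModel where
  /-- arrival (demand) rate as a function of the price -/
  lam : ℝ → ℝ
  /-- staffing cost as a function of the service rate -/
  cost : ℝ → ℝ
  /-- holding cost coefficient -/
  h₀ : ℝ
  /-- bounds of the feasible service rates -/
  muLo : ℝ
  muHi : ℝ
  /-- bounds of the feasible prices -/
  pLo : ℝ
  pHi : ℝ
  /-- common law of the unscaled interarrival times `U_n` -/
  lawU : Measure ℝ
  /-- common law of the unscaled service times `V_n` -/
  lawV : Measure ℝ
  [probU : IsProbabilityMeasure lawU]
  [probV : IsProbabilityMeasure lawV]

attribute [instance] QueueModel.probU QueueModel.probV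

namespace QueueModel

/-- The feasible set `[μ_lo, μ_hi] × [p_lo, p_hi]`. -/
def box (M : QueueModel) : Set Param :=
  {ϑ | ϑ 0 ∈ Set.Icc M.muLo M.muHi ∧ ϑ 1 ∈ Set.Icc M.pLo M.pHi}

/-- Standing assumptions on demand rate, staffing cost and stability. -/
structure Regular (M : QueueModel) : Prop where
  lam_pos : ∀ p ∈ Set.Icc M.pLo M.pHi, 0 < M.lam p
  lam_contDiff : ∀ p ∈ Set.Icc M.pLo M.pHi, ContDiffAt ℝ 1 M.lam p
  lam_anti : AntitoneOn M.lam (Set.Icc M.pLo M.pHi)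
  lam_deriv_lipschitz : ∃ K, LipschitzOnWith K (deriv M.lam) (Set.Icc M.pLo M.pHi)
  cost_contDiff : ∀ m ∈ Set.Icc M.muLo M.muHi, ContDiffAt ℝ 1 M.cost m
  cost_mono : MonotoneOn M.cost (Set.Icc M.muLo M.muHi)
  cost_deriv_lipschitz : ∃ K, LipschitzOnWith K (deriv M.cost) (Set.Icc M.muLo M.muHi)
  /-- uniform stability -/
  stable : M.lam M.pLo < M.muLo

/-- Standing assumptions on the interarrival and service time distributions: nonnegative, unit
mean, light-tailed, with a bounded service time density. -/
structure LightTailed (M : QueueModel) : Prop where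
  U_nonneg : ∀ᵐ s ∂M.lawU, 0 ≤ s
  V_nonneg : ∀ᵐ s ∂M.lawV, 0 ≤ s
  U_mean : ∫ s, s ∂M.lawU = 1
  V_mean : ∫ s, s ∂M.lawV = 1
  /-- `V` has a density bounded by a constant -/
  V_density : ∃ b : NNReal, M.lawV ≤ b • (volume : Measure ℝ)
  exp_moments : ∃ η > 0,
    Integrable (fun s => Real.exp (η * s)) M.lawU ∧
    Integrable (fun s => Real.exp (η * s)) M.lawV ∧
    ∃ θ a γ : ℝ, 0 < θ ∧ θ < η / (2 * M.muHi) ∧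
      0 < a ∧ a < (M.muLo - M.lam M.pLo) / (M.muLo + M.lam M.pLo) ∧ 0 < γ ∧
      Integrable (fun s => Real.exp (θ / (1 + a) * s)) M.lawV ∧
      cgf id M.lawU (-θ / (1 - a)) < -θ - γ / 2 ∧
      cgf id M.lawV (θ / (1 + a)) < θ - γ / 2

/-- One step of the queue under `ϑ` from `x = (w, y)` when the unscaled interarrival and service
times are `s = (U, V)`. -/
def step (M : QueueModel) (ϑ : Param) (x : QState) (s : ℝ × ℝ) : QState :=
  (max (x.1 - s.1 / M.lam (ϑ 1) + s.2 / ϑ 0) 0,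
    if 0 < max (x.1 - s.1 / M.lam (ϑ 1) + s.2 / ϑ 0) 0 then x.2 + s.1 / M.lam (ϑ 1) else 0)

theorem measurable_step (M : QueueModel) (ϑ : Param) :
    Measurable (fun z : QState × (ℝ × ℝ) => M.step ϑ z.1 z.2) := by
  have h : Measurable (fun z : QState × (ℝ × ℝ) =>
      max (z.1.1 - z.2.1 / M.lam (ϑ 1) + z.2.2 / ϑ 0) 0) := by fun_prop
  exact h.prodMk (Measurable.ite (measurableSet_lt measurable_const h) (by fun_prop)
    measurable_const)

/-- The transition kernel `P_ϑ` of the queue under `ϑ`. -/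
def kernel (M : QueueModel) (ϑ : Param) : Kernel QState QState where
  toFun x := (M.lawU.prod M.lawV).map (M.step ϑ x)
  measurable' := by
    refine Measure.measurable_of_measurable_coe _ fun s hs => ?_
    have h : ∀ x, ((M.lawU.prod M.lawV).map (M.step ϑ x)) s
        = (M.lawU.prod M.lawV) (Prod.mk x ⁻¹' ((fun z => M.step ϑ z.1 z.2) ⁻¹' s)) := fun x =>
      Measure.map_apply ((M.measurable_step ϑ).comp measurable_prodMk_left) hs
    simp only [h]
    exact measurable_measure_prodMk_left (M.measurable_step ϑ hs)

/-! The steady-state mean number of customers. A fixed-parameter queue starts empty at time `0`,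
when customer `0` arrives; `s n = (U_n, V_n)`, customer `n + 1` arrives `U_n / λ` after customer
`n`, and the service time of customer `n` is `V_n / μ`. -/

/-- The state found by customer `n`. -/
def path (M : QueueModel) (ϑ : Param) (s : ℕ → ℝ × ℝ) : ℕ → QState
  | 0 => (0, 0)
  | n + 1 => M.step ϑ (M.path ϑ s n) (s n)

/-- Arrival time of customer `n`. -/
def arrival (M : QueueModel) (ϑ : Param) (s : ℕ → ℝ × ℝ) (n : ℕ) : ℝ :=
  ∑ i ∈ Finset.range n, (s i).1 / M.lam (ϑ 1)

/-- Departure time of customer `n`: arrival time plus waiting time plus service time. -/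
def departure (M : QueueModel) (ϑ : Param) (s : ℕ → ℝ × ℝ) (n : ℕ) : ℝ :=
  M.arrival ϑ s n + (M.path ϑ s n).1 + (s n).2 / ϑ 0

open Classical in
/-- The number of customers in the system (waiting or in service) at time `r`. -/
def queueLength (M : QueueModel) (ϑ : Param) (s : ℕ → ℝ × ℝ) (r : ℝ) : ENNReal :=
  ∑' n : ℕ, if M.arrival ϑ s n ≤ r ∧ r < M.departure ϑ s n then 1 else 0

/-- The expected time average `T⁻¹ 𝔼 ∫₀ᵀ Q(r) dr` of the number of customers. -/
def avgQueue (M : QueueModel) (ϑ : Param) (T : ℝ) : ℝ :=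
  (∫⁻ s, (∫⁻ r in Set.Ioc 0 T, M.queueLength ϑ s r)
    ∂(Measure.infinitePi fun _ : ℕ => M.lawU.prod M.lawV)).toReal / T

/-- The steady-state mean queue length `𝔼 Q_∞(μ, p)`, as the long-run average. -/
def meanQueue (M : QueueModel) (ϑ : Param) : ℝ := limUnder atTop (M.avgQueue ϑ)

/-- The objective `f(μ, p) = h₀ 𝔼 Q_∞(μ, p) + c(μ) - p λ(p)`. -/
def objective (M : QueueModel) (ϑ : Param) : ℝ :=
  M.h₀ * M.meanQueue ϑ + M.cost (ϑ 0) - ϑ 1 * M.lam (ϑ 1)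

/-- `θ` is an optimal solution: it minimizes the objective over the feasible set. -/
def IsOptimal (M : QueueModel) (θ : Param) : Prop :=
  θ ∈ M.box ∧ IsMinOn M.objective M.box θ

/-- The gradient estimator `H(ϑ, x)`; the first coordinate belongs to `μ`, the second to `p`. -/
def H (M : QueueModel) (ϑ : Param) (x : QState) : Param :=
  !₂[deriv M.cost (ϑ 0) - M.h₀ * (M.lam (ϑ 1) / ϑ 0) * (x.1 + x.2 + 1 / ϑ 0),
    -M.lam (ϑ 1) - ϑ 1 * deriv M.lam (ϑ 1)
      + M.h₀ * deriv M.lam (ϑ 1) * (x.1 + x.2 + 1 / ϑ 0)]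

/-- The `n`-th term `𝔼[H(ϑ, x_n)] - ∇f(ϑ)` for the chain with kernel `P_ϑ` and `x_0 = x`. -/
def bias (M : QueueModel) (ϑ : Param) (x : QState) (n : ℕ) : Param :=
  (∫ z, M.H ϑ z ∂((M.kernel ϑ ^ n) x)) - gradient M.objective ϑ

/-- The solution `U(ϑ, x)` of the Poisson equation: the cumulated transient bias. -/
def U (M : QueueModel) (ϑ : Param) (x : QState) : Param := ∑' n : ℕ, M.bias ϑ x n

/-- `P_ϑ U(ϑ, x)`. -/
def PU (M : QueueModel) (ϑ : Param) (x : QState) : Param := ∫ z, M.U ϑ z ∂(M.kernel ϑ x)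

/-- All the quantities in the definition of `U(ϑ, ·)` exist, and `U(ϑ, ·)` does solve the Poisson
equation `H(ϑ, x) - ∇f(ϑ) = U(ϑ, x) - P_ϑ U(ϑ, x)`. -/
structure WellPosed (M : QueueModel) (ϑ : Param) : Prop where
  meanQueue_tendsto : Tendsto (M.avgQueue ϑ) atTop (𝓝 (M.meanQueue ϑ))
  differentiable : DifferentiableAt ℝ M.objective ϑ
  integrable_H : ∀ x ∈ stateSpace, ∀ n : ℕ, Integrable (M.H ϑ) ((M.kernel ϑ ^ n) x)
  summable : ∀ x ∈ stateSpace, Summable fun n => ‖M.bias ϑ x n‖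
  integrable_U : ∀ x ∈ stateSpace, Integrable (M.U ϑ) (M.kernel ϑ x)
  poisson : ∀ x ∈ stateSpace, M.H ϑ x - gradient M.objective ϑ = M.U ϑ x - M.PU ϑ x

/-- The Euclidean projection onto the feasible set: coordinatewise truncation. -/
def proj (M : QueueModel) (v : Param) : Param :=
  !₂[max M.muLo (min M.muHi (v 0)), max M.pLo (min M.pHi (v 1))]

/-- `proj` is the nearest point map of the feasible set. -/
theorem proj_nearest (M : QueueModel) (hm : M.muLo ≤ M.muHi) (hp : M.pLo ≤ M.pHi) (v : Param) :
    M.proj v ∈ M.box ∧ ∀ b ∈ M.box, ‖v - M.proj v‖ ≤ ‖v - b‖ := by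
  have key : ∀ lo hi t b : ℝ, b ∈ Set.Icc lo hi →
      (t - max lo (min hi t)) ^ 2 ≤ (t - b) ^ 2 := by
    rintro lo hi t b ⟨h1, h2⟩
    apply sq_le_sq.2
    rcases le_total hi t with h | h
    · rw [min_eq_left h, max_eq_right (h1.trans h2), abs_of_nonneg (by linarith),
        abs_of_nonneg (by linarith)]
      linarith
    · rw [min_eq_right h]
      rcases le_total lo t with h' | h'
      · rw [max_eq_right h']
        simp
      · rw [max_eq_left h', abs_of_nonpos (by linarith), abs_of_nonpos (by linarith)]
        linarith
  refine ⟨?_, fun b hb => ?_⟩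
  · simp [proj, box, hm, hp]
  · rw [EuclideanSpace.norm_eq, EuclideanSpace.norm_eq]
    apply Real.sqrt_le_sqrt
    simp only [Fin.sum_univ_two, Real.norm_eq_abs, sq_abs]
    exact add_le_add (key _ _ _ _ hb.1) (key _ _ _ _ hb.2)

/-- `(ϑ_t, x_t)` is a trajectory of the SAMCMC algorithm for the queue, driven by two independent
i.i.d. sequences `(U_t)`, `(V_t)`, with step sizes `η_t`, started from the empty system `(0, 0)`
and a feasible parameter; the first index is `0`. Both schedules in use are covered: `ϑ_{t+1}` is
computed from the state `x_t` that has just been used, or from the freshly sampled state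
`x_{t+1} ∼ P_{ϑ_t}(x_t, ·)`. -/
structure IsSAMCMC (M : QueueModel) {Ω : Type u} [MeasurableSpace Ω] (P : Measure Ω)
    (Us Vs : ℕ → Ω → ℝ) (η : ℕ → ℝ) (ϑ : ℕ → Ω → Param) (x : ℕ → Ω → QState) : Prop where
  measurable_U : ∀ t, Measurable (Us t)
  measurable_V : ∀ t, Measurable (Vs t)
  law : ∀ t, P.map (fun ω => (Us t ω, Vs t ω)) = M.lawU.prod M.lawV
  indep : iIndepFun (fun t ω => (Us t ω, Vs t ω)) P
  init_param : ∃ ϑ₀ ∈ M.box, ∀ ω, ϑ 0 ω = ϑ₀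
  init_state : ∀ ω, x 0 ω = (0, 0)
  state_step : ∀ t ω, x (t + 1) ω = M.step (ϑ t ω) (x t ω) (Us t ω, Vs t ω)
  param_step :
    (∀ t ω, ϑ (t + 1) ω = M.proj (ϑ t ω - η t • M.H (ϑ t ω) (x t ω))) ∨
    (∀ t ω, ϑ (t + 1) ω = M.proj (ϑ t ω - η t • M.H (ϑ t ω) (x (t + 1) ω)))

end QueueModel

end

/-! Write `a = 1/μ` and `b = 1/λ(p)`, so that the waiting time follows the recursion `w' = (w - bU +
aV)₊`. Run two copies of the queue from `x` and `x'` with the same noise. If both empty at the same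
step they coincide from then on. Otherwise the weight `exp(t(max w + c max y))` is multiplied by at
most `exp(t * drift)`, whose mean is below one for small `t`, uniformly over a rectangle of stable
`(a, b)`. Hence the transition operator `T` contracts the weighted oscillation seminorm with no
additive term (`Osc.T`). This gives geometric convergence to the stationary mean `π F`, absolute
convergence of the potential `∑ (T^n F - π F)`, and the Poisson equation (`T_potential`).

For the dependence on the parameters, the difficulty is that `y` jumps to zero when the queue
empties, so one step is not Lipschitz. Two coupled steps disagree about emptiness only if `V`, given
`U`, falls between two thresholds that are close to each other. The bounded density of `V` makes
this probability Lipschitz in the states and in the parameters. So `T` contracts a seminorm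
combining oscillation and Lipschitz constant (`Lip.T`, `Smooth.T`), and `T` is itself Lipschitz in
`(a, b)` on that class (`Lip.abs_T_sub_T_le`). The identity `π F - π' F = π (T - T') G'`, with `G'`
the potential of `F` under the second parameter, and its analogue for potentials transfer the
Lipschitz bound to `π F` and `G` (`Smooth.abs_statMean_sub_le`, `Smooth.abs_potential_sub_le`).

For the gradient, the waiting time of each customer is convex in `(a, b)`, with subgradient `((w +
y)/a, -y/b)` (`path_subgradient`). In the stationary limit the subgradient is continuous in the
parameter, so the mean wait is differentiable (`hasFDerivAt_mean_wait`). Little's law for the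
expected time averages (`tendsto_avgQueue`) then identifies `∇f` with the stationary mean of `H`.
Since `H` is affine in `w + y`, both `U` and `P U` reduce to the potential of the scalar function `w
+ y`.

For the moments, the drift inequality of the Lyapunov function `V` holds for every parameter in the
rectangle, even one chosen from the past. It therefore bounds the mean of `V` uniformly along every
trajectory (`lintegral_V_le`). The exponents are taken small enough for fourth powers to be covered.
-/

noncomputable section

namespace QueueModel

/-! ### The recursion in terms of mean service and interarrival times. -/

variable {M : QueueModel}

/-- Joint law of the unscaled interarrival and service times. -/
abbrev noise (M : QueueModel) : Measure (ℝ × ℝ) := M.lawU.prod M.lawV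

/-- One step of the queue in terms of the mean service time `a` and mean interarrival time `b`. -/
def lindley (a b : ℝ) (x : QState) (s : ℝ × ℝ) : QState :=
  (max (x.1 - b * s.1 + a * s.2) 0, if 0 < x.1 - b * s.1 + a * s.2 then x.2 + b * s.1 else 0)

theorem step_eq_lindley (M : QueueModel) (ϑ : Param) (x : QState) (s : ℝ × ℝ) :
    M.step ϑ x s = lindley (ϑ 0)⁻¹ (M.lam (ϑ 1))⁻¹ x s := by
  simp only [step, lindley, div_eq_inv_mul, lt_max_iff, lt_irrefl, or_false]

theorem measurable_lindley (a b : ℝ) :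
    Measurable (fun z : QState × (ℝ × ℝ) => lindley a b z.1 z.2) := by
  have h : Measurable (fun z : QState × (ℝ × ℝ) => z.1.1 - b * z.2.1 + a * z.2.2) := by fun_prop
  exact (h.max measurable_const).prodMk
    (Measurable.ite (measurableSet_lt measurable_const h) (by fun_prop) measurable_const)

theorem measurable_lindley_right (a b : ℝ) (x : QState) : Measurable (lindley a b x) :=
  (measurable_lindley a b).comp measurable_prodMk_left

theorem lindley_of_pos {a b : ℝ} {x : QState} {s : ℝ × ℝ} (h : 0 < x.1 - b * s.1 + a * s.2) :
    lindley a b x s = (x.1 - b * s.1 + a * s.2, x.2 + b * s.1) := by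
  simp [lindley, h, h.le]

theorem lindley_of_nonpos {a b : ℝ} {x : QState} {s : ℝ × ℝ} (h : x.1 - b * s.1 + a * s.2 ≤ 0) :
    lindley a b x s = (0, 0) := by
  simp [lindley, h, h.not_gt]

/-- A rectangle of stable parameters `(a, b)` together with a range of exponents for which the
exponential Lyapunov functions contract, uniformly over the rectangle. -/
structure Frame (M : QueueModel) where
  aLo : ℝ
  aHi : ℝ
  bLo : ℝ
  bHi : ℝ
  t₀ : ℝ
  D : NNReal
  aLo_pos : 0 < aLo
  aLo_le : aLo ≤ aHi
  stable : aHi < bLo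
  bLo_le : bLo ≤ bHi
  t₀_pos : 0 < t₀
  U_nonneg : ∀ᵐ s ∂M.lawU, 0 ≤ s
  V_nonneg : ∀ᵐ s ∂M.lawV, 0 ≤ s
  density : M.lawV ≤ D • (volume : Measure ℝ)
  contract : ∀ t, 0 < t → t ≤ t₀ →
    ∫ s, Real.exp (t * (aHi * s.2 - (bLo + aHi) / 2 * s.1)) ∂M.noise < 1
  integ : Integrable (fun s : ℝ × ℝ => Real.exp (t₀ * ((aHi + bHi) * (s.1 + s.2)))) M.noise

/-! ### Exponential weights and their behaviour in one coupled step. -/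

namespace Frame

variable (Fr : Frame M)

/-- Membership of the parameter rectangle. -/
structure Mem (a b : ℝ) : Prop where
  a_lo : Fr.aLo ≤ a
  a_hi : a ≤ Fr.aHi
  b_lo : Fr.bLo ≤ b
  b_hi : b ≤ Fr.bHi

/-- Relative weight of the busy period. -/
def c : ℝ := (Fr.bLo - Fr.aHi) / (2 * Fr.bHi)

/-- Dominating increment of the logarithm of the Lyapunov function. -/
def drift (s : ℝ × ℝ) : ℝ := Fr.aHi * s.2 - (Fr.bLo + Fr.aHi) / 2 * s.1

/-- Crude bound of the growth in one step. -/
def growth (s : ℝ × ℝ) : ℝ := (Fr.aHi + Fr.bHi) * (s.1 + s.2)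

/-- Size of a pair of states. -/
def gauge (x x' : QState) : ℝ := max |x.1| |x'.1| + Fr.c * max |x.2| |x'.2|

/-- Exponential weight of a pair of states. -/
def K (t : ℝ) (x x' : QState) : ℝ := Real.exp (t * Fr.gauge x x')

/-- Exponential Lyapunov function. -/
def V (t : ℝ) (x : QState) : ℝ := Fr.K t x x

/-- Contraction rate of the Lyapunov function. -/
def rate (t : ℝ) : ℝ := ∫ s, Real.exp (t * Fr.drift s) ∂M.noise

theorem aHi_pos : 0 < Fr.aHi := Fr.aLo_pos.trans_le Fr.aLo_le
theorem bLo_pos : 0 < Fr.bLo := Fr.aHi_pos.trans Fr.stable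
theorem bHi_pos : 0 < Fr.bHi := Fr.bLo_pos.trans_le Fr.bLo_le
theorem c_pos : 0 < Fr.c := div_pos (by linarith [Fr.stable]) (by linarith [Fr.bHi_pos])
-- One interarrival time raises the weighted busy period by at most `(bLo - aHi) / 2 * s.1`, which
-- is half of the stability margin. The other half is left in `drift` as negative drift.
theorem c_mul : Fr.c * Fr.bHi = (Fr.bLo - Fr.aHi) / 2 := by
  have := Fr.bHi_pos.ne'
  unfold c
  field_simp
theorem c_mul_le : Fr.c * Fr.bHi ≤ Fr.bHi := by
  rw [c_mul]; linarith [Fr.aHi_pos, Fr.bLo_le, Fr.bHi_pos]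

theorem noise_nonneg (Fr : Frame M) : ∀ᵐ s ∂M.noise, 0 ≤ s.1 ∧ 0 ≤ s.2 := by
  have h1 : ∀ᵐ s ∂M.noise, 0 ≤ s.1 := Measure.quasiMeasurePreserving_fst.ae Fr.U_nonneg
  have h2 : ∀ᵐ s ∂M.noise, 0 ≤ s.2 := Measure.quasiMeasurePreserving_snd.ae Fr.V_nonneg
  exact h1.and h2

theorem gauge_nonneg (x x' : QState) : 0 ≤ Fr.gauge x x' := by
  have := Fr.c_pos
  unfold gauge; positivity

theorem gauge_comm (x x' : QState) : Fr.gauge x x' = Fr.gauge x' x := by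
  simp [gauge, max_comm]

theorem gauge_mono_right {x x' : QState} : Fr.gauge x x ≤ Fr.gauge x x' := by
  have := Fr.c_pos
  simp only [gauge, max_self]
  gcongr <;> exact le_max_left _ _

theorem gauge_zero_right (x : QState) : Fr.gauge x (0, 0) = Fr.gauge x x := by
  simp [gauge]

theorem K_pos (t : ℝ) (x x' : QState) : 0 < Fr.K t x x' := Real.exp_pos _
theorem V_pos (t : ℝ) (x : QState) : 0 < Fr.V t x := Real.exp_pos _
theorem one_le_K {t : ℝ} (ht : 0 ≤ t) (x x' : QState) : 1 ≤ Fr.K t x x' :=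
  Real.one_le_exp (mul_nonneg ht (Fr.gauge_nonneg x x'))
theorem one_le_V {t : ℝ} (ht : 0 ≤ t) (x : QState) : 1 ≤ Fr.V t x := Fr.one_le_K ht x x
theorem K_comm (t : ℝ) (x x' : QState) : Fr.K t x x' = Fr.K t x' x := by
  rw [K, K, gauge_comm]
theorem K_zero_right (t : ℝ) (x : QState) : Fr.K t x (0, 0) = Fr.V t x := by
  rw [K, V, K, gauge_zero_right]
theorem V_zero (t : ℝ) : Fr.V t (0, 0) = 1 := by simp [V, K, gauge]
theorem V_le_K_left {t : ℝ} (ht : 0 ≤ t) (x x' : QState) : Fr.V t x ≤ Fr.K t x x' :=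
  Real.exp_le_exp.2 (mul_le_mul_of_nonneg_left Fr.gauge_mono_right ht)
theorem V_le_K_right {t : ℝ} (ht : 0 ≤ t) (x x' : QState) : Fr.V t x' ≤ Fr.K t x x' := by
  rw [K_comm]; exact Fr.V_le_K_left ht x' x
theorem K_mono {t t' : ℝ} (h : t ≤ t') (x x' : QState) : Fr.K t x x' ≤ Fr.K t' x x' :=
  Real.exp_le_exp.2 (mul_le_mul_of_nonneg_right h (Fr.gauge_nonneg x x'))
theorem V_mono {t t' : ℝ} (h : t ≤ t') (x : QState) : Fr.V t x ≤ Fr.V t' x := Fr.K_mono h x x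
theorem V_pow (t : ℝ) (x : QState) (n : ℕ) : Fr.V t x ^ n = Fr.V (n * t) x := by
  rw [V, K, V, K, ← Real.exp_nat_mul, mul_assoc]
theorem measurable_V (t : ℝ) : Measurable (Fr.V t) := by
  unfold V K gauge; fun_prop

theorem abs_fst_le_gauge (x x' : QState) : max |x.1| |x'.1| ≤ Fr.gauge x x' := by
  have := Fr.c_pos
  unfold gauge
  have : 0 ≤ Fr.c * max |x.2| |x'.2| := by positivity
  linarith

theorem abs_snd_le_gauge (x x' : QState) : Fr.c * max |x.2| |x'.2| ≤ Fr.gauge x x' := by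
  unfold gauge
  have : 0 ≤ max |x.1| |x'.1| := by positivity
  linarith

variable {Fr} in
theorem Mem.a_pos {a b : ℝ} (h : Fr.Mem a b) : 0 < a := Fr.aLo_pos.trans_le h.a_lo
variable {Fr} in
theorem Mem.b_pos {a b : ℝ} (h : Fr.Mem a b) : 0 < b := Fr.bLo_pos.trans_le h.b_lo

theorem abs_snd_lindley_le {a b : ℝ} (h : Fr.Mem a b) (x : QState) {s : ℝ × ℝ} (hs : 0 ≤ s.1) :
    |(lindley a b x s).2| ≤ |x.2| + Fr.bHi * s.1 := by
  have h1 : 0 ≤ b * s.1 := mul_nonneg h.b_pos.le hs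
  have h2 : b * s.1 ≤ Fr.bHi * s.1 := mul_le_mul_of_nonneg_right h.b_hi hs
  simp only [lindley]
  split_ifs
  · rw [abs_le]
    constructor <;> [linarith [neg_abs_le x.2]; linarith [le_abs_self x.2]]
  · rw [abs_zero]; linarith [abs_nonneg x.2]

theorem abs_fst_lindley_le {a b : ℝ} (h : Fr.Mem a b) (x : QState) {s : ℝ × ℝ}
    (hs : 0 ≤ s.1 ∧ 0 ≤ s.2) : |(lindley a b x s).1| ≤ |x.1| + Fr.aHi * s.2 := by
  have h1 : 0 ≤ b * s.1 := mul_nonneg h.b_pos.le hs.1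
  have h2 : a * s.2 ≤ Fr.aHi * s.2 := mul_le_mul_of_nonneg_right h.a_hi hs.2
  have h3 : 0 ≤ a * s.2 := mul_nonneg h.a_pos.le hs.2
  simp only [lindley]
  rw [abs_of_nonneg (le_max_right _ _)]
  exact max_le (by linarith [le_abs_self x.1]) (by linarith [abs_nonneg x.1])

theorem gauge_lindley_le {a b a' b' : ℝ} (h : Fr.Mem a b) (h' : Fr.Mem a' b') (x x' : QState)
    {s : ℝ × ℝ} (hs : 0 ≤ s.1 ∧ 0 ≤ s.2) :
    Fr.gauge (lindley a b x s) (lindley a' b' x' s) ≤ Fr.gauge x x' + Fr.growth s := by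
  have e1 : max |(lindley a b x s).1| |(lindley a' b' x' s).1|
      ≤ max |x.1| |x'.1| + Fr.aHi * s.2 :=
    max_le ((Fr.abs_fst_lindley_le h x hs).trans (by gcongr; simp))
      ((Fr.abs_fst_lindley_le h' x' hs).trans (by gcongr; simp))
  have e2 : max |(lindley a b x s).2| |(lindley a' b' x' s).2|
      ≤ max |x.2| |x'.2| + Fr.bHi * s.1 :=
    max_le ((Fr.abs_snd_lindley_le h x hs.1).trans (by gcongr; simp))
      ((Fr.abs_snd_lindley_le h' x' hs.1).trans (by gcongr; simp))
  have e3 := mul_le_mul_of_nonneg_left e2 Fr.c_pos.le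
  have e4 := mul_le_mul_of_nonneg_right Fr.c_mul_le hs.1
  have e5 := mul_nonneg Fr.aHi_pos.le hs.1
  have e6 := mul_nonneg Fr.bHi_pos.le hs.2
  unfold gauge growth
  linarith

theorem K_lindley_le {t : ℝ} (ht : 0 ≤ t) {a b a' b' : ℝ} (h : Fr.Mem a b) (h' : Fr.Mem a' b')
    (x x' : QState) {s : ℝ × ℝ} (hs : 0 ≤ s.1 ∧ 0 ≤ s.2) :
    Fr.K t (lindley a b x s) (lindley a' b' x' s)
      ≤ Fr.K t x x' * Real.exp (t * Fr.growth s) := by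
  rw [K, K, ← Real.exp_add, ← mul_add]
  exact Real.exp_le_exp.2 (mul_le_mul_of_nonneg_left (Fr.gauge_lindley_le h h' x x' hs) ht)

/-- As one of the two queues stays busy, `max |w| |w'| - b U + a V` is nonnegative and hence bounds
both truncated waiting times. The weighted busy periods give back half of the margin, by `c_mul`,
and `drift` remains. -/
theorem gauge_lindley_contract {a b : ℝ} (h : Fr.Mem a b) (x x' : QState) {s : ℝ × ℝ}
    (hs : 0 ≤ s.1 ∧ 0 ≤ s.2)
    (hpos : 0 < x.1 - b * s.1 + a * s.2 ∨ 0 < x'.1 - b * s.1 + a * s.2) :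
    Fr.gauge (lindley a b x s) (lindley a b x' s) ≤ Fr.gauge x x' + Fr.drift s := by
  have h2 : a * s.2 ≤ Fr.aHi * s.2 := mul_le_mul_of_nonneg_right h.a_hi hs.2
  have h3 : Fr.bLo * s.1 ≤ b * s.1 := mul_le_mul_of_nonneg_right h.b_lo hs.1
  have hm : 0 ≤ max |x.1| |x'.1| - b * s.1 + a * s.2 := by
    rcases hpos with hp | hp
    · linarith [le_abs_self x.1, le_max_left |x.1| |x'.1|]
    · linarith [le_abs_self x'.1, le_max_right |x.1| |x'.1|]
  have e1 : max |(lindley a b x s).1| |(lindley a b x' s).1|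
      ≤ max |x.1| |x'.1| - b * s.1 + a * s.2 := by
    simp only [lindley]
    rw [abs_of_nonneg (le_max_right _ _), abs_of_nonneg (le_max_right _ _)]
    refine max_le (max_le ?_ hm) (max_le ?_ hm)
    · linarith [le_abs_self x.1, le_max_left |x.1| |x'.1|]
    · linarith [le_abs_self x'.1, le_max_right |x.1| |x'.1|]
  have e2 : max |(lindley a b x s).2| |(lindley a b x' s).2|
      ≤ max |x.2| |x'.2| + Fr.bHi * s.1 :=
    max_le ((Fr.abs_snd_lindley_le h x hs.1).trans (by gcongr; simp))
      ((Fr.abs_snd_lindley_le h x' hs.1).trans (by gcongr; simp))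
  have e3 := mul_le_mul_of_nonneg_left e2 Fr.c_pos.le
  have e4 : Fr.c * (Fr.bHi * s.1) = (Fr.bLo - Fr.aHi) / 2 * s.1 := by rw [← mul_assoc, c_mul]
  unfold gauge drift
  linarith

theorem K_lindley_contract {t : ℝ} (ht : 0 ≤ t) {a b : ℝ} (h : Fr.Mem a b) (x x' : QState)
    {s : ℝ × ℝ} (hs : 0 ≤ s.1 ∧ 0 ≤ s.2)
    (hpos : 0 < x.1 - b * s.1 + a * s.2 ∨ 0 < x'.1 - b * s.1 + a * s.2) :
    Fr.K t (lindley a b x s) (lindley a b x' s)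
      ≤ Fr.K t x x' * Real.exp (t * Fr.drift s) := by
  rw [K, K, ← Real.exp_add, ← mul_add]
  exact Real.exp_le_exp.2 (mul_le_mul_of_nonneg_left (Fr.gauge_lindley_contract h x x' hs hpos) ht)

/-- The additive `1` is the weight of the empty state, reached whenever the queue does not stay
busy. -/
theorem V_lindley_le {t : ℝ} (ht : 0 ≤ t) {a b : ℝ} (h : Fr.Mem a b) (x : QState)
    {s : ℝ × ℝ} (hs : 0 ≤ s.1 ∧ 0 ≤ s.2) :
    Fr.V t (lindley a b x s) ≤ 1 + Fr.V t x * Real.exp (t * Fr.drift s) := by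
  rcases lt_or_ge 0 (x.1 - b * s.1 + a * s.2) with hp | hp
  · have := Fr.K_lindley_contract ht h x x hs (Or.inl hp)
    unfold V; linarith
  · rw [lindley_of_nonpos hp, V_zero]
    have := mul_pos (Fr.V_pos t x) (Real.exp_pos (t * Fr.drift s))
    linarith

theorem drift_le_growth {s : ℝ × ℝ} (hs : 0 ≤ s.1 ∧ 0 ≤ s.2) : Fr.drift s ≤ Fr.growth s := by
  have e5 := mul_nonneg Fr.aHi_pos.le hs.1
  have e6 := mul_nonneg Fr.bHi_pos.le hs.2
  have e7 := mul_nonneg Fr.bHi_pos.le hs.1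
  have e8 := mul_nonneg Fr.bLo_pos.le hs.1
  unfold drift growth
  linarith

theorem growth_nonneg {s : ℝ × ℝ} (hs : 0 ≤ s.1 ∧ 0 ≤ s.2) : 0 ≤ Fr.growth s :=
  mul_nonneg (by linarith [Fr.aHi_pos, Fr.bHi_pos]) (by linarith [hs.1, hs.2])

theorem integrable_exp_growth {t : ℝ} (ht : t ≤ Fr.t₀) :
    Integrable (fun s => Real.exp (t * Fr.growth s)) M.noise := by
  refine Fr.integ.mono' (by unfold growth; fun_prop) ?_
  filter_upwards [Fr.noise_nonneg] with s hs
  rw [Real.norm_eq_abs, Real.abs_exp]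
  exact Real.exp_le_exp.2 (mul_le_mul_of_nonneg_right ht (Fr.growth_nonneg hs))

theorem integrable_exp_drift {t : ℝ} (h0 : 0 ≤ t) (ht : t ≤ Fr.t₀) :
    Integrable (fun s => Real.exp (t * Fr.drift s)) M.noise := by
  refine (Fr.integrable_exp_growth ht).mono' (by unfold drift; fun_prop) ?_
  filter_upwards [Fr.noise_nonneg] with s hs
  rw [Real.norm_eq_abs, Real.abs_exp]
  exact Real.exp_le_exp.2 (mul_le_mul_of_nonneg_left (Fr.drift_le_growth hs) h0)

theorem rate_lt_one {t : ℝ} (h0 : 0 < t) (ht : t ≤ Fr.t₀) : Fr.rate t < 1 := Fr.contract t h0 ht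

theorem rate_nonneg (t : ℝ) : 0 ≤ Fr.rate t := integral_nonneg fun _ => (Real.exp_pos _).le

end Frame

/-! ### Weighted oscillation, geometric ergodicity and the Poisson equation. -/

/-- The transition operator of the queue with parameters `(a, b)`. -/
def T (M : QueueModel) (a b : ℝ) (F : QState → ℝ) : QState → ℝ :=
  fun x => ∫ s, F (lindley a b x s) ∂M.noise

/-- The limit of the expectations of `F` along the chain: its stationary mean. -/
def statMean (M : QueueModel) (a b : ℝ) (F : QState → ℝ) : ℝ :=
  limUnder atTop (fun n => (M.T a b)^[n] F (0, 0))

/-- The cumulated transient bias of `F`. -/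
def potential (M : QueueModel) (a b : ℝ) (F : QState → ℝ) (x : QState) : ℝ :=
  ∑' n : ℕ, ((M.T a b)^[n] F x - M.statMean a b F)

theorem measurable_T (a b : ℝ) {F : QState → ℝ} (hF : Measurable F) : Measurable (M.T a b F) :=
  (StronglyMeasurable.integral_prod_right (f := fun (x : QState) (s : ℝ × ℝ) => F (lindley a b x s))
    (hF.comp (measurable_lindley a b)).stronglyMeasurable).measurable

namespace Frame

variable (Fr : Frame M)

/-- Measurable functions whose oscillation is controlled by the weight `K t`. -/
structure Osc (t A : ℝ) (F : QState → ℝ) : Prop where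
  meas : Measurable F
  bound : ∀ x x', |F x - F x'| ≤ A * Fr.K t x x'

/-- Mean growth of the weight in one step. -/
def growthMean (t : ℝ) : ℝ := ∫ s, Real.exp (t * Fr.growth s) ∂M.noise

theorem growthMean_nonneg (t : ℝ) : 0 ≤ Fr.growthMean t :=
  integral_nonneg fun _ => (Real.exp_pos _).le

variable {Fr} {t A A' a b : ℝ} {F G : QState → ℝ}

theorem Osc.nonneg (h : Fr.Osc t A F) : 0 ≤ A := by
  have := h.bound (0, 0) (0, 0)
  rw [sub_self, abs_zero] at this
  exact nonneg_of_mul_nonneg_left this (Fr.K_pos _ _ _)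

theorem Osc.mono (h : Fr.Osc t A F) (hA : A ≤ A') : Fr.Osc t A' F :=
  ⟨h.meas, fun x x' => (h.bound x x').trans
    (mul_le_mul_of_nonneg_right hA (Fr.K_pos _ _ _).le)⟩

theorem Osc.sub (h : Fr.Osc t A F) (h' : Fr.Osc t A' G) :
    Fr.Osc t (A + A') (fun x => F x - G x) := by
  refine ⟨h.meas.sub h'.meas, fun x x' => ?_⟩
  calc |F x - G x - (F x' - G x')| = |(F x - F x') - (G x - G x')| := by ring_nf
    _ ≤ |F x - F x'| + |G x - G x'| := abs_sub _ _
    _ ≤ _ := by linarith [h.bound x x', h'.bound x x']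

theorem Osc.abs (h : Fr.Osc t A F) : Fr.Osc t A (fun x => |F x|) :=
  ⟨h.meas.abs, fun x x' => (abs_abs_sub_abs_le _ _).trans (h.bound x x')⟩

theorem osc_of_le (hF : Measurable F) (ht : 0 ≤ t) (hb : ∀ x, |F x| ≤ A * Fr.V t x) :
    Fr.Osc t (2 * A) F := by
  have hA : 0 ≤ A := by
    have := (abs_nonneg _).trans (hb (0, 0))
    exact nonneg_of_mul_nonneg_left this (Fr.V_pos _ _)
  refine ⟨hF, fun x x' => (abs_sub _ _).trans ?_⟩
  have h1 := mul_le_mul_of_nonneg_left (Fr.V_le_K_left ht x x') hA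
  have h2 := mul_le_mul_of_nonneg_left (Fr.V_le_K_right ht x x') hA
  linarith [hb x, hb x']

theorem Osc.abs_le (h : Fr.Osc t A F) (ht : 0 ≤ t) (x : QState) :
    |F x| ≤ (|F (0, 0)| + A) * Fr.V t x := by
  have h1 := h.bound x (0, 0)
  rw [Fr.K_zero_right] at h1
  have h2 := abs_sub_abs_le_abs_sub (F x) (F (0, 0))
  nlinarith [Fr.one_le_V ht x, abs_nonneg (F (0, 0))]

theorem integrable_K_lindley (ht : 0 ≤ t) (ht' : t ≤ Fr.t₀) {a' b' : ℝ} (hm : Fr.Mem a b)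
    (hm' : Fr.Mem a' b') (x x' : QState) :
    Integrable (fun s => Fr.K t (lindley a b x s) (lindley a' b' x' s)) M.noise := by
  refine ((Fr.integrable_exp_growth ht').const_mul (Fr.K t x x')).mono' ?_ ?_
  · exact (Measurable.comp (g := fun p : QState × QState => Fr.K t p.1 p.2)
      (by unfold K gauge; fun_prop) ((measurable_lindley_right a b x).prodMk
        (measurable_lindley_right a' b' x'))).aestronglyMeasurable
  · filter_upwards [Fr.noise_nonneg] with s hs
    rw [Real.norm_eq_abs, abs_of_pos (Fr.K_pos _ _ _)]
    exact Fr.K_lindley_le ht hm hm' x x' hs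

theorem Osc.integrable (h : Fr.Osc t A F) (ht : 0 ≤ t) (ht' : t ≤ Fr.t₀) (hm : Fr.Mem a b)
    (x : QState) : Integrable (fun s => F (lindley a b x s)) M.noise := by
  refine ((integrable_K_lindley ht ht' hm hm x x).const_mul (|F (0, 0)| + A)).mono'
    (h.meas.comp (measurable_lindley_right a b x)).aestronglyMeasurable ?_
  exact ae_of_all _ fun s => h.abs_le ht _

/-- Synchronous coupling: the same noise drives both starting points. If both queues empty, the next
states are equal and the difference vanishes; otherwise the weight contracts by `exp (t * drift)`.
Because the first case costs nothing, the seminorm contracts strictly. -/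
theorem Osc.T (h : Fr.Osc t A F) (ht : 0 ≤ t) (ht' : t ≤ Fr.t₀) (hm : Fr.Mem a b) :
    Fr.Osc t (Fr.rate t * A) (M.T a b F) := by
  refine ⟨measurable_T a b h.meas, fun x x' => ?_⟩
  rw [QueueModel.T, QueueModel.T, ← integral_sub (h.integrable ht ht' hm x) (h.integrable ht ht' hm x')]
  rw [← Real.norm_eq_abs]
  refine (norm_integral_le_of_norm_le (g := fun s => A * Fr.K t x x' * Real.exp (t * Fr.drift s))
    ((Fr.integrable_exp_drift ht ht').const_mul _) ?_).trans ?_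
  · filter_upwards [Fr.noise_nonneg] with s hs
    rw [Real.norm_eq_abs]
    by_cases hp : 0 < x.1 - b * s.1 + a * s.2 ∨ 0 < x'.1 - b * s.1 + a * s.2
    · refine (h.bound _ _).trans ?_
      rw [mul_assoc]
      exact mul_le_mul_of_nonneg_left (Fr.K_lindley_contract ht hm x x' hs hp) h.nonneg
    · push Not at hp
      rw [lindley_of_nonpos hp.1, lindley_of_nonpos hp.2, sub_self, abs_zero]
      have := h.nonneg
      have := Fr.K_pos t x x'
      positivity
  · rw [integral_const_mul]
    unfold rate
    linarith

theorem Osc.iterate (h : Fr.Osc t A F) (ht : 0 ≤ t) (ht' : t ≤ Fr.t₀) (hm : Fr.Mem a b) (n : ℕ) :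
    Fr.Osc t (Fr.rate t ^ n * A) ((M.T a b)^[n] F) := by
  induction n with
  | zero => simpa using h
  | succ n ih =>
    rw [Function.iterate_succ_apply', pow_succ', mul_assoc]
    exact ih.T ht ht' hm

theorem T_sub (h : Fr.Osc t A F) (h' : Fr.Osc t A' G) (ht : 0 ≤ t) (ht' : t ≤ Fr.t₀)
    (hm : Fr.Mem a b) :
    M.T a b (fun x => F x - G x) = fun x => M.T a b F x - M.T a b G x :=
  funext fun x => integral_sub (h.integrable ht ht' hm x) (h'.integrable ht ht' hm x)

theorem T_const (a b k : ℝ) : M.T a b (fun _ => k) = fun _ => k := by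
  funext x
  simp [QueueModel.T]

theorem iterate_const (a b k : ℝ) (n : ℕ) : (M.T a b)^[n] (fun _ => k) = fun _ => k :=
  Function.iterate_fixed (T_const a b k) n

theorem osc_const (k : ℝ) : Fr.Osc t 0 (fun _ => k) :=
  ⟨measurable_const, fun x x' => by simp⟩

theorem iterate_sub (h : Fr.Osc t A F) (h' : Fr.Osc t A' G) (ht : 0 ≤ t) (ht' : t ≤ Fr.t₀)
    (hm : Fr.Mem a b) (n : ℕ) :
    (M.T a b)^[n] (fun x => F x - G x) = fun x => (M.T a b)^[n] F x - (M.T a b)^[n] G x := by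
  induction n with
  | zero => rfl
  | succ n ih =>
    rw [Function.iterate_succ_apply', ih,
      T_sub (h.iterate ht ht' hm n) (h'.iterate ht ht' hm n) ht ht' hm]
    simp only [Function.iterate_succ_apply']

theorem T_mono (h : Fr.Osc t A F) (h' : Fr.Osc t A' G) (ht : 0 ≤ t) (ht' : t ≤ Fr.t₀)
    (hm : Fr.Mem a b) (hFG : ∀ x, F x ≤ G x) (x : QState) : M.T a b F x ≤ M.T a b G x :=
  integral_mono (h.integrable ht ht' hm x) (h'.integrable ht ht' hm x) fun _ => hFG _

theorem iterate_mono (h : Fr.Osc t A F) (h' : Fr.Osc t A' G) (ht : 0 ≤ t) (ht' : t ≤ Fr.t₀)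
    (hm : Fr.Mem a b) (hFG : ∀ x, F x ≤ G x) (n : ℕ) (x : QState) :
    (M.T a b)^[n] F x ≤ (M.T a b)^[n] G x := by
  induction n generalizing x with
  | zero => exact hFG x
  | succ n ih =>
    simp only [Function.iterate_succ_apply']
    exact T_mono (h.iterate ht ht' hm n) (h'.iterate ht ht' hm n) ht ht' hm ih x

theorem T_const_mul (a b k : ℝ) (F : QState → ℝ) :
    M.T a b (fun x => k * F x) = fun x => k * M.T a b F x :=
  funext fun _ => integral_const_mul _ _

theorem iterate_const_mul (a b k : ℝ) (F : QState → ℝ) (n : ℕ) :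
    (M.T a b)^[n] (fun x => k * F x) = fun x => k * (M.T a b)^[n] F x := by
  induction n with
  | zero => rfl
  | succ n ih => simp only [Function.iterate_succ_apply', ih, T_const_mul]

theorem osc_V (ht : 0 ≤ t) : Fr.Osc t 1 (Fr.V t) := by
  refine ⟨Fr.measurable_V t, fun x x' => ?_⟩
  have h1 := Fr.V_le_K_left ht x x'
  have h2 := Fr.V_le_K_right ht x x'
  rw [one_mul, abs_le]
  constructor <;> linarith [Fr.V_pos t x, Fr.V_pos t x']

theorem T_V_le (ht : 0 ≤ t) (ht' : t ≤ Fr.t₀) (hm : Fr.Mem a b) (x : QState) :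
    M.T a b (Fr.V t) x ≤ 1 + Fr.rate t * Fr.V t x := by
  calc M.T a b (Fr.V t) x ≤ ∫ s, (1 + Fr.V t x * Real.exp (t * Fr.drift s)) ∂M.noise := by
        refine integral_mono_ae ((osc_V ht).integrable ht ht' hm x)
          ((integrable_const _).add ((Fr.integrable_exp_drift ht ht').const_mul _)) ?_
        filter_upwards [Fr.noise_nonneg] with s hs
        exact Fr.V_lindley_le ht hm x hs
    _ = _ := by
        rw [integral_add (integrable_const _) ((Fr.integrable_exp_drift ht ht').const_mul _),
          integral_const_mul]
        simp [rate, mul_comm]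

theorem iterate_V_le (ht : 0 < t) (ht' : t ≤ Fr.t₀) (hm : Fr.Mem a b) (n : ℕ) (x : QState) :
    (M.T a b)^[n] (Fr.V t) x ≤ (1 - Fr.rate t)⁻¹ * Fr.V t x := by
  have hr := Fr.rate_lt_one ht ht'
  have hr' : 0 < 1 - Fr.rate t := by linarith
  have hi : (1 - Fr.rate t) * (1 - Fr.rate t)⁻¹ = 1 := mul_inv_cancel₀ hr'.ne'
  have hpos : 0 < (1 - Fr.rate t)⁻¹ := inv_pos.2 hr'
  -- The claimed bound does not pass through the induction by itself. The exact solution of the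
  -- recursion `v ↦ 1 + rate * v` does, and it implies the claim because `V ≥ 1`.
  suffices h : (M.T a b)^[n] (Fr.V t) x
      ≤ Fr.rate t ^ n * Fr.V t x + (1 - Fr.rate t ^ n) * (1 - Fr.rate t)⁻¹ by
    have h1 := Fr.one_le_V ht.le x
    have h2 : Fr.rate t ^ n ≤ 1 := pow_le_one₀ (Fr.rate_nonneg t) hr.le
    have h3 : 0 ≤ Fr.rate t ^ n := pow_nonneg (Fr.rate_nonneg t) n
    have h4 : 1 ≤ (1 - Fr.rate t)⁻¹ := (one_le_inv₀ hr').2 (by linarith [Fr.rate_nonneg t])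
    have h5 : Fr.rate t ^ n * Fr.V t x ≤ Fr.rate t ^ n * (1 - Fr.rate t)⁻¹ * Fr.V t x := by
      rw [mul_assoc]
      exact mul_le_mul_of_nonneg_left (by nlinarith) h3
    have h6 : (1 - Fr.rate t ^ n) * (1 - Fr.rate t)⁻¹
        ≤ (1 - Fr.rate t ^ n) * (1 - Fr.rate t)⁻¹ * Fr.V t x :=
      le_mul_of_one_le_right (mul_nonneg (by linarith) hpos.le) h1
    nlinarith
  induction n generalizing x with
  | zero => simp
  | succ n ih =>
    rw [Function.iterate_succ_apply']
    have hV := osc_V (Fr := Fr) ht.le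
    have hle : M.T a b ((M.T a b)^[n] (Fr.V t)) x
        ≤ ∫ s, (Fr.rate t ^ n * Fr.V t (lindley a b x s)
          + (1 - Fr.rate t ^ n) * (1 - Fr.rate t)⁻¹) ∂M.noise :=
      integral_mono ((hV.iterate ht.le ht' hm n).integrable ht.le ht' hm x)
        (((hV.integrable ht.le ht' hm x).const_mul _).add (integrable_const _)) fun _ => ih _
    refine hle.trans ?_
    rw [integral_add ((hV.integrable ht.le ht' hm x).const_mul _) (integrable_const _),
      integral_const_mul]
    have h1 := mul_le_mul_of_nonneg_left (T_V_le ht.le ht' hm x) (pow_nonneg (Fr.rate_nonneg t) n)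
    simp only [QueueModel.T] at h1
    simp only [integral_const, probReal_univ, smul_eq_mul, one_mul]
    have h2 : (1 - Fr.rate t ^ (n + 1)) * (1 - Fr.rate t)⁻¹
        = Fr.rate t ^ n + (1 - Fr.rate t ^ n) * (1 - Fr.rate t)⁻¹ := by
      rw [pow_succ]
      linear_combination (Fr.rate t ^ n) * hi
    rw [h2, pow_succ]
    linarith

theorem K_lindley_self_le (ht : 0 ≤ t) (hm : Fr.Mem a b) (x : QState) {s : ℝ × ℝ}
    (hs : 0 ≤ s.1 ∧ 0 ≤ s.2) :
    Fr.K t (lindley a b x s) x ≤ Fr.V t x * Real.exp (t * Fr.growth s) := by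
  rw [K, V, K, ← Real.exp_add, ← mul_add]
  refine Real.exp_le_exp.2 (mul_le_mul_of_nonneg_left ?_ ht)
  have e1 : max |(lindley a b x s).1| |x.1| ≤ |x.1| + Fr.aHi * s.2 :=
    max_le (Fr.abs_fst_lindley_le hm x hs)
      (le_add_of_nonneg_right (mul_nonneg Fr.aHi_pos.le hs.2))
  have e2 : max |(lindley a b x s).2| |x.2| ≤ |x.2| + Fr.bHi * s.1 :=
    max_le (Fr.abs_snd_lindley_le hm x hs.1)
      (le_add_of_nonneg_right (mul_nonneg Fr.bHi_pos.le hs.1))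
  have e3 := mul_le_mul_of_nonneg_left e2 Fr.c_pos.le
  have e4 := mul_le_mul_of_nonneg_right Fr.c_mul_le hs.1
  have e5 := mul_nonneg Fr.aHi_pos.le hs.1
  have e6 := mul_nonneg Fr.bHi_pos.le hs.2
  simp only [gauge, growth, max_self] at *
  linarith

/-- Applied to `T^n F`, whose oscillation is at most `rate ^ n * A`, this makes the iterates a
Cauchy sequence with geometric increments, so that the limit defining `statMean` exists. -/
theorem Osc.abs_T_sub_le (h : Fr.Osc t A F) (ht : 0 ≤ t) (ht' : t ≤ Fr.t₀) (hm : Fr.Mem a b)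
    (x : QState) : |M.T a b F x - F x| ≤ A * Fr.growthMean t * Fr.V t x := by
  have h1 : M.T a b F x - F x = ∫ s, (F (lindley a b x s) - F x) ∂M.noise := by
    rw [integral_sub (h.integrable ht ht' hm x) (integrable_const _)]
    simp [QueueModel.T]
  rw [h1]
  rw [← Real.norm_eq_abs]
  refine (norm_integral_le_of_norm_le (g := fun s => A * Fr.V t x * Real.exp (t * Fr.growth s))
    ((Fr.integrable_exp_growth ht').const_mul _) ?_).trans ?_
  · filter_upwards [Fr.noise_nonneg] with s hs
    rw [Real.norm_eq_abs, mul_assoc]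
    exact (h.bound _ _).trans
      (mul_le_mul_of_nonneg_left (K_lindley_self_le ht hm x hs) h.nonneg)
  · rw [integral_const_mul]
    unfold growthMean
    linarith

/-- Constant of the geometric convergence towards the stationary mean. -/
def convConst (Fr : Frame M) (t : ℝ) : ℝ := Fr.growthMean t * (1 - Fr.rate t)⁻¹

theorem convConst_nonneg (ht : 0 < t) (ht' : t ≤ Fr.t₀) : 0 ≤ Fr.convConst t :=
  mul_nonneg (Fr.growthMean_nonneg t) (inv_nonneg.2 (by linarith [Fr.rate_lt_one ht ht']))

theorem Osc.dist_iterate_le (h : Fr.Osc t A F) (ht : 0 ≤ t) (ht' : t ≤ Fr.t₀) (hm : Fr.Mem a b)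
    (x : QState) (n : ℕ) : dist ((M.T a b)^[n] F x) ((M.T a b)^[n + 1] F x)
      ≤ A * Fr.growthMean t * Fr.V t x * Fr.rate t ^ n := by
  have := (h.iterate ht ht' hm n).abs_T_sub_le ht ht' hm x
  rw [dist_comm, Real.dist_eq, Function.iterate_succ_apply']
  linarith

theorem Osc.tendsto_zero (h : Fr.Osc t A F) (ht : 0 < t) (ht' : t ≤ Fr.t₀) (hm : Fr.Mem a b) :
    Tendsto (fun n => (M.T a b)^[n] F (0, 0)) atTop (𝓝 (M.statMean a b F)) :=
  (cauchySeq_of_le_geometric _ _ (Fr.rate_lt_one ht ht')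
    (h.dist_iterate_le ht.le ht' hm (0, 0))).tendsto_limUnder

theorem Osc.tendsto (h : Fr.Osc t A F) (ht : 0 < t) (ht' : t ≤ Fr.t₀) (hm : Fr.Mem a b)
    (x : QState) :
    Tendsto (fun n => (M.T a b)^[n] F x) atTop (𝓝 (M.statMean a b F)) := by
  have h1 : Tendsto (fun n => (M.T a b)^[n] F x - (M.T a b)^[n] F (0, 0)) atTop (𝓝 0) := by
    refine squeeze_zero_norm
      (fun n => (h.iterate ht.le ht' hm n).bound x (0, 0)) ?_
    have := tendsto_pow_atTop_nhds_zero_of_lt_one (Fr.rate_nonneg t) (Fr.rate_lt_one ht ht')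
    simpa [mul_assoc] using this.mul_const (A * Fr.K t x (0, 0))
  simpa using h1.add (h.tendsto_zero ht ht' hm)

theorem Osc.abs_iterate_sub_le (h : Fr.Osc t A F) (ht : 0 < t) (ht' : t ≤ Fr.t₀)
    (hm : Fr.Mem a b) (n : ℕ) (x : QState) :
    |(M.T a b)^[n] F x - M.statMean a b F|
      ≤ A * Fr.convConst t * Fr.V t x * Fr.rate t ^ n := by
  have := dist_le_of_le_geometric_of_tendsto _ _ (Fr.rate_lt_one ht ht')
    (h.dist_iterate_le ht.le ht' hm x) (h.tendsto ht ht' hm x) n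
  rw [Real.dist_eq] at this
  refine this.trans (le_of_eq ?_)
  rw [convConst, div_eq_mul_inv]
  ring

theorem statMean_eq (h : Fr.Osc t A F) (ht : 0 < t) (ht' : t ≤ Fr.t₀) (hm : Fr.Mem a b)
    {l : ℝ} {x : QState} (hl : Tendsto (fun n => (M.T a b)^[n] F x) atTop (𝓝 l)) :
    M.statMean a b F = l :=
  tendsto_nhds_unique (h.tendsto ht ht' hm x) hl

theorem statMean_sub (h : Fr.Osc t A F) (h' : Fr.Osc t A' G) (ht : 0 < t) (ht' : t ≤ Fr.t₀)
    (hm : Fr.Mem a b) :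
    M.statMean a b (fun x => F x - G x) = M.statMean a b F - M.statMean a b G := by
  refine statMean_eq (h.sub h') ht ht' hm (x := (0, 0)) ?_
  simp only [iterate_sub h h' ht.le ht' hm]
  exact (h.tendsto ht ht' hm _).sub (h'.tendsto ht ht' hm _)

theorem statMean_T (h : Fr.Osc t A F) (ht : 0 < t) (ht' : t ≤ Fr.t₀) (hm : Fr.Mem a b) :
    M.statMean a b (M.T a b F) = M.statMean a b F := by
  refine statMean_eq (h.T ht.le ht' hm) ht ht' hm (x := (0, 0)) ?_
  exact (tendsto_add_atTop_iff_nat 1).2 (h.tendsto ht ht' hm (0, 0))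

theorem statMean_const (k : ℝ) : M.statMean a b (fun _ => k) = k := by
  simp only [statMean, iterate_const]
  exact tendsto_const_nhds.limUnder_eq

/-- A function bounded by the Lyapunov function has a bounded stationary mean. -/
theorem abs_iterate_le (hF : Measurable F) (ht : 0 < t) (ht' : t ≤ Fr.t₀) (hm : Fr.Mem a b)
    (hb : ∀ x, |F x| ≤ A * Fr.V t x) (n : ℕ) (x : QState) :
    |(M.T a b)^[n] F x| ≤ A * ((1 - Fr.rate t)⁻¹ * Fr.V t x) := by
  have hA : 0 ≤ A := nonneg_of_mul_nonneg_left ((abs_nonneg _).trans (hb (0, 0))) (Fr.V_pos _ _)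
  have hO := osc_of_le hF ht.le hb
  have hV : Fr.Osc t (2 * A) (fun x => A * Fr.V t x) :=
    osc_of_le ((Fr.measurable_V t).const_mul A) ht.le fun x => by
      rw [abs_of_nonneg (mul_nonneg hA (Fr.V_pos t x).le)]
  have hV' : Fr.Osc t (2 * A) (fun x => -A * Fr.V t x) :=
    osc_of_le ((Fr.measurable_V t).const_mul (-A)) ht.le fun x => by
      rw [neg_mul, abs_neg, abs_of_nonneg (mul_nonneg hA (Fr.V_pos t x).le)]
  have h1 := iterate_mono hO hV ht.le ht' hm (fun x => (abs_le.1 (hb x)).2) n x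
  have h2 := iterate_mono hV' hO ht.le ht' hm
    (fun x => by rw [neg_mul]; exact (abs_le.1 (hb x)).1) n x
  rw [iterate_const_mul] at h1 h2
  have h3 := mul_le_mul_of_nonneg_left (iterate_V_le ht ht' hm n x) hA
  rw [abs_le]
  constructor <;> linarith

theorem Osc.summable (h : Fr.Osc t A F) (ht : 0 < t) (ht' : t ≤ Fr.t₀) (hm : Fr.Mem a b)
    (x : QState) : Summable fun n => |(M.T a b)^[n] F x - M.statMean a b F| :=
  Summable.of_nonneg_of_le (fun _ => abs_nonneg _)
    (fun n => h.abs_iterate_sub_le ht ht' hm n x)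
    ((summable_geometric_of_lt_one (Fr.rate_nonneg t) (Fr.rate_lt_one ht ht')).mul_left _)

/-- In the difference of two values of the series the stationary means cancel, and the contracted
oscillations sum to a geometric series. Thus no convergence constant enters. -/
theorem Osc.potential (h : Fr.Osc t A F) (ht : 0 < t) (ht' : t ≤ Fr.t₀) (hm : Fr.Mem a b) :
    Fr.Osc t (A * (1 - Fr.rate t)⁻¹) (M.potential a b F) := by
  have hs := fun x => (h.summable ht ht' hm x).of_abs
  refine ⟨?_, fun x x' => ?_⟩
  · exact measurable_of_tendsto_metrizable (f := fun n x => ∑ i ∈ Finset.range n,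
      ((M.T a b)^[i] F x - M.statMean a b F))
      (fun n => Finset.measurable_sum _ fun i _ =>
        (h.iterate ht.le ht' hm i).meas.sub_const _)
      (tendsto_pi_nhds.2 fun x => (hs x).hasSum.tendsto_sum_nat)
  · rw [QueueModel.potential, QueueModel.potential, ← (hs x).tsum_sub (hs x'),
      ← Real.norm_eq_abs]
    refine tsum_of_norm_bounded (g := fun n => Fr.rate t ^ n * (A * Fr.K t x x')) ?_ fun n => ?_
    · have := (hasSum_geometric_of_lt_one (Fr.rate_nonneg t) (Fr.rate_lt_one ht ht')).mul_right
        (A * Fr.K t x x')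
      rw [show A * (1 - Fr.rate t)⁻¹ * Fr.K t x x' = (1 - Fr.rate t)⁻¹ * (A * Fr.K t x x') by ring]
      exact this
    · rw [Real.norm_eq_abs]
      have := (h.iterate ht.le ht' hm n).bound x x'
      calc _ = |(M.T a b)^[n] F x - (M.T a b)^[n] F x'| := by ring_nf
        _ ≤ _ := by linarith

theorem Osc.abs_potential_le (h : Fr.Osc t A F) (ht : 0 < t) (ht' : t ≤ Fr.t₀) (hm : Fr.Mem a b)
    (x : QState) :
    |M.potential a b F x| ≤ A * Fr.convConst t * (1 - Fr.rate t)⁻¹ * Fr.V t x := by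
  rw [QueueModel.potential, ← Real.norm_eq_abs]
  refine tsum_of_norm_bounded (g := fun n => A * Fr.convConst t * Fr.V t x * Fr.rate t ^ n) ?_
    fun n => h.abs_iterate_sub_le ht ht' hm n x
  have := (hasSum_geometric_of_lt_one (Fr.rate_nonneg t) (Fr.rate_lt_one ht ht')).mul_left
    (A * Fr.convConst t * Fr.V t x)
  rw [show A * Fr.convConst t * (1 - Fr.rate t)⁻¹ * Fr.V t x
    = A * Fr.convConst t * Fr.V t x * (1 - Fr.rate t)⁻¹ by ring]
  exact this

/-- The potential solves the Poisson equation. -/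
theorem T_potential (h : Fr.Osc t A F) (ht : 0 < t) (ht' : t ≤ Fr.t₀) (hm : Fr.Mem a b)
    (x : QState) :
    M.T a b (M.potential a b F) x = M.potential a b F x - (F x - M.statMean a b F) := by
  have hs := fun x => (h.summable ht ht' hm x).of_abs
  have hV := osc_V (Fr := Fr) ht.le
  have h1 : HasSum (fun n => ∫ s, ((M.T a b)^[n] F (lindley a b x s) - M.statMean a b F) ∂M.noise)
      (M.T a b (M.potential a b F) x) := by
    refine hasSum_integral_of_dominated_convergence
      (fun n s => A * Fr.convConst t * Fr.V t (lindley a b x s) * Fr.rate t ^ n) ?_ ?_ ?_ ?_ ?_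
    · exact fun n => (((h.iterate ht.le ht' hm n).meas.comp
        (measurable_lindley_right a b x)).sub_const _).aestronglyMeasurable
    · exact fun n => ae_of_all _ fun s => h.abs_iterate_sub_le ht ht' hm n _
    · exact ae_of_all _ fun s =>
        (summable_geometric_of_lt_one (Fr.rate_nonneg t) (Fr.rate_lt_one ht ht')).mul_left _
    · simp only [tsum_mul_left]
      exact ((hV.integrable ht.le ht' hm x).const_mul _).mul_const _
    · exact ae_of_all _ fun s => (hs _).hasSum
  have h2 : ∀ n, ∫ s, ((M.T a b)^[n] F (lindley a b x s) - M.statMean a b F) ∂M.noise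
      = (M.T a b)^[n + 1] F x - M.statMean a b F := by
    intro n
    rw [integral_sub ((h.iterate ht.le ht' hm n).integrable ht.le ht' hm x) (integrable_const _),
      Function.iterate_succ_apply']
    simp [QueueModel.T]
  simp only [h2] at h1
  -- Applying `T` shifts the series by one index, so exactly the zeroth term `F x - statMean` is
  -- lost.
  have h3 := (hasSum_nat_add_iff' 1).2 (hs x).hasSum
  rw [h1.unique h3]
  simp [QueueModel.potential]

/-- By iterating the Poisson equation, `T^n` of the potential is the potential minus the first `n`
terms of its own series. This is a tail, and it tends to zero. -/
theorem statMean_potential (h : Fr.Osc t A F) (ht : 0 < t) (ht' : t ≤ Fr.t₀) (hm : Fr.Mem a b) :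
    M.statMean a b (M.potential a b F) = 0 := by
  have hs := fun x => (h.summable ht ht' hm x).of_abs
  have hP := h.potential ht ht' hm
  have hc := osc_const (Fr := Fr) (t := t) (M.statMean a b F)
  have key : ∀ n x, (M.T a b)^[n] (M.potential a b F) x = M.potential a b F x
      - ∑ i ∈ Finset.range n, ((M.T a b)^[i] F x - M.statMean a b F) := by
    intro n
    induction n with
    | zero => simp
    | succ n ih =>
      intro x
      have h1 : M.T a b (M.potential a b F)
          = fun x => M.potential a b F x - (F x - M.statMean a b F) :=
        funext fun x => T_potential h ht ht' hm x
      rw [Function.iterate_succ_apply, h1, iterate_sub hP (h.sub hc) ht.le ht' hm,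
        iterate_sub h hc ht.le ht' hm]
      simp only [iterate_const]
      rw [ih, Finset.sum_range_succ]
      ring
  refine statMean_eq hP ht ht' hm (x := (0, 0)) ?_
  simp only [key]
  have := (hs (0, 0)).hasSum.tendsto_sum_nat.const_sub (M.potential a b F (0, 0))
  simpa [QueueModel.potential] using this

end Frame

/-! ### Weighted Lipschitz bounds: smoothing by the density of the service time. -/

/-- The `ℓ¹` distance between two states. -/
def dist₁ (x x' : QState) : ℝ := |x.1 - x'.1| + |x.2 - x'.2|

theorem dist₁_nonneg (x x' : QState) : 0 ≤ dist₁ x x' := by unfold dist₁; positivity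

/-- While both queues stay busy the step is a translation of the state, depending linearly on the
parameters. With equal parameters it preserves the distance. -/
theorem dist₁_lindley_le {a b a' b' : ℝ} {x x' : QState} {s : ℝ × ℝ} (hs : 0 ≤ s.1 ∧ 0 ≤ s.2)
    (h : 0 < x.1 - b * s.1 + a * s.2) (h' : 0 < x'.1 - b' * s.1 + a' * s.2) :
    dist₁ (lindley a b x s) (lindley a' b' x' s)
      ≤ dist₁ x x' + 2 * (|a - a'| + |b - b'|) * (s.1 + s.2) := by
  rw [lindley_of_pos h, lindley_of_pos h']
  simp only [dist₁]
  have e1 : |x.1 - b * s.1 + a * s.2 - (x'.1 - b' * s.1 + a' * s.2)|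
      ≤ |x.1 - x'.1| + |b - b'| * s.1 + |a - a'| * s.2 := by
    calc _ = |(x.1 - x'.1) + (-((b - b') * s.1)) + (a - a') * s.2| := by ring_nf
      _ ≤ _ := (abs_add_three _ _ _).trans (by
        rw [abs_neg, abs_mul, abs_mul, abs_of_nonneg hs.1, abs_of_nonneg hs.2])
  have e2 : |x.2 + b * s.1 - (x'.2 + b' * s.1)| ≤ |x.2 - x'.2| + |b - b'| * s.1 := by
    calc _ = |(x.2 - x'.2) + (b - b') * s.1| := by ring_nf
      _ ≤ _ := (abs_add_le _ _).trans (by rw [abs_mul, abs_of_nonneg hs.1])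
  nlinarith [mul_nonneg (abs_nonneg (a - a')) hs.1, mul_nonneg (abs_nonneg (a - a')) hs.2,
    mul_nonneg (abs_nonneg (b - b')) hs.1, mul_nonneg (abs_nonneg (b - b')) hs.2]

namespace Frame

variable (Fr : Frame M)

theorem lawV_uIcc_le (l u : ℝ) : M.lawV.real (Set.uIcc l u) ≤ Fr.D * |u - l| := by
  have h := Fr.density (Set.uIcc l u)
  rw [Measure.smul_apply, Real.volume_interval] at h
  refine ENNReal.toReal_le_of_le_ofReal (by positivity) (h.trans (le_of_eq ?_))
  rw [ENNReal.ofReal_mul Fr.D.coe_nonneg, ENNReal.ofReal_coe_nnreal]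
  rfl

/-- Indicator that the service time lies between two thresholds depending on the interarrival
time. -/
def between (l u : ℝ → ℝ) (s : ℝ × ℝ) : ℝ :=
  (Set.uIcc (l s.1) (u s.1)).indicator (fun _ => 1) s.2

theorem between_nonneg (l u : ℝ → ℝ) (s : ℝ × ℝ) : 0 ≤ between l u s :=
  Set.indicator_nonneg (fun _ _ => zero_le_one) _

theorem between_le_one (l u : ℝ → ℝ) (s : ℝ × ℝ) : between l u s ≤ 1 :=
  Set.indicator_le_self' (fun _ _ => zero_le_one) _

theorem measurable_between {l u : ℝ → ℝ} (hl : Measurable l) (hu : Measurable u) :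
    Measurable (between l u) := by
  have h : MeasurableSet {s : ℝ × ℝ | s.2 ∈ Set.uIcc (l s.1) (u s.1)} :=
    (measurableSet_le ((hl.comp measurable_fst).min (hu.comp measurable_fst))
      measurable_snd).inter (measurableSet_le measurable_snd
        ((hl.comp measurable_fst).max (hu.comp measurable_fst)))
  exact (measurable_const (a := (1 : ℝ))).indicator h

theorem integrable_mul_between {l u f : ℝ → ℝ} (hl : Measurable l) (hu : Measurable u)
    (hfi : Integrable (fun s => f s.1) M.noise) :
    Integrable (fun s => f s.1 * between l u s) M.noise := by
  refine hfi.norm.mono' (hfi.aestronglyMeasurable.mul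
    (measurable_between hl hu).aestronglyMeasurable) (ae_of_all _ fun s => ?_)
  rw [norm_mul, Real.norm_eq_abs (between l u s), abs_of_nonneg (between_nonneg l u s)]
  exact mul_le_of_le_one_right (norm_nonneg _) (between_le_one l u s)

/-- Smoothing by the bounded density of the service time. -/
theorem integral_mul_between_le {l u f g : ℝ → ℝ} (hl : Measurable l) (hu : Measurable u)
    (hf : ∀ v, 0 ≤ f v) (hfi : Integrable (fun s => f s.1) M.noise)
    (hg : ∀ v, 0 ≤ v → |u v - l v| ≤ g v) (hgi : Integrable (fun s => f s.1 * g s.1) M.noise) :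
    ∫ s, f s.1 * between l u s ∂M.noise ≤ Fr.D * ∫ s, f s.1 * g s.1 ∂M.noise := by
  have hi := integrable_mul_between hl hu hfi
  rw [integral_prod _ hi, integral_prod _ hgi, ← integral_const_mul]
  refine integral_mono_ae hi.integral_prod_left (hgi.integral_prod_left.const_mul _) ?_
  filter_upwards [Fr.U_nonneg] with v hv
  simp only [integral_const_mul, between, integral_const, probReal_univ, smul_eq_mul, one_mul]
  rw [integral_indicator_const _ measurableSet_uIcc, smul_eq_mul, mul_one]
  have h1 := mul_le_mul_of_nonneg_left ((Fr.lawV_uIcc_le (l v) (u v)).trans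
    (mul_le_mul_of_nonneg_left (hg v hv) Fr.D.coe_nonneg)) (hf v)
  linarith

/-- Ratio between the exponents used for Lipschitz and for oscillation bounds. -/
def kap : ℝ := 1 + Fr.aHi / Fr.aLo

theorem one_le_kap : 1 ≤ Fr.kap := by
  have := div_nonneg Fr.aHi_pos.le Fr.aLo_pos.le
  unfold kap; linarith

theorem kap_pos : 0 < Fr.kap := zero_lt_one.trans_le Fr.one_le_kap

variable {Fr} {θ A L a b a' b' : ℝ} {F : QState → ℝ}

/-- If one of the queues empties, its `V` cannot exceed `(bHi * U + max w) / aLo`. Replacing `aHi *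
V` by this bound costs the factor `kap` and leaves an estimate free of `V`, so that `V` can still be
integrated against its density. -/
theorem gauge_lindley_of_sign_change (hm : Fr.Mem a b) (hm' : Fr.Mem a' b') {x x' : QState}
    {s : ℝ × ℝ} (hs : 0 ≤ s.1 ∧ 0 ≤ s.2)
    (h : x.1 - b * s.1 + a * s.2 ≤ 0 ∨ x'.1 - b' * s.1 + a' * s.2 ≤ 0) :
    Fr.gauge (lindley a b x s) (lindley a' b' x' s)
      ≤ Fr.kap * Fr.gauge x x' + Fr.kap * (Fr.bHi * s.1) := by
  have hV : Fr.aLo * s.2 ≤ Fr.bHi * s.1 + max |x.1| |x'.1| := by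
    rcases h with h | h
    · have h1 : Fr.aLo * s.2 ≤ a * s.2 := mul_le_mul_of_nonneg_right hm.a_lo hs.2
      have h2 : b * s.1 ≤ Fr.bHi * s.1 := mul_le_mul_of_nonneg_right hm.b_hi hs.1
      linarith [neg_abs_le x.1, le_max_left |x.1| |x'.1|]
    · have h1 : Fr.aLo * s.2 ≤ a' * s.2 := mul_le_mul_of_nonneg_right hm'.a_lo hs.2
      have h2 : b' * s.1 ≤ Fr.bHi * s.1 := mul_le_mul_of_nonneg_right hm'.b_hi hs.1
      linarith [neg_abs_le x'.1, le_max_right |x.1| |x'.1|]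
  have hV' : Fr.aHi * s.2 ≤ (Fr.kap - 1) * (Fr.bHi * s.1 + max |x.1| |x'.1|) := by
    have e : Fr.aHi * s.2 = (Fr.kap - 1) * (Fr.aLo * s.2) := by
      have := Fr.aLo_pos.ne'
      unfold kap
      field_simp
      ring
    rw [e]
    exact mul_le_mul_of_nonneg_left hV (by linarith [Fr.one_le_kap])
  have e1 : max |(lindley a b x s).1| |(lindley a' b' x' s).1|
      ≤ max |x.1| |x'.1| + Fr.aHi * s.2 :=
    max_le ((Fr.abs_fst_lindley_le hm x hs).trans (by gcongr; simp))
      ((Fr.abs_fst_lindley_le hm' x' hs).trans (by gcongr; simp))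
  have e2 : max |(lindley a b x s).2| |(lindley a' b' x' s).2|
      ≤ max |x.2| |x'.2| + Fr.bHi * s.1 :=
    max_le ((Fr.abs_snd_lindley_le hm x hs.1).trans (by gcongr; simp))
      ((Fr.abs_snd_lindley_le hm' x' hs.1).trans (by gcongr; simp))
  have e3 := mul_le_mul_of_nonneg_left e2 Fr.c_pos.le
  have e4 := mul_le_mul_of_nonneg_right Fr.c_mul_le hs.1
  have e5 : 0 ≤ Fr.c * max |x.2| |x'.2| := mul_nonneg Fr.c_pos.le (by positivity)
  have e6 : Fr.c * max |x.2| |x'.2| ≤ Fr.kap * (Fr.c * max |x.2| |x'.2|) :=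
    le_mul_of_one_le_left e5 Fr.one_le_kap
  unfold gauge
  linarith

theorem mem_uIcc_of_sign_change (hm : Fr.Mem a b) (hm' : Fr.Mem a' b') {x x' : QState}
    {s : ℝ × ℝ}
    (h : (0 < x.1 - b * s.1 + a * s.2 ∧ x'.1 - b' * s.1 + a' * s.2 ≤ 0) ∨
      (x.1 - b * s.1 + a * s.2 ≤ 0 ∧ 0 < x'.1 - b' * s.1 + a' * s.2)) :
    s.2 ∈ Set.uIcc ((b * s.1 - x.1) / a) ((b' * s.1 - x'.1) / a') := by
  have ha := hm.a_pos
  have ha' := hm'.a_pos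
  rw [Set.mem_uIcc]
  rcases h with h | h
  · left
    rw [div_le_iff₀ ha, le_div_iff₀ ha']
    constructor <;> linarith
  · right
    rw [div_le_iff₀ ha', le_div_iff₀ ha]
    constructor <;> linarith

variable (Fr) in
/-- Functions with bounded weighted oscillation and bounded weighted Lipschitz constant. -/
structure Lip (θ A L : ℝ) (F : QState → ℝ) : Prop extends Fr.Osc θ A F where
  lip : ∀ x x', |F x - F x'| ≤ L * Fr.K (Fr.kap * θ) x x' * dist₁ x x'
  lip_nonneg : 0 ≤ L

/-- Both queues busy: the Lipschitz bound of `F` applies. Exactly one busy: only the oscillation of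
`F` is available, but `V` is confined to an interval between two thresholds. Both empty: no
difference. The bound `R` is left free because equal parameters allow a contracting weight, while
different ones allow only the crude growth bound. -/
theorem Lip.abs_sub_lindley_le (h : Fr.Lip θ A L F) (hθ : 0 ≤ θ) (hm : Fr.Mem a b)
    (hm' : Fr.Mem a' b') {x x' : QState} {s : ℝ × ℝ} (hs : 0 ≤ s.1 ∧ 0 ≤ s.2) {R : ℝ}
    (hR0 : 0 ≤ R)
    (hR : 0 < x.1 - b * s.1 + a * s.2 → 0 < x'.1 - b' * s.1 + a' * s.2 →
      Fr.K (Fr.kap * θ) (lindley a b x s) (lindley a' b' x' s) ≤ R) :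
    |F (lindley a b x s) - F (lindley a' b' x' s)|
      ≤ L * R * (dist₁ x x' + 2 * (|a - a'| + |b - b'|) * (s.1 + s.2))
        + A * Fr.K (Fr.kap * θ) x x' * (Real.exp (Fr.kap * θ * (Fr.bHi * s.1))
          * between (fun v => (b * v - x.1) / a) (fun v => (b' * v - x'.1) / a') s) := by
  have hA := h.nonneg
  have hL := h.lip_nonneg
  have hd : 0 ≤ dist₁ x x' + 2 * (|a - a'| + |b - b'|) * (s.1 + s.2) := by
    have := dist₁_nonneg x x'
    have := hs.1
    have := hs.2
    positivity
  have hK := Fr.K_pos (Fr.kap * θ) x x'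
  have hbn := between_nonneg (fun v => (b * v - x.1) / a) (fun v => (b' * v - x'.1) / a') s
  have hp1 : 0 ≤ L * R * (dist₁ x x' + 2 * (|a - a'| + |b - b'|) * (s.1 + s.2)) := by positivity
  have hp2 : 0 ≤ A * Fr.K (Fr.kap * θ) x x' * (Real.exp (Fr.kap * θ * (Fr.bHi * s.1))
          * between (fun v => (b * v - x.1) / a) (fun v => (b' * v - x'.1) / a') s) := by
    positivity
  have hsc : (0 < x.1 - b * s.1 + a * s.2 ∧ x'.1 - b' * s.1 + a' * s.2 ≤ 0) ∨
      (x.1 - b * s.1 + a * s.2 ≤ 0 ∧ 0 < x'.1 - b' * s.1 + a' * s.2) →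
      |F (lindley a b x s) - F (lindley a' b' x' s)|
      ≤ A * Fr.K (Fr.kap * θ) x x' * (Real.exp (Fr.kap * θ * (Fr.bHi * s.1))
          * between (fun v => (b * v - x.1) / a) (fun v => (b' * v - x'.1) / a') s) := by
    intro hc
    have h1 : between (fun v => (b * v - x.1) / a) (fun v => (b' * v - x'.1) / a') s = 1 :=
      Set.indicator_of_mem (mem_uIcc_of_sign_change hm hm' hc) _
    rw [h1, mul_one, mul_assoc]
    refine (h.bound _ _).trans (mul_le_mul_of_nonneg_left ?_ hA)
    rw [K, K, ← Real.exp_add]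
    refine Real.exp_le_exp.2 ?_
    have h2 := gauge_lindley_of_sign_change hm hm' hs (x := x) (x' := x')
      (hc.elim (fun h => Or.inr h.2) fun h => Or.inl h.1)
    nlinarith [mul_le_mul_of_nonneg_left h2 hθ]
  rcases lt_or_ge 0 (x.1 - b * s.1 + a * s.2) with hp | hp <;>
    rcases lt_or_ge 0 (x'.1 - b' * s.1 + a' * s.2) with hp' | hp'
  · have h1 : |F (lindley a b x s) - F (lindley a' b' x' s)|
        ≤ L * R * (dist₁ x x' + 2 * (|a - a'| + |b - b'|) * (s.1 + s.2)) :=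
      (h.lip _ _).trans (mul_le_mul (mul_le_mul_of_nonneg_left (hR hp hp') hL)
        (dist₁_lindley_le hs hp hp') (dist₁_nonneg _ _) (mul_nonneg hL hR0))
    linarith
  · linarith [hsc (Or.inl ⟨hp, hp'⟩)]
  · linarith [hsc (Or.inr ⟨hp, hp'⟩)]
  · rw [lindley_of_nonpos hp, lindley_of_nonpos hp', sub_self, abs_zero]
    linarith

theorem measurable_threshold (a b w : ℝ) : Measurable fun v : ℝ => (b * v - w) / a := by fun_prop

theorem exp_U_le_growth {τ : ℝ} (hτ : 0 ≤ τ) {s : ℝ × ℝ} (hs : 0 ≤ s.1 ∧ 0 ≤ s.2) :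
    Real.exp (τ * (Fr.bHi * s.1)) ≤ Real.exp (τ * Fr.growth s) := by
  refine Real.exp_le_exp.2 (mul_le_mul_of_nonneg_left ?_ hτ)
  have e5 := mul_nonneg Fr.aHi_pos.le hs.1
  have e6 := mul_nonneg Fr.bHi_pos.le hs.2
  have e7 := mul_nonneg Fr.aHi_pos.le hs.2
  unfold growth
  linarith

theorem integrable_exp_U {τ : ℝ} (hτ : 0 ≤ τ) (hτ' : τ ≤ Fr.t₀) :
    Integrable (fun s => Real.exp (τ * (Fr.bHi * s.1))) M.noise := by
  refine (Fr.integrable_exp_growth hτ').mono' (by fun_prop) ?_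
  filter_upwards [Fr.noise_nonneg] with s hs
  rw [Real.norm_eq_abs, Real.abs_exp]
  exact exp_U_le_growth hτ hs

theorem integral_exp_U_le {τ : ℝ} (hτ : 0 ≤ τ) (hτ' : τ ≤ Fr.t₀) :
    ∫ s, Real.exp (τ * (Fr.bHi * s.1)) ∂M.noise ≤ Fr.growthMean τ := by
  refine integral_mono_ae (integrable_exp_U hτ hτ') (Fr.integrable_exp_growth hτ') ?_
  filter_upwards [Fr.noise_nonneg] with s hs
  exact exp_U_le_growth hτ hs

/-- The transition operator improves Lipschitz bounds. -/
theorem Lip.T (h : Fr.Lip θ A L F) (hθ : 0 < θ) (hθ' : Fr.kap * θ ≤ Fr.t₀) (hm : Fr.Mem a b) :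
    Fr.Lip θ (Fr.rate θ * A)
      (Fr.rate (Fr.kap * θ) * L + Fr.D / Fr.aLo * Fr.growthMean (Fr.kap * θ) * A)
      (M.T a b F) := by
  have hτ : 0 < Fr.kap * θ := mul_pos Fr.kap_pos hθ
  have hθt : θ ≤ Fr.t₀ := (le_mul_of_one_le_left hθ.le Fr.one_le_kap).trans hθ'
  have hA := h.nonneg
  have hL := h.lip_nonneg
  have haLo := Fr.aLo_pos
  refine ⟨h.toOsc.T hθ.le hθt hm, fun x x' => ?_, ?_⟩
  swap
  · have := Fr.rate_nonneg (Fr.kap * θ)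
    have := Fr.growthMean_nonneg (Fr.kap * θ)
    positivity
  have hF := fun x => h.toOsc.integrable hθ.le hθt hm x
  rw [QueueModel.T, QueueModel.T, ← integral_sub (hF x) (hF x'), ← Real.norm_eq_abs]
  have hi1 : Integrable (fun s => L * (Fr.K (Fr.kap * θ) x x' * dist₁ x x')
      * Real.exp (Fr.kap * θ * Fr.drift s)) M.noise :=
    (Fr.integrable_exp_drift hτ.le hθ').const_mul _
  have hi2 := (integrable_mul_between (f := fun v => Real.exp (Fr.kap * θ * (Fr.bHi * v)))
    (measurable_threshold a b x.1) (measurable_threshold a b x'.1)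
    (integrable_exp_U (Fr := Fr) hτ.le hθ')).const_mul (A * Fr.K (Fr.kap * θ) x x')
  refine (norm_integral_le_of_norm_le (hi1.add hi2) ?_).trans ?_
  · filter_upwards [Fr.noise_nonneg] with s hs
    have hK := Fr.K_pos (Fr.kap * θ) x x'
    refine (h.abs_sub_lindley_le hθ.le hm hm hs (by positivity)
      (fun hp _ => Fr.K_lindley_contract hτ.le hm x x' hs (Or.inl hp))).trans (le_of_eq ?_)
    simp only [sub_self, abs_zero, add_zero, mul_zero, zero_mul, Pi.add_apply]
    ring
  · have hlen : ∀ v : ℝ, 0 ≤ v →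
        |(b * v - x'.1) / a - (b * v - x.1) / a| ≤ |x.1 - x'.1| / Fr.aLo := by
      intro v _
      rw [← sub_div, abs_div, abs_of_pos hm.a_pos]
      rw [show b * v - x'.1 - (b * v - x.1) = x.1 - x'.1 by ring]
      exact div_le_div_of_nonneg_left (abs_nonneg _) Fr.aLo_pos hm.a_lo
    -- Conditionally on `U`, the event of a sign change has probability at most `D` times the
    -- distance of the thresholds. This turns the oscillation bound into a Lipschitz one.
    have hb := Fr.integral_mul_between_le (measurable_threshold a b x.1)
      (measurable_threshold a b x'.1) (fun v => (Real.exp_pos (Fr.kap * θ * (Fr.bHi * v))).le)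
      (integrable_exp_U hτ.le hθ') hlen ((integrable_exp_U hτ.le hθ').mul_const _)
    rw [integral_mul_const] at hb
    have hE := integral_exp_U_le (Fr := Fr) hτ.le hθ'
    have hK := Fr.K_pos (Fr.kap * θ) x x'
    have hx : |x.1 - x'.1| ≤ dist₁ x x' := by unfold dist₁; linarith [abs_nonneg (x.2 - x'.2)]
    have hb2 : Fr.D * ((∫ s, Real.exp (Fr.kap * θ * (Fr.bHi * s.1)) ∂M.noise)
        * (|x.1 - x'.1| / Fr.aLo)) ≤ Fr.D / Fr.aLo * Fr.growthMean (Fr.kap * θ) * dist₁ x x' := by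
      have := Fr.growthMean_nonneg (Fr.kap * θ)
      calc _ ≤ Fr.D * (Fr.growthMean (Fr.kap * θ) * (dist₁ x x' / Fr.aLo)) := by gcongr
        _ = _ := by ring
    rw [integral_add' hi1 hi2, integral_const_mul, integral_const_mul]
    have h3 := mul_le_mul_of_nonneg_left (hb.trans hb2)
      (mul_nonneg hA (Fr.K_pos (Fr.kap * θ) x x').le)
    unfold rate
    linarith

/-- Constant of the Lipschitz dependence of the transition operator on the parameters. -/
def pertConst (Fr : Frame M) (θ : ℝ) : ℝ :=
  2 * (Fr.growthMean (2 * (Fr.kap * θ)) / (Fr.kap * θ * (Fr.aHi + Fr.bHi)))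
    + Fr.D * (1 / Fr.aLo + (Fr.bHi + 1) / Fr.aLo ^ 2)
      * (Fr.growthMean (2 * (Fr.kap * θ)) / (Fr.kap * θ * (Fr.aHi + Fr.bHi))
        + Fr.growthMean (Fr.kap * θ) / (Fr.kap * θ))

theorem threshold_sub_le (hm : Fr.Mem a b) (hm' : Fr.Mem a' b') (w : ℝ) {v : ℝ} (hv : 0 ≤ v) :
    |(b' * v - w) / a' - (b * v - w) / a|
      ≤ (|a - a'| + |b - b'|) * (1 / Fr.aLo + (Fr.bHi + 1) / Fr.aLo ^ 2) * (v + |w|) := by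
  have ha := hm.a_pos
  have ha' := hm'.a_pos
  have haLo := Fr.aLo_pos
  have hbHi := Fr.bHi_pos
  have e : (b' * v - w) / a' - (b * v - w) / a
      = (b' - b) * v / a' + (b * v - w) * (a - a') / (a * a') := by
    field_simp
    ring
  rw [e]
  have h1 : |(b' - b) * v / a'| ≤ |b - b'| * v / Fr.aLo := by
    rw [abs_div, abs_mul, abs_of_nonneg hv, abs_of_pos ha', abs_sub_comm]
    have := hm'.a_lo
    gcongr
  have h2 : |(b * v - w) * (a - a') / (a * a')|
      ≤ (Fr.bHi + 1) * (v + |w|) * |a - a'| / Fr.aLo ^ 2 := by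
    rw [abs_div, abs_mul, abs_of_pos (mul_pos ha ha'), sq]
    have h3 : |b * v - w| ≤ (Fr.bHi + 1) * (v + |w|) := by
      have := mul_le_mul_of_nonneg_right hm.b_hi hv
      have h4 : 0 ≤ b * v := mul_nonneg hm.b_pos.le hv
      have := mul_nonneg hbHi.le (abs_nonneg w)
      calc |b * v - w| ≤ |b * v| + |w| := abs_sub _ _
        _ ≤ _ := by rw [abs_of_nonneg h4]; linarith
    have := hm.a_lo
    have := hm'.a_lo
    gcongr
  refine (abs_add_le _ _).trans ((add_le_add h1 h2).trans ?_)
  have p1 : 0 ≤ |a - a'| * (v + |w|) / Fr.aLo := by positivity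
  have p2 : 0 ≤ (Fr.bHi + 1) * (v + |w|) * |b - b'| / Fr.aLo ^ 2 := by positivity
  have p3 : 0 ≤ |b - b'| * |w| / Fr.aLo := by positivity
  have e2 : (|a - a'| + |b - b'|) * (1 / Fr.aLo + (Fr.bHi + 1) / Fr.aLo ^ 2) * (v + |w|)
      = |b - b'| * v / Fr.aLo + (Fr.bHi + 1) * (v + |w|) * |a - a'| / Fr.aLo ^ 2
        + (|a - a'| * (v + |w|) / Fr.aLo + (Fr.bHi + 1) * (v + |w|) * |b - b'| / Fr.aLo ^ 2
        + |b - b'| * |w| / Fr.aLo) := by ring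
  rw [e2]
  linarith

theorem le_exp_div {τ y : ℝ} (hτ : 0 < τ) : y ≤ Real.exp (τ * y) / τ := by
  rw [le_div_iff₀ hτ]
  linarith [Real.add_one_le_exp (τ * y)]

/-- The linear factor is absorbed by doubling the exponent. This is why the perturbation bounds use
the exponent `2 * (kap * θ)`. -/
theorem sum_mul_exp_growth_le {τ : ℝ} (hτ : 0 < τ) (s : ℝ × ℝ) :
    (s.1 + s.2) * Real.exp (τ * Fr.growth s)
      ≤ Real.exp (2 * τ * Fr.growth s) / (τ * (Fr.aHi + Fr.bHi)) := by
  have hB : 0 < Fr.aHi + Fr.bHi := add_pos Fr.aHi_pos Fr.bHi_pos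
  have h := le_exp_div (y := s.1 + s.2) (mul_pos hτ hB)
  have h2 := mul_le_mul_of_nonneg_right h (Real.exp_pos (τ * Fr.growth s)).le
  refine h2.trans (le_of_eq ?_)
  rw [div_mul_eq_mul_div, ← Real.exp_add]
  unfold growth
  ring_nf

/-- The transition operator depends on the parameters in a Lipschitz way. -/
theorem Lip.abs_T_sub_T_le (h : Fr.Lip θ A L F) (hθ : 0 < θ) (hθ' : 2 * (Fr.kap * θ) ≤ Fr.t₀)
    (hm : Fr.Mem a b) (hm' : Fr.Mem a' b') (x : QState) :
    |M.T a b F x - M.T a' b' F x|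
      ≤ Fr.pertConst θ * (A + L) * (|a - a'| + |b - b'|) * Fr.V (2 * (Fr.kap * θ)) x := by
  have hτ : 0 < Fr.kap * θ := mul_pos Fr.kap_pos hθ
  have hτ' : Fr.kap * θ ≤ Fr.t₀ := by linarith
  have hθt : θ ≤ Fr.t₀ := (le_mul_of_one_le_left hθ.le Fr.one_le_kap).trans hτ'
  have hA := h.nonneg
  have hL := h.lip_nonneg
  have haLo := Fr.aLo_pos
  have hbHi := Fr.bHi_pos
  have hB : 0 < Fr.aHi + Fr.bHi := add_pos Fr.aHi_pos Fr.bHi_pos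
  unfold pertConst
  set τ := Fr.kap * θ with hτdef
  set Δ := |a - a'| + |b - b'| with hΔ
  have hΔ0 : 0 ≤ Δ := by positivity
  set C := 1 / Fr.aLo + (Fr.bHi + 1) / Fr.aLo ^ 2 with hC
  have hC0 : 0 ≤ C := by positivity
  rw [QueueModel.T, QueueModel.T, ← integral_sub (h.toOsc.integrable hθ.le hθt hm x)
    (h.toOsc.integrable hθ.le hθt hm' x), ← Real.norm_eq_abs]
  have hV := Fr.V_pos τ x
  have hi1 : Integrable (fun s => L * Fr.V τ x * (2 * Δ) / (τ * (Fr.aHi + Fr.bHi))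
      * Real.exp (2 * τ * Fr.growth s)) M.noise :=
    (Fr.integrable_exp_growth hθ').const_mul _
  have hi2 := (integrable_mul_between (f := fun v => Real.exp (τ * (Fr.bHi * v)))
    (measurable_threshold a b x.1)
    (measurable_threshold a' b' x.1)
    (integrable_exp_U (Fr := Fr) hτ.le hτ')).const_mul (A * Fr.V τ x)
  refine (norm_integral_le_of_norm_le (hi1.add hi2) ?_).trans ?_
  · filter_upwards [Fr.noise_nonneg] with s hs
    -- Both copies start at `x`, so the distance after a busy step and the gap between the
    -- thresholds come from the parameters alone.
    refine (h.abs_sub_lindley_le hθ.le hm hm' hs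
      (mul_nonneg hV.le (Real.exp_pos (τ * Fr.growth s)).le)
      (fun _ _ => Fr.K_lindley_le hτ.le hm hm' x x hs)).trans ?_
    have h0 : dist₁ x x = 0 := by simp [dist₁]
    rw [h0, zero_add, ← hτdef]
    simp only [Pi.add_apply]
    refine add_le_add ?_ (le_of_eq (by rw [V]))
    have h1 := mul_le_mul_of_nonneg_left (sum_mul_exp_growth_le (Fr := Fr) hτ s)
      (mul_nonneg (mul_nonneg hL hV.le) (mul_nonneg zero_le_two hΔ0))
    calc _ = L * Fr.V τ x * (2 * Δ) * ((s.1 + s.2) * Real.exp (τ * Fr.growth s)) := by ring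
      _ ≤ _ := h1
      _ = _ := by ring
  · have hgi : Integrable (fun s : ℝ × ℝ => Real.exp (τ * (Fr.bHi * s.1))
        * (Δ * C * (s.1 + |x.1|))) M.noise := by
      refine (((Fr.integrable_exp_growth hθ').const_mul (Δ * C / (τ * (Fr.aHi + Fr.bHi)))).add
        ((Fr.integrable_exp_growth hτ').const_mul (Δ * C * |x.1|))).mono' (by fun_prop) ?_
      filter_upwards [Fr.noise_nonneg] with s hs
      have h1 := sum_mul_exp_growth_le (Fr := Fr) hτ s
      have h2 := exp_U_le_growth (Fr := Fr) hτ.le hs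
      have h3 := hs.1
      have h4 := hs.2
      rw [Real.norm_eq_abs, abs_of_nonneg (by positivity)]
      calc _ = Δ * C * (s.1 * Real.exp (τ * (Fr.bHi * s.1)))
            + Δ * C * |x.1| * Real.exp (τ * (Fr.bHi * s.1)) := by ring
        _ ≤ Δ * C * (Real.exp (2 * τ * Fr.growth s) / (τ * (Fr.aHi + Fr.bHi)))
            + Δ * C * |x.1| * Real.exp (τ * Fr.growth s) := by
          have h5 : s.1 * Real.exp (τ * (Fr.bHi * s.1))
              ≤ (s.1 + s.2) * Real.exp (τ * Fr.growth s) := by gcongr; linarith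
          have h6 := h5.trans h1
          gcongr
        _ = _ := by simp only [Pi.add_apply]; ring
    have hgi_le : ∫ s : ℝ × ℝ, Real.exp (τ * (Fr.bHi * s.1)) * (Δ * C * (s.1 + |x.1|)) ∂M.noise
        ≤ Δ * C * (Fr.growthMean (2 * τ) / (τ * (Fr.aHi + Fr.bHi)) + |x.1| * Fr.growthMean τ) := by
      have hj := ((Fr.integrable_exp_growth hθ').const_mul (Δ * C / (τ * (Fr.aHi + Fr.bHi)))).add
        ((Fr.integrable_exp_growth hτ').const_mul (Δ * C * |x.1|))
      refine (integral_mono_ae hgi hj ?_).trans (le_of_eq ?_)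
      · filter_upwards [Fr.noise_nonneg] with s hs
        have h1 := sum_mul_exp_growth_le (Fr := Fr) hτ s
        have h2 := exp_U_le_growth (Fr := Fr) hτ.le hs
        have h3 := hs.1
        have h4 := hs.2
        calc _ = Δ * C * (s.1 * Real.exp (τ * (Fr.bHi * s.1)))
              + Δ * C * |x.1| * Real.exp (τ * (Fr.bHi * s.1)) := by ring
          _ ≤ Δ * C * (Real.exp (2 * τ * Fr.growth s) / (τ * (Fr.aHi + Fr.bHi)))
              + Δ * C * |x.1| * Real.exp (τ * Fr.growth s) := by
            have h5 : s.1 * Real.exp (τ * (Fr.bHi * s.1))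
                ≤ (s.1 + s.2) * Real.exp (τ * Fr.growth s) := by gcongr; linarith
            have h6 := h5.trans h1
            gcongr
          _ = _ := by simp only [Pi.add_apply]; ring
      · rw [integral_add' ((Fr.integrable_exp_growth hθ').const_mul _)
          ((Fr.integrable_exp_growth hτ').const_mul _), integral_const_mul, integral_const_mul]
        unfold growthMean
        ring
    have hb := (Fr.integral_mul_between_le (measurable_threshold a b x.1)
      (measurable_threshold a' b' x.1) (fun v => (Real.exp_pos (τ * (Fr.bHi * v))).le)
      (integrable_exp_U hτ.le hτ') (fun v hv => threshold_sub_le hm hm' x.1 hv) hgi).trans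
      (mul_le_mul_of_nonneg_left hgi_le Fr.D.coe_nonneg)
    rw [integral_add' hi1 hi2, integral_const_mul, integral_const_mul]
    have hG2 := Fr.growthMean_nonneg (2 * τ)
    have hG1 := Fr.growthMean_nonneg τ
    have hV1 := Fr.one_le_V hτ.le x
    -- The thresholds differ by a multiple of `U + |w|`. The factor `|w|` is absorbed by a second
    -- copy of `V τ`, which gives `V (2 * τ)`.
    have hV2 : Fr.V (2 * τ) x = Fr.V τ x * Fr.V τ x := by
      rw [← sq, V_pow]; norm_num
    have hx : |x.1| ≤ Fr.V τ x / τ := by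
      refine ((le_max_left _ _).trans (Fr.abs_fst_le_gauge x x)).trans (le_exp_div hτ)
    have hb2 : A * Fr.V τ x * (Fr.D * (Δ * C * (Fr.growthMean (2 * τ)
        / (τ * (Fr.aHi + Fr.bHi)) + |x.1| * Fr.growthMean τ)))
        ≤ A * Δ * (Fr.D * C * (Fr.growthMean (2 * τ) / (τ * (Fr.aHi + Fr.bHi))
          + Fr.growthMean τ / τ)) * Fr.V (2 * τ) x := by
      rw [hV2]
      calc _ ≤ A * Fr.V τ x * (Fr.D * (Δ * C * (Fr.growthMean (2 * τ)
            / (τ * (Fr.aHi + Fr.bHi)) * Fr.V τ x + Fr.V τ x / τ * Fr.growthMean τ))) := by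
            gcongr
            exact le_mul_of_one_le_right (by positivity) hV1
        _ = _ := by ring
    have hb3 := mul_le_mul_of_nonneg_left hb (mul_nonneg hA hV.le)
    have h1 : L * Fr.V τ x * (2 * Δ) / (τ * (Fr.aHi + Fr.bHi)) * Fr.growthMean (2 * τ)
        ≤ L * Δ * (2 * (Fr.growthMean (2 * τ) / (τ * (Fr.aHi + Fr.bHi)))) * Fr.V (2 * τ) x := by
      rw [hV2]
      calc _ = L * Δ * (2 * (Fr.growthMean (2 * τ) / (τ * (Fr.aHi + Fr.bHi))))
            * (Fr.V τ x * 1) := by ring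
        _ ≤ _ := by gcongr
    have hp1 : 0 ≤ A * Δ * (2 * (Fr.growthMean (2 * τ) / (τ * (Fr.aHi + Fr.bHi))))
        * Fr.V (2 * τ) x := by
      have := Fr.V_pos (2 * τ) x
      positivity
    have hp2 : 0 ≤ L * Δ * (Fr.D * C * (Fr.growthMean (2 * τ) / (τ * (Fr.aHi + Fr.bHi))
          + Fr.growthMean τ / τ)) * Fr.V (2 * τ) x := by
      have := Fr.V_pos (2 * τ) x
      positivity
    have h2 := hb3.trans hb2
    simp only [growthMean] at h1 h2 hp1 hp2 ⊢
    linarith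

end Frame

/-! ### The combined seminorm; perturbation of stationary means and potentials. -/

namespace Frame

variable (Fr : Frame M)

/-- Common contraction rate of oscillation and Lipschitz bounds. -/
def sig (θ : ℝ) : ℝ := (1 + max (Fr.rate θ) (Fr.rate (Fr.kap * θ))) / 2

/-- Weight of the oscillation bound in the combined seminorm. -/
def lipRatio (θ : ℝ) : ℝ :=
  1 + Fr.D / Fr.aLo * Fr.growthMean (Fr.kap * θ) / (Fr.sig θ - Fr.rate (Fr.kap * θ))

/-- The ball of radius `N` in the seminorm combining oscillation and Lipschitz bounds. -/
abbrev Smooth (θ N : ℝ) (F : QState → ℝ) : Prop := Fr.Lip θ N (Fr.lipRatio θ * N) F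

/-- Exponents small enough for the perturbation bounds. -/
structure Adm (θ : ℝ) : Prop where
  pos : 0 < θ
  le : 2 * (Fr.kap * θ) ≤ Fr.t₀

variable {Fr} {θ A L N a b a' b' : ℝ} {F G : QState → ℝ}

namespace Adm

variable (hθ : Fr.Adm θ)
include hθ

theorem kap_pos : 0 < Fr.kap * θ := mul_pos Fr.kap_pos hθ.pos
theorem kap_le : Fr.kap * θ ≤ Fr.t₀ := by linarith [hθ.kap_pos, hθ.le]
theorem le' : θ ≤ Fr.t₀ := (le_mul_of_one_le_left hθ.pos.le Fr.one_le_kap).trans hθ.kap_le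
theorem two_pos : 0 < 2 * (Fr.kap * θ) := by linarith [hθ.kap_pos]
theorem le_two : θ ≤ 2 * (Fr.kap * θ) := by
  linarith [le_mul_of_one_le_left hθ.pos.le Fr.one_le_kap, hθ.kap_pos]

theorem rate_lt_sig : Fr.rate θ < Fr.sig θ := by
  have h1 := Fr.rate_lt_one hθ.pos hθ.le'
  have h2 := le_max_left (Fr.rate θ) (Fr.rate (Fr.kap * θ))
  unfold sig; linarith

theorem rate_kap_lt_sig : Fr.rate (Fr.kap * θ) < Fr.sig θ := by
  have h1 := Fr.rate_lt_one hθ.kap_pos hθ.kap_le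
  have h2 := le_max_right (Fr.rate θ) (Fr.rate (Fr.kap * θ))
  unfold sig; linarith

theorem sig_lt_one : Fr.sig θ < 1 := by
  have h1 := Fr.rate_lt_one hθ.pos hθ.le'
  have h2 := Fr.rate_lt_one hθ.kap_pos hθ.kap_le
  have := max_lt h1 h2
  unfold sig; linarith

theorem sig_nonneg : 0 ≤ Fr.sig θ := (Fr.rate_nonneg θ).trans hθ.rate_lt_sig.le

theorem one_le_lipRatio : 1 ≤ Fr.lipRatio θ := by
  have h1 := Fr.growthMean_nonneg (Fr.kap * θ)
  have h2 : 0 < Fr.sig θ - Fr.rate (Fr.kap * θ) := sub_pos.2 hθ.rate_kap_lt_sig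
  have h3 := Fr.aLo_pos
  unfold lipRatio
  have : 0 ≤ Fr.D / Fr.aLo * Fr.growthMean (Fr.kap * θ) / (Fr.sig θ - Fr.rate (Fr.kap * θ)) := by
    positivity
  linarith

/-- The oscillation feeds into the Lipschitz constant of `T F`, but not conversely. A large enough
ratio between the two bounds lets this inhomogeneous term fit into the gap between `rate (kap * θ)`
and `sig θ`, so the combined seminorm contracts by `sig θ`. -/
theorem lipRatio_contract : Fr.rate (Fr.kap * θ) * Fr.lipRatio θ
    + Fr.D / Fr.aLo * Fr.growthMean (Fr.kap * θ) ≤ Fr.sig θ * Fr.lipRatio θ := by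
  have h2 : 0 < Fr.sig θ - Fr.rate (Fr.kap * θ) := sub_pos.2 hθ.rate_kap_lt_sig
  have h3 : (Fr.sig θ - Fr.rate (Fr.kap * θ)) * Fr.lipRatio θ
      = (Fr.sig θ - Fr.rate (Fr.kap * θ)) + Fr.D / Fr.aLo * Fr.growthMean (Fr.kap * θ) := by
    rw [lipRatio, mul_add, mul_one, mul_div_cancel₀ _ h2.ne']
  linarith

end Adm

theorem Lip.mono {A' L' : ℝ} (h : Fr.Lip θ A L F) (hA : A ≤ A') (hL : L ≤ L') :
    Fr.Lip θ A' L' F :=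
  ⟨h.toOsc.mono hA, fun x x' => (h.lip x x').trans
    (mul_le_mul_of_nonneg_right (mul_le_mul_of_nonneg_right hL (Fr.K_pos _ _ _).le)
      (dist₁_nonneg x x')), h.lip_nonneg.trans hL⟩

theorem Smooth.T (h : Fr.Smooth θ N F) (hθ : Fr.Adm θ) (hm : Fr.Mem a b) :
    Fr.Smooth θ (Fr.sig θ * N) (M.T a b F) := by
  have hN : 0 ≤ N := h.nonneg
  refine (Lip.T h hθ.pos hθ.kap_le hm).mono
    (mul_le_mul_of_nonneg_right hθ.rate_lt_sig.le hN) ?_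
  have := mul_le_mul_of_nonneg_right hθ.lipRatio_contract hN
  linarith

theorem Smooth.iterate (h : Fr.Smooth θ N F) (hθ : Fr.Adm θ) (hm : Fr.Mem a b) (n : ℕ) :
    Fr.Smooth θ (Fr.sig θ ^ n * N) ((M.T a b)^[n] F) := by
  induction n with
  | zero => simpa using h
  | succ n ih =>
    rw [Function.iterate_succ_apply', pow_succ', mul_assoc]
    exact ih.T hθ hm

theorem Smooth.potential (h : Fr.Smooth θ N F) (hθ : Fr.Adm θ) (hm : Fr.Mem a b) :
    Fr.Smooth θ (N * (1 - Fr.sig θ)⁻¹) (M.potential a b F) := by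
  have hN : 0 ≤ N := h.nonneg
  have hσ : 0 < 1 - Fr.sig θ := by linarith [hθ.sig_lt_one]
  have hM := hθ.one_le_lipRatio
  have hs := fun x => (h.toOsc.summable hθ.pos hθ.le' hm x).of_abs
  refine ⟨(h.toOsc.potential hθ.pos hθ.le' hm).mono ?_, fun x x' => ?_, by positivity⟩
  · have := hθ.rate_lt_sig.le
    gcongr
  · rw [QueueModel.potential, QueueModel.potential, ← (hs x).tsum_sub (hs x'),
      ← Real.norm_eq_abs]
    refine tsum_of_norm_bounded (g := fun n => Fr.sig θ ^ n
      * (Fr.lipRatio θ * N * Fr.K (Fr.kap * θ) x x' * dist₁ x x')) ?_ fun n => ?_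
    · have := (hasSum_geometric_of_lt_one hθ.sig_nonneg hθ.sig_lt_one).mul_right
        (Fr.lipRatio θ * N * Fr.K (Fr.kap * θ) x x' * dist₁ x x')
      rw [show Fr.lipRatio θ * (N * (1 - Fr.sig θ)⁻¹) * Fr.K (Fr.kap * θ) x x' * dist₁ x x'
        = (1 - Fr.sig θ)⁻¹ * (Fr.lipRatio θ * N * Fr.K (Fr.kap * θ) x x' * dist₁ x x') by ring]
      exact this
    · rw [Real.norm_eq_abs]
      have := (h.iterate hθ hm n).lip x x'
      calc _ = |(M.T a b)^[n] F x - (M.T a b)^[n] F x'| := by ring_nf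
        _ ≤ _ := by linarith

theorem abs_statMean_le {t : ℝ} (hF : Measurable F) (ht : 0 < t) (ht' : t ≤ Fr.t₀)
    (hm : Fr.Mem a b) (hb : ∀ x, |F x| ≤ A * Fr.V t x) :
    |M.statMean a b F| ≤ A * (1 - Fr.rate t)⁻¹ := by
  have h1 := ((osc_of_le hF ht.le hb).tendsto_zero ht ht' hm).abs
  refine le_of_tendsto h1 (Eventually.of_forall fun n => ?_)
  simpa [V_zero] using abs_iterate_le hF ht ht' hm hb n (0, 0)

/-- Constant of the Lipschitz dependence of the stationary mean on the parameters. -/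
def meanConst (Fr : Frame M) (θ : ℝ) : ℝ :=
  Fr.pertConst θ * (1 + Fr.lipRatio θ) * (1 - Fr.sig θ)⁻¹ * (1 - Fr.rate (2 * (Fr.kap * θ)))⁻¹

theorem Smooth.abs_T_sub_T_le (h : Fr.Smooth θ N F) (hθ : Fr.Adm θ)
    (hm : Fr.Mem a b) (hm' : Fr.Mem a' b') (x : QState) :
    |M.T a b F x - M.T a' b' F x| ≤ Fr.pertConst θ * (1 + Fr.lipRatio θ) * N
      * (|a - a'| + |b - b'|) * Fr.V (2 * (Fr.kap * θ)) x := by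
  refine (Lip.abs_T_sub_T_le h hθ.pos hθ.le hm hm' x).trans (le_of_eq ?_)
  ring

/-- Let `G` be the potential of `F` under `(a', b')`, so that `F - π' F = G - T' G`. Applying the
stationary mean `π` of `(a, b)`, which does not see `T`, gives `π F - π' F = π (T G - T' G)`. The
operator perturbation bound finishes. -/
theorem Smooth.abs_statMean_sub_le (h : Fr.Smooth θ N F) (hθ : Fr.Adm θ)
    (hm : Fr.Mem a b) (hm' : Fr.Mem a' b') :
    |M.statMean a b F - M.statMean a' b' F|
      ≤ Fr.meanConst θ * N * (|a - a'| + |b - b'|) := by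
  have hG := h.potential hθ hm'
  set G := M.potential a' b' F with hGdef
  have hO := hG.toOsc
  have h0 := hθ.pos
  have h1 := hθ.le'
  have e1 : (fun x => F x - M.statMean a' b' F) = fun x => G x - M.T a' b' G x := by
    funext x
    have := T_potential h.toOsc h0 h1 hm' x
    rw [← hGdef] at this
    linarith
  have e2 : M.statMean a b F - M.statMean a' b' F
      = M.statMean a b (fun x => M.T a b G x - M.T a' b' G x) := by
    have hT := hO.T h0.le h1 hm
    have hT' := hO.T h0.le h1 hm'
    rw [statMean_sub hT hT' h0 h1 hm, statMean_T hO h0 h1 hm, ← statMean_sub hO hT' h0 h1 hm,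
      ← e1, statMean_sub h.toOsc (osc_const _) h0 h1 hm, statMean_const]
  rw [e2]
  refine (abs_statMean_le ((measurable_T a b hO.meas).sub (measurable_T a' b' hO.meas))
    hθ.two_pos hθ.le hm (fun x => hG.abs_T_sub_T_le hθ hm hm' x)).trans (le_of_eq ?_)
  unfold meanConst
  ring

/-- The partial sums telescope to `F - T^n F`. Thus `F` is recovered from `F - T F` up to its
stationary mean. -/
theorem potential_sub_T {t : ℝ} (h : Fr.Osc t A F) (ht : 0 < t) (ht' : t ≤ Fr.t₀)
    (hm : Fr.Mem a b) (x : QState) :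
    M.potential a b (fun x => F x - M.T a b F x) x = F x - M.statMean a b F := by
  have hT := h.T ht.le ht' hm
  have h0 : M.statMean a b (fun x => F x - M.T a b F x) = 0 := by
    rw [statMean_sub h hT ht ht' hm, statMean_T h ht ht' hm, sub_self]
  have hs := ((h.sub hT).summable ht ht' hm x).of_abs.hasSum.tendsto_sum_nat
  refine tendsto_nhds_unique hs ?_
  have e : ∀ n, ∑ i ∈ Finset.range n, ((M.T a b)^[i] (fun x => F x - M.T a b F x) x
      - M.statMean a b fun x => F x - M.T a b F x) = F x - (M.T a b)^[n] F x := by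
    intro n
    simp only [h0, sub_zero, iterate_sub h hT ht.le ht' hm, ← Function.iterate_succ_apply]
    rw [Finset.sum_range_sub' (fun i => (M.T a b)^[i] F x)]
    rfl
  simp only [e]
  exact (h.tendsto ht ht' hm x).const_sub _

/-- Constant of the Lipschitz dependence of the potential on the parameters. -/
def potConst (Fr : Frame M) (θ : ℝ) : ℝ :=
  2 * (Fr.meanConst θ + Fr.pertConst θ * (1 + Fr.lipRatio θ) * (1 - Fr.sig θ)⁻¹)
    * Fr.convConst (2 * (Fr.kap * θ)) * (1 - Fr.rate (2 * (Fr.kap * θ)))⁻¹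
    + Fr.meanConst θ * (1 - Fr.sig θ)⁻¹

theorem pertConst_nonneg (hθ : Fr.Adm θ) : 0 ≤ Fr.pertConst θ := by
  have h1 := Fr.growthMean_nonneg (2 * (Fr.kap * θ))
  have h2 := Fr.growthMean_nonneg (Fr.kap * θ)
  have h3 := hθ.kap_pos
  have h4 := Fr.aLo_pos
  have h5 := Fr.aHi_pos
  have h6 := Fr.bHi_pos
  unfold pertConst
  positivity

theorem meanConst_nonneg (hθ : Fr.Adm θ) : 0 ≤ Fr.meanConst θ := by
  have h1 := pertConst_nonneg hθ
  have h2 := hθ.one_le_lipRatio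
  have h3 : 0 < 1 - Fr.sig θ := by linarith [hθ.sig_lt_one]
  have h4 : 0 < 1 - Fr.rate (2 * (Fr.kap * θ)) := by
    linarith [Fr.rate_lt_one hθ.two_pos hθ.le]
  unfold meanConst
  positivity

/-- Subtracting the two Poisson equations, `G - G'` satisfies the `(a, b)` equation with right-hand
side `q = -(π F - π' F) + (T - T') G'`, which is small. So `G - G'` is the potential of `q` plus `π
(G - G')`. Here `π G = 0`, and `π G' = π G' - π' G'` is small by the bound for stationary means. -/
theorem Smooth.abs_potential_sub_le (h : Fr.Smooth θ N F) (hθ : Fr.Adm θ)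
    (hm : Fr.Mem a b) (hm' : Fr.Mem a' b') (x : QState) :
    |M.potential a b F x - M.potential a' b' F x|
      ≤ Fr.potConst θ * N * (|a - a'| + |b - b'|) * Fr.V (2 * (Fr.kap * θ)) x := by
  have h0 := hθ.pos
  have h1 := hθ.le'
  have hN : 0 ≤ N := h.nonneg
  have hG := (h.potential hθ hm).toOsc
  have hS' := h.potential hθ hm'
  have hG' := hS'.toOsc
  have hmean := h.abs_statMean_sub_le hθ hm hm'
  have hmean' := hS'.abs_statMean_sub_le hθ hm hm'
  have hpert := fun x => hS'.abs_T_sub_T_le hθ hm hm' x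
  have hpi := statMean_potential h.toOsc h0 h1 hm
  have hpi' := statMean_potential h.toOsc h0 h1 hm'
  have hPo := fun x => T_potential h.toOsc h0 h1 hm x
  have hPo' := fun x => T_potential h.toOsc h0 h1 hm' x
  generalize M.potential a b F = G at *
  generalize M.potential a' b' F = G' at *
  set Δ := |a - a'| + |b - b'|
  have hΔ : 0 ≤ Δ := by positivity
  have hmc := meanConst_nonneg hθ
  have hpc := pertConst_nonneg hθ
  have hσ : 0 < (1 - Fr.sig θ)⁻¹ := inv_pos.2 (by linarith [hθ.sig_lt_one])
  have hD := hG.sub hG'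
  set q : QState → ℝ := fun x => (G x - G' x) - M.T a b (fun x => G x - G' x) x with hq
  have hTs := T_sub hG hG' h0.le h1 hm
  have hqb : ∀ x, |q x| ≤ ((Fr.meanConst θ
      + Fr.pertConst θ * (1 + Fr.lipRatio θ) * (1 - Fr.sig θ)⁻¹) * N * Δ)
      * Fr.V (2 * (Fr.kap * θ)) x := by
    intro x
    have e : q x = -(M.statMean a b F - M.statMean a' b' F) + (M.T a b G' x - M.T a' b' G' x) := by
      simp only [hq, hTs, hPo, hPo']
      ring
    have h2 := Fr.one_le_V hθ.two_pos.le x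
    have h3 : Fr.meanConst θ * N * Δ ≤ Fr.meanConst θ * N * Δ * Fr.V (2 * (Fr.kap * θ)) x :=
      le_mul_of_one_le_right (by positivity) h2
    rw [e]
    refine (abs_add_le _ _).trans ?_
    rw [abs_neg]
    linarith [hpert x]
  have hqm : Measurable q := hD.meas.sub (measurable_T a b hD.meas)
  have hpot := (osc_of_le hqm hθ.two_pos.le hqb).abs_potential_le hθ.two_pos hθ.le hm x
  rw [hq, potential_sub_T hD h0 h1 hm, statMean_sub hG hG' h0 h1 hm, hpi] at hpot
  rw [hpi', sub_zero] at hmean'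
  have h2 := Fr.one_le_V hθ.two_pos.le x
  have h3 : Fr.meanConst θ * (N * (1 - Fr.sig θ)⁻¹) * Δ
      ≤ Fr.meanConst θ * (N * (1 - Fr.sig θ)⁻¹) * Δ * Fr.V (2 * (Fr.kap * θ)) x :=
    le_mul_of_one_le_right (by positivity) h2
  have h4 : G x - G' x = (G x - G' x - (0 - M.statMean a b G')) + (- M.statMean a b G') := by ring
  rw [h4]
  refine (abs_add_le _ _).trans ?_
  rw [abs_neg]
  unfold potConst
  linarith

/-! ### Linear functions belong to the smooth class. -/

/-- Linear functions of the state. -/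
def lin (p q : ℝ) (x : QState) : ℝ := p * x.1 + q * x.2

variable (Fr) in
/-- Seminorm bound of linear functions with coefficients bounded by one. -/
def linConst (θ : ℝ) : ℝ := 1 + 2 * (1 + 1 / Fr.c) / θ

theorem abs_lin_sub_le {p q : ℝ} (hp : |p| ≤ 1) (hq : |q| ≤ 1) (x x' : QState) :
    |lin p q x - lin p q x'| ≤ dist₁ x x' := by
  have e : lin p q x - lin p q x' = p * (x.1 - x'.1) + q * (x.2 - x'.2) := by
    unfold lin; ring
  rw [e]
  refine (abs_add_le _ _).trans ?_
  rw [abs_mul, abs_mul]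
  unfold dist₁
  gcongr <;> exact mul_le_of_le_one_left (abs_nonneg _) ‹_›

theorem dist₁_le_gauge (x x' : QState) : dist₁ x x' ≤ 2 * (1 + 1 / Fr.c) * Fr.gauge x x' := by
  have h1 := Fr.abs_fst_le_gauge x x'
  have h2 := Fr.abs_snd_le_gauge x x'
  have hc := Fr.c_pos
  have h3 : max |x.2| |x'.2| ≤ 1 / Fr.c * Fr.gauge x x' := by
    rw [div_mul_eq_mul_div, one_mul, le_div_iff₀ hc]
    linarith
  have e1 := abs_sub x.1 x'.1
  have e2 := abs_sub x.2 x'.2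
  unfold dist₁
  linarith [le_max_left |x.1| |x'.1|, le_max_right |x.1| |x'.1|, le_max_left |x.2| |x'.2|,
    le_max_right |x.2| |x'.2|]

theorem linConst_nonneg (hθ : Fr.Adm θ) : 0 ≤ Fr.linConst θ := by
  have := hθ.pos
  have := Fr.c_pos
  unfold linConst; positivity

theorem smooth_lin (hθ : Fr.Adm θ) {p q : ℝ} (hp : |p| ≤ 1) (hq : |q| ≤ 1) :
    Fr.Smooth θ (Fr.linConst θ) (lin p q) := by
  have hθ0 := hθ.pos
  have hc := Fr.c_pos
  refine ⟨⟨by unfold lin; fun_prop, fun x x' => (abs_lin_sub_le hp hq x x').trans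
    ((dist₁_le_gauge (Fr := Fr) x x').trans ?_)⟩, fun x x' => (abs_lin_sub_le hp hq x x').trans ?_,
    ?_⟩
  · have h1 := le_exp_div (y := Fr.gauge x x') hθ0
    have h2 : 2 * (1 + 1 / Fr.c) * Fr.gauge x x' ≤ 2 * (1 + 1 / Fr.c) * (Fr.K θ x x' / θ) :=
      mul_le_mul_of_nonneg_left h1 (by positivity)
    have h3 := Fr.K_pos θ x x'
    unfold linConst
    calc _ ≤ _ := h2
      _ = 0 + 2 * (1 + 1 / Fr.c) / θ * Fr.K θ x x' := by ring
      _ ≤ 1 * Fr.K θ x x' + 2 * (1 + 1 / Fr.c) / θ * Fr.K θ x x' := by gcongr; positivity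
      _ = _ := by ring
  · have h1 := hθ.one_le_lipRatio
    have h2 : 1 ≤ Fr.linConst θ := by
      unfold linConst
      have : 0 ≤ 2 * (1 + 1 / Fr.c) / θ := by positivity
      linarith
    have h3 := Fr.one_le_K hθ.kap_pos.le x x'
    refine le_mul_of_one_le_left (dist₁_nonneg x x') ?_
    exact one_le_mul_of_one_le_of_one_le (one_le_mul_of_one_le_of_one_le h1 h2) h3
  · exact mul_nonneg (zero_le_one.trans hθ.one_le_lipRatio) (linConst_nonneg hθ)

end Frame

/-! ### Powers of the kernel and iterates of the transition operator. -/

instance (ϑ : Param) : IsMarkovKernel (M.kernel ϑ) :=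
  ⟨fun _ => Measure.isProbabilityMeasure_map
    ((M.measurable_step ϑ).comp measurable_prodMk_left).aemeasurable⟩

theorem measurable_step_right (M : QueueModel) (ϑ : Param) (x : QState) :
    Measurable (M.step ϑ x) :=
  (M.measurable_step ϑ).comp measurable_prodMk_left

theorem kernel_apply (ϑ : Param) (x : QState) :
    M.kernel ϑ x = M.noise.map (M.step ϑ x) := rfl

theorem integral_kernel (ϑ : Param) (x : QState) {F : QState → ℝ} (hF : Measurable F) :
    ∫ z, F z ∂M.kernel ϑ x = M.T (ϑ 0)⁻¹ (M.lam (ϑ 1))⁻¹ F x := by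
  rw [kernel_apply, integral_map (M.measurable_step_right ϑ x).aemeasurable
    hF.aestronglyMeasurable]
  simp only [step_eq_lindley]
  rfl

namespace Frame

variable {Fr : Frame M} {t A : ℝ} {F : QState → ℝ} {ϑ : Param}

theorem Osc.integrable_kernel (h : Fr.Osc t A F) (ht : 0 ≤ t) (ht' : t ≤ Fr.t₀)
    (hm : Fr.Mem (ϑ 0)⁻¹ (M.lam (ϑ 1))⁻¹) (x : QState) : Integrable F (M.kernel ϑ x) := by
  rw [kernel_apply, integrable_map_measure h.meas.aestronglyMeasurable
    (M.measurable_step_right ϑ x).aemeasurable]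
  have := h.integrable ht ht' hm x
  simpa only [Function.comp_def, step_eq_lindley] using this

/-- Integrability and the value of the integral are proved together: integrability under a
composition of kernels needs the inner integrals of `|F|`, which are again iterates because `|F|`
has the same oscillation bound. Hence the induction is over all `F`. -/
theorem Osc.integrable_kernel_pow_and_integral (h : Fr.Osc t A F) (ht : 0 ≤ t) (ht' : t ≤ Fr.t₀)
    (hm : Fr.Mem (ϑ 0)⁻¹ (M.lam (ϑ 1))⁻¹) (n : ℕ) (x : QState) :
    Integrable F ((M.kernel ϑ ^ n) x) ∧
      ∫ z, F z ∂((M.kernel ϑ ^ n) x) = (M.T (ϑ 0)⁻¹ (M.lam (ϑ 1))⁻¹)^[n] F x := by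
  induction n generalizing F A x with
  | zero =>
    have h1 : (M.kernel ϑ ^ 0) x = Measure.dirac x := by
      rw [pow_zero]; exact Kernel.id_apply x
    rw [h1]
    exact ⟨integrable_dirac (by finiteness), by simp⟩
  | succ n ih =>
    have h1 : (M.kernel ϑ ^ (n + 1)) = (M.kernel ϑ ^ n) ∘ₖ M.kernel ϑ := pow_succ _ _
    rw [h1]
    have hi : Integrable F (((M.kernel ϑ ^ n) ∘ₖ M.kernel ϑ) x) := by
      rw [integrable_comp_iff h.meas.aestronglyMeasurable]
      refine ⟨ae_of_all _ fun y => (ih h y).1, ?_⟩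
      have h2 : (fun y => ∫ z, ‖F z‖ ∂((M.kernel ϑ ^ n) y))
          = (M.T (ϑ 0)⁻¹ (M.lam (ϑ 1))⁻¹)^[n] fun x => |F x| :=
        funext fun y => (ih h.abs y).2
      rw [h2]
      exact (h.abs.iterate ht ht' hm n).integrable_kernel ht ht' hm x
    refine ⟨hi, ?_⟩
    rw [Kernel.integral_comp hi, Function.iterate_succ_apply']
    simp only [(ih h _).2]
    exact integral_kernel ϑ x (h.iterate ht ht' hm n).meas

end Frame

/-! ### Independence of the current state and the next noise; laws of the paths. -/

section Adapted

variable {Ω E : Type*} [MeasurableSpace E] {ξ : ℕ → Ω → ℝ × ℝ} {Z : ℕ → Ω → E}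

/-- A recursively defined process factors through the past of the driving sequence. -/
theorem exists_eq_comp_past {z₀ : E} (hZ0 : ∀ ω, Z 0 ω = z₀) {g : ℕ → E × (ℝ × ℝ) → E}
    (hg : ∀ n, Measurable (g n)) (hZ : ∀ n ω, Z (n + 1) ω = g n (Z n ω, ξ n ω)) (n : ℕ) :
    ∃ φ : ((i : Finset.range n) → ℝ × ℝ) → E, Measurable φ ∧
      ∀ ω, Z n ω = φ (fun i => ξ i ω) := by
  induction n with
  | zero => exact ⟨fun _ => z₀, measurable_const, hZ0⟩
  | succ n ih =>
    obtain ⟨φ, hφ, h⟩ := ih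
    refine ⟨fun u => g n (φ (fun i => u ⟨i, Finset.mem_range.2
      ((Finset.mem_range.1 i.2).trans (Nat.lt_succ_self n))⟩),
      u ⟨n, Finset.mem_range.2 (Nat.lt_succ_self n)⟩), ?_, fun ω => ?_⟩
    · refine (hg n).comp (Measurable.prodMk (hφ.comp ?_) (measurable_pi_apply _))
      exact measurable_pi_lambda _ fun i => measurable_pi_apply _
    · rw [hZ, h]

variable [MeasurableSpace Ω] {P : Measure Ω}

theorem measurable_of_adapted (hξ : ∀ n, Measurable (ξ n)) {z₀ : E} (hZ0 : ∀ ω, Z 0 ω = z₀)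
    {g : ℕ → E × (ℝ × ℝ) → E} (hg : ∀ n, Measurable (g n))
    (hZ : ∀ n ω, Z (n + 1) ω = g n (Z n ω, ξ n ω)) (n : ℕ) : Measurable (Z n) := by
  obtain ⟨φ, hφ, h⟩ := exists_eq_comp_past hZ0 hg hZ n
  rw [show Z n = fun ω => φ (fun i => ξ i ω) from funext h]
  exact hφ.comp (measurable_pi_lambda _ fun i => hξ i)

/-- `Z n` is a function of the noise with indices below `n`, a set disjoint from `{n}`. -/
theorem indepFun_of_adapted (hξ : ∀ n, Measurable (ξ n)) (hind : iIndepFun ξ P) {z₀ : E}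
    (hZ0 : ∀ ω, Z 0 ω = z₀) {g : ℕ → E × (ℝ × ℝ) → E} (hg : ∀ n, Measurable (g n))
    (hZ : ∀ n ω, Z (n + 1) ω = g n (Z n ω, ξ n ω)) (n : ℕ) : IndepFun (Z n) (ξ n) P := by
  obtain ⟨φ, hφ, h⟩ := exists_eq_comp_past hZ0 hg hZ n
  have h1 := hind.indepFun_finset (Finset.range n) {n} (by simp) hξ
  have h2 := h1.comp hφ (measurable_pi_apply (⟨n, Finset.mem_singleton_self n⟩ :
    ({n} : Finset ℕ)))
  rw [show Z n = fun ω => φ (fun i => ξ i ω) from funext h]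
  exact h2

end Adapted

/-- Law of the driving sequence of a queue. -/
abbrev seqLaw (M : QueueModel) : Measure (ℕ → ℝ × ℝ) := Measure.infinitePi fun _ : ℕ => M.noise

theorem iIndepFun_seq (M : QueueModel) : iIndepFun (fun (n : ℕ) (s : ℕ → ℝ × ℝ) => s n) M.seqLaw :=
  iIndepFun_infinitePi (X := fun _ s => s) fun _ => measurable_id

theorem map_seq (M : QueueModel) (n : ℕ) : M.seqLaw.map (fun s => s n) = M.noise :=
  Measure.infinitePi_map_eval _ n

theorem measurable_path (M : QueueModel) (ϑ : Param) (n : ℕ) : Measurable fun s => M.path ϑ s n :=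
  measurable_of_adapted (ξ := fun n s => s n) (Z := fun n s => M.path ϑ s n)
    (fun n => measurable_pi_apply n) (fun _ => rfl) (g := fun _ z => M.step ϑ z.1 z.2)
    (fun _ => M.measurable_step ϑ) (fun _ _ => rfl) n

theorem indepFun_path (M : QueueModel) (ϑ : Param) (n : ℕ) :
    IndepFun (fun s => M.path ϑ s n) (fun s => s n) M.seqLaw :=
  indepFun_of_adapted (ξ := fun n s => s n) (Z := fun n s => M.path ϑ s n)
    (fun n => measurable_pi_apply n) M.iIndepFun_seq (fun _ => rfl)
    (g := fun _ z => M.step ϑ z.1 z.2) (fun _ => M.measurable_step ϑ) (fun _ _ => rfl) n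

theorem map_path (M : QueueModel) (ϑ : Param) (n : ℕ) :
    M.seqLaw.map (fun s => M.path ϑ s n) = (M.kernel ϑ ^ n) (0, 0) := by
  induction n with
  | zero =>
    have h1 : (M.kernel ϑ ^ 0) (0, 0) = Measure.dirac ((0, 0) : QState) := by
      rw [pow_zero]; exact Kernel.id_apply _
    rw [h1]
    simp [path, Measure.map_const]
  | succ n ih =>
    have h1 : (M.kernel ϑ ^ (n + 1)) = M.kernel ϑ ∘ₖ (M.kernel ϑ ^ n) := pow_succ' _ _
    have hp : M.seqLaw.map (fun s => (M.path ϑ s n, s n))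
        = ((M.kernel ϑ ^ n) (0, 0)).prod M.noise := by
      rw [(M.indepFun_path ϑ n).map_prod_eq_prod_map_map (M.measurable_path ϑ n).aemeasurable
        (measurable_pi_apply n).aemeasurable, ih, map_seq]
    have h2 : (fun s => M.path ϑ s (n + 1))
        = (fun z : QState × (ℝ × ℝ) => M.step ϑ z.1 z.2) ∘ fun s => (M.path ϑ s n, s n) := rfl
    rw [h2, ← Measure.map_map (M.measurable_step ϑ)
      ((M.measurable_path ϑ n).prodMk (measurable_pi_apply n)), hp, h1, Kernel.comp_apply]
    ext S hS
    have : SFinite ((M.kernel ϑ ^ n) (0, 0)) := by rw [← ih]; infer_instance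
    rw [Measure.map_apply (M.measurable_step ϑ) hS, Measure.prod_apply (M.measurable_step ϑ hS),
      Measure.bind_apply hS (Kernel.aemeasurable _)]
    refine lintegral_congr fun x => ?_
    rw [kernel_apply, Measure.map_apply (M.measurable_step_right ϑ x) hS]
    rfl

/-! ### Expectations and uniform moments along the paths. -/

namespace Frame

variable {Fr : Frame M} {t A : ℝ} {F : QState → ℝ} {ϑ : Param}

theorem Osc.integrable_path (h : Fr.Osc t A F) (ht : 0 ≤ t) (ht' : t ≤ Fr.t₀)
    (hm : Fr.Mem (ϑ 0)⁻¹ (M.lam (ϑ 1))⁻¹) (n : ℕ) :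
    Integrable (fun s => F (M.path ϑ s n)) M.seqLaw := by
  have := (h.integrable_kernel_pow_and_integral ht ht' hm n (0, 0)).1
  rw [← map_path] at this
  exact (integrable_map_measure h.meas.aestronglyMeasurable
    (M.measurable_path ϑ n).aemeasurable).1 this

theorem Osc.integral_path (h : Fr.Osc t A F) (ht : 0 ≤ t) (ht' : t ≤ Fr.t₀)
    (hm : Fr.Mem (ϑ 0)⁻¹ (M.lam (ϑ 1))⁻¹) (n : ℕ) :
    ∫ s, F (M.path ϑ s n) ∂M.seqLaw = (M.T (ϑ 0)⁻¹ (M.lam (ϑ 1))⁻¹)^[n] F (0, 0) := by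
  rw [← (h.integrable_kernel_pow_and_integral ht ht' hm n (0, 0)).2, ← map_path,
    integral_map (M.measurable_path ϑ n).aemeasurable h.meas.aestronglyMeasurable]

theorem Osc.tendsto_integral_path (h : Fr.Osc t A F) (ht : 0 < t) (ht' : t ≤ Fr.t₀)
    (hm : Fr.Mem (ϑ 0)⁻¹ (M.lam (ϑ 1))⁻¹) :
    Tendsto (fun n => ∫ s, F (M.path ϑ s n) ∂M.seqLaw) atTop
      (𝓝 (M.statMean (ϑ 0)⁻¹ (M.lam (ϑ 1))⁻¹ F)) := by
  simp only [h.integral_path ht.le ht' hm]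
  exact h.tendsto_zero ht ht' hm

section Moments

variable {Ω : Type*} [MeasurableSpace Ω] {P : Measure Ω} [IsProbabilityMeasure P]
  {ξ : ℕ → Ω → ℝ × ℝ} {X : ℕ → Ω → QState}

/-- Uniform bound of the Lyapunov function along any controlled queue. -/
theorem lintegral_V_le (hξ : ∀ n, Measurable (ξ n)) (hlaw : ∀ n, P.map (ξ n) = M.noise)
    (hX : ∀ n, Measurable (X n)) (hind : ∀ n, IndepFun (X n) (ξ n) P)
    (hX0 : ∀ ω, X 0 ω = (0, 0))
    (hstep : ∀ n ω, ∃ a b, Fr.Mem a b ∧ X (n + 1) ω = lindley a b (X n ω) (ξ n ω))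
    (ht : 0 < t) (ht' : t ≤ Fr.t₀) (n : ℕ) :
    ∫⁻ ω, ENNReal.ofReal (Fr.V t (X n ω)) ∂P ≤ ENNReal.ofReal (1 - Fr.rate t)⁻¹ := by
  have hr := Fr.rate_lt_one ht ht'
  have hr0 := Fr.rate_nonneg t
  have hr' : 0 < 1 - Fr.rate t := by linarith
  induction n with
  | zero =>
    simp only [hX0, V_zero, lintegral_const, measure_univ, mul_one]
    exact ENNReal.ofReal_le_ofReal ((one_le_inv₀ hr').2 (by linarith))
  | succ n ih =>
    have hpos : ∀ᵐ ω ∂P, 0 ≤ (ξ n ω).1 ∧ 0 ≤ (ξ n ω).2 := by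
      have := Fr.noise_nonneg
      rw [← hlaw n] at this
      exact ae_of_ae_map (hξ n).aemeasurable this
    have hdm : Measurable fun s => ENNReal.ofReal (Real.exp (t * Fr.drift s)) := by
      unfold drift; fun_prop
    have hVm : Measurable fun x => ENNReal.ofReal (Fr.V t x) := (Fr.measurable_V t).ennreal_ofReal
    -- The parameters `(a, b)` may depend on `ω`. This is harmless because the pathwise bound by
    -- `drift` is the same over the whole rectangle. Only afterwards is the independence of state
    -- and noise used.
    have h1 : ∫⁻ ω, ENNReal.ofReal (Fr.V t (X (n + 1) ω)) ∂P
        ≤ ∫⁻ ω, (1 + ENNReal.ofReal (Fr.V t (X n ω))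
          * ENNReal.ofReal (Real.exp (t * Fr.drift (ξ n ω)))) ∂P := by
      refine lintegral_mono_ae ?_
      filter_upwards [hpos] with ω hω
      obtain ⟨a, b, hm, he⟩ := hstep n ω
      rw [he, ← ENNReal.ofReal_one, ← ENNReal.ofReal_mul (Fr.V_pos t _).le,
        ← ENNReal.ofReal_add zero_le_one (mul_nonneg (Fr.V_pos t _).le (Real.exp_pos _).le)]
      exact ENNReal.ofReal_le_ofReal (Fr.V_lindley_le ht.le hm _ hω)
    have h2 : ∫⁻ ω, ENNReal.ofReal (Fr.V t (X n ω))
          * ENNReal.ofReal (Real.exp (t * Fr.drift (ξ n ω))) ∂P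
        = (∫⁻ ω, ENNReal.ofReal (Fr.V t (X n ω)) ∂P) * ENNReal.ofReal (Fr.rate t) := by
      have h3 := lintegral_mul_eq_lintegral_mul_lintegral_of_indepFun
        (hVm.comp (hX n)) (hdm.comp (hξ n)) ((hind n).comp hVm hdm)
      simp only [Pi.mul_apply, Function.comp_apply] at h3
      rw [h3, ← lintegral_map hdm (hξ n), hlaw n, rate,
        ofReal_integral_eq_lintegral_ofReal (Fr.integrable_exp_drift ht.le ht')
          (ae_of_all _ fun _ => (Real.exp_pos _).le)]
    rw [lintegral_add_left measurable_const, h2, lintegral_const, measure_univ, mul_one] at h1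
    refine h1.trans ((add_le_add le_rfl (mul_le_mul_left ih _)).trans ?_)
    rw [← ENNReal.ofReal_mul (inv_pos.2 hr').le, ← ENNReal.ofReal_one,
      ← ENNReal.ofReal_add zero_le_one (by positivity)]
    refine ENNReal.ofReal_le_ofReal (le_of_eq ?_)
    field_simp
    ring

theorem integrable_and_integral_le_of_le_V {Y : Ω → ℝ} (hX : ∀ n, Measurable (X n))
    (hV : ∀ n, ∫⁻ ω, ENNReal.ofReal (Fr.V t (X n ω)) ∂P ≤ ENNReal.ofReal (1 - Fr.rate t)⁻¹)
    (ht : 0 < t) (ht' : t ≤ Fr.t₀) (n : ℕ) {C : ℝ} (hY : AEStronglyMeasurable Y P)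
    (hb : ∀ ω, |Y ω| ≤ C * Fr.V t (X n ω)) :
    Integrable Y P ∧ ∫ ω, Y ω ∂P ≤ C * (1 - Fr.rate t)⁻¹ := by
  have hVm : Measurable fun ω => Fr.V t (X n ω) := (Fr.measurable_V t).comp (hX n)
  have hi : Integrable (fun ω => Fr.V t (X n ω)) P := by
    refine ⟨hVm.aestronglyMeasurable, ?_⟩
    rw [hasFiniteIntegral_iff_ofReal (ae_of_all _ fun _ => (Fr.V_pos t _).le)]
    exact (hV n).trans_lt ENNReal.ofReal_lt_top
  have hle : ∫ ω, Fr.V t (X n ω) ∂P ≤ (1 - Fr.rate t)⁻¹ := by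
    rw [← ENNReal.ofReal_le_ofReal_iff (inv_nonneg.2 (by linarith [Fr.rate_lt_one ht ht'])),
      ofReal_integral_eq_lintegral_ofReal hi (ae_of_all _ fun _ => (Fr.V_pos t _).le)]
    exact hV n
  have hYi : Integrable Y P := (hi.const_mul C).mono' hY (ae_of_all _ hb)
  refine ⟨hYi, ?_⟩
  obtain ⟨ω⟩ : Nonempty Ω := by
    by_contra hne
    have : IsEmpty Ω := not_nonempty_iff.1 hne
    exact IsProbabilityMeasure.ne_zero P (Measure.eq_zero_of_isEmpty P)
  have hC : 0 ≤ C := nonneg_of_mul_nonneg_left ((abs_nonneg _).trans (hb ω)) (Fr.V_pos t _)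
  calc ∫ ω, Y ω ∂P ≤ ∫ ω, C * Fr.V t (X n ω) ∂P :=
        integral_mono hYi (hi.const_mul C) fun ω => (le_abs_self _).trans (hb ω)
    _ ≤ _ := by
        rw [integral_const_mul]
        exact mul_le_mul_of_nonneg_left hle hC

end Moments

end Frame

/-! ### Differentiability of the stationary waiting time through convexity. -/

/-- A function with subgradients along two differentiable coordinates is differentiable where the
subgradients are continuous. -/
theorem hasFDerivAt_of_subgradient {E : Type*} [NormedAddCommGroup E] [NormedSpace ℝ E]
    {m α β gα gβ : E → ℝ} {x₀ : E} {α' β' : E →L[ℝ] ℝ} (hα : HasFDerivAt α α' x₀)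
    (hβ : HasFDerivAt β β' x₀) (hgα : ContinuousAt gα x₀) (hgβ : ContinuousAt gβ x₀)
    (hsub : ∀ᶠ x in 𝓝 x₀, m x₀ + gα x₀ * (α x - α x₀) + gβ x₀ * (β x - β x₀) ≤ m x)
    (hsub' : ∀ᶠ x in 𝓝 x₀, m x + gα x * (α x₀ - α x) + gβ x * (β x₀ - β x) ≤ m x₀) :
    HasFDerivAt m (gα x₀ • α' + gβ x₀ • β') x₀ := by
  have hφ : HasFDerivAt (fun x => gα x₀ * α x + gβ x₀ * β x) (gα x₀ • α' + gβ x₀ • β') x₀ :=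
    (hα.const_mul _).add (hβ.const_mul _)
  -- The increment of the remainder is nonnegative by the subgradient at `x₀`. By the subgradient at
  -- `x` it is at most the increments of `α` and `β` times the changes of `gα` and `gβ`, which is
  -- `o(‖x - x₀‖)` by continuity.
  have hr : HasFDerivAt (fun x => m x - (gα x₀ * α x + gβ x₀ * β x)) (0 : E →L[ℝ] ℝ) x₀ := by
    rw [hasFDerivAt_iff_isLittleO]
    have h1 : (fun x => (gα x - gα x₀) * (α x - α x₀)) =o[𝓝 x₀] fun x => (1 : ℝ) * ‖x - x₀‖ :=
      ((Asymptotics.isLittleO_one_iff ℝ).2 (tendsto_sub_nhds_zero_iff.2 hgα)).mul_isBigO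
        hα.isBigO_sub.norm_right
    have h2 : (fun x => (gβ x - gβ x₀) * (β x - β x₀)) =o[𝓝 x₀] fun x => (1 : ℝ) * ‖x - x₀‖ :=
      ((Asymptotics.isLittleO_one_iff ℝ).2 (tendsto_sub_nhds_zero_iff.2 hgβ)).mul_isBigO
        hβ.isBigO_sub.norm_right
    have h3 := h1.add h2
    simp only [one_mul] at h3
    refine (Asymptotics.IsBigO.of_bound 1 ?_).trans_isLittleO h3.of_norm_right
    filter_upwards [hsub, hsub'] with x hx hx'
    rw [one_mul, zero_apply, sub_zero, Real.norm_eq_abs, Real.norm_eq_abs,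
      abs_of_nonneg (by linarith)]
    refine le_trans ?_ (le_abs_self _)
    linarith
  have h := hφ.add hr
  rw [add_zero] at h
  exact h.congr_of_eventuallyEq (Eventually.of_forall fun x => by simp)

theorem path_fst_nonneg (M : QueueModel) (ϑ : Param) (s : ℕ → ℝ × ℝ) (n : ℕ) :
    0 ≤ (M.path ϑ s n).1 := by
  cases n with
  | zero => simp [path]
  | succ n => exact le_max_right _ _

/-- The waiting time is convex in the mean service and interarrival times; its subgradient is
given by the work and the interarrival times accumulated in the busy period. -/
theorem path_subgradient (M : QueueModel) {ϑ ϑ' : Param} (ha : (ϑ 0)⁻¹ ≠ 0)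
    (hb : (M.lam (ϑ 1))⁻¹ ≠ 0) (s : ℕ → ℝ × ℝ) (n : ℕ) :
    (M.path ϑ s n).1
        + ((ϑ' 0)⁻¹ - (ϑ 0)⁻¹) * (((M.path ϑ s n).1 + (M.path ϑ s n).2) / (ϑ 0)⁻¹)
        - ((M.lam (ϑ' 1))⁻¹ - (M.lam (ϑ 1))⁻¹) * ((M.path ϑ s n).2 / (M.lam (ϑ 1))⁻¹)
      ≤ (M.path ϑ' s n).1 := by
  induction n with
  | zero => simp [path]
  | succ n ih =>
    have h0 := M.path_fst_nonneg ϑ' s (n + 1)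
    have hle : (M.path ϑ' s n).1 - (M.lam (ϑ' 1))⁻¹ * (s n).1 + (ϑ' 0)⁻¹ * (s n).2
        ≤ (M.path ϑ' s (n + 1)).1 := by
      simp only [path, step_eq_lindley]
      exact le_max_left _ _
    rcases lt_or_ge 0 ((M.path ϑ s n).1 - (M.lam (ϑ 1))⁻¹ * (s n).1 + (ϑ 0)⁻¹ * (s n).2)
      with hp | hp
    · have e : M.path ϑ s (n + 1)
          = ((M.path ϑ s n).1 - (M.lam (ϑ 1))⁻¹ * (s n).1 + (ϑ 0)⁻¹ * (s n).2,
            (M.path ϑ s n).2 + (M.lam (ϑ 1))⁻¹ * (s n).1) := by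
        simp only [path, step_eq_lindley]
        exact lindley_of_pos hp
      rw [e]
      generalize (M.lam (ϑ 1))⁻¹ = b at *
      generalize (M.lam (ϑ' 1))⁻¹ = b' at *
      generalize (ϑ 0)⁻¹ = a at *
      generalize (ϑ' 0)⁻¹ = a' at *
      generalize M.path ϑ s n = x at *
      -- Within a busy period `(w + y) / a` and `y / b` are the accumulated unscaled service and
      -- interarrival times. They increase by exactly `(s n).2` and `(s n).1`, so the affine
      -- minorant follows the untruncated recursion of `ϑ'`.
      refine le_trans (le_of_eq ?_) ((add_le_add (sub_le_sub_right ih (b' * (s n).1))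
        (le_refl (a' * (s n).2))).trans hle)
      field_simp
      ring
    -- When the queue empties, value and subgradient both reset to zero, and nonnegativity of the
    -- other waiting time suffices.
    · have e : M.path ϑ s (n + 1) = (0, 0) := by
        simp only [path, step_eq_lindley]
        exact lindley_of_nonpos hp
      rw [e]
      simpa using h0

namespace Frame

variable {Fr : Frame M} {θ : ℝ} {ϑ ϑ' : Param}

variable (Fr) in
/-- Parameters whose mean service and interarrival times lie in the rectangle. -/
abbrev Good (ϑ : Param) : Prop := Fr.Mem (ϑ 0)⁻¹ (M.lam (ϑ 1))⁻¹

/-- Stationary mean of a function under the parameter `ϑ`. -/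
abbrev _root_.QueueModel.mean (M : QueueModel) (ϑ : Param) (F : QState → ℝ) : ℝ :=
  M.statMean (ϑ 0)⁻¹ (M.lam (ϑ 1))⁻¹ F

theorem mean_lin_eq (hθ : Fr.Adm θ) (hm : Fr.Good ϑ) :
    M.mean ϑ (lin 1 1) = M.mean ϑ (lin 1 0) + M.mean ϑ (lin 0 1) := by
  have h1 := (smooth_lin hθ (p := 1) (q := 1) (by simp) (by simp)).toOsc
  have h2 := (smooth_lin hθ (p := 0) (q := 1) (by simp) (by simp)).toOsc
  have h := statMean_sub h1 h2 hθ.pos hθ.le' hm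
  have e : (fun x : QState => lin 1 1 x - lin 0 1 x) = lin 1 0 := by
    funext x; simp [lin]
  rw [e] at h
  linarith

/-- Both queues are driven by one noise sequence. The pathwise inequality for customer `n` is
integrated, and `n` tends to infinity. -/
theorem mean_subgradient (hθ : Fr.Adm θ) (hm : Fr.Good ϑ) (hm' : Fr.Good ϑ') :
    M.mean ϑ (lin 1 0) + M.mean ϑ (lin 1 1) / (ϑ 0)⁻¹ * ((ϑ' 0)⁻¹ - (ϑ 0)⁻¹)
      + -(M.mean ϑ (lin 0 1) / (M.lam (ϑ 1))⁻¹) * ((M.lam (ϑ' 1))⁻¹ - (M.lam (ϑ 1))⁻¹)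
      ≤ M.mean ϑ' (lin 1 0) := by
  have h10 := (smooth_lin hθ (p := 1) (q := 0) (by simp) (by simp)).toOsc
  have h11 := (smooth_lin hθ (p := 1) (q := 1) (by simp) (by simp)).toOsc
  have h01 := (smooth_lin hθ (p := 0) (q := 1) (by simp) (by simp)).toOsc
  have h0 := hθ.pos
  have h1 := hθ.le'
  refine le_of_tendsto_of_tendsto' ((((h10.tendsto_integral_path h0 h1 hm).add
    (((h11.tendsto_integral_path h0 h1 hm).div_const _).mul_const _))).add
    (((h01.tendsto_integral_path h0 h1 hm).div_const _).neg.mul_const _))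
    (h10.tendsto_integral_path h0 h1 hm') fun n => ?_
  have i10 := h10.integrable_path h0.le h1 hm n
  have i11 := (h11.integrable_path h0.le h1 hm n).div_const (ϑ 0)⁻¹
  have i01 := (h01.integrable_path h0.le h1 hm n).div_const (M.lam (ϑ 1))⁻¹
  have j1 := i11.mul_const ((ϑ' 0)⁻¹ - (ϑ 0)⁻¹)
  have j2 : Integrable (fun s => -(lin 0 1 (M.path ϑ s n) / (M.lam (ϑ 1))⁻¹)
      * ((M.lam (ϑ' 1))⁻¹ - (M.lam (ϑ 1))⁻¹)) M.seqLaw := i01.neg.mul_const ((M.lam (ϑ' 1))⁻¹ - (M.lam (ϑ 1))⁻¹)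
  have j3 : Integrable (fun s => lin 1 0 (M.path ϑ s n)
    + lin 1 1 (M.path ϑ s n) / (ϑ 0)⁻¹ * ((ϑ' 0)⁻¹ - (ϑ 0)⁻¹)) M.seqLaw := i10.add j1
  rw [← integral_div, ← integral_div, ← integral_neg, ← integral_mul_const, ← integral_mul_const,
    ← integral_add i10 j1, ← integral_add j3 j2]
  refine integral_mono (j3.add j2) (h10.integrable_path h0.le h1 hm' n) fun s => ?_
  have := M.path_subgradient (ϑ' := ϑ') hm.a_pos.ne' hm.b_pos.ne' s n
  simp only [lin, one_mul, zero_mul, add_zero, zero_add] at this ⊢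
  linarith

theorem continuousAt_mean (hθ : Fr.Adm θ) (hev : ∀ᶠ ϑ' in 𝓝 ϑ, Fr.Good ϑ')
    (ha : ContinuousAt (fun ϑ : Param => (ϑ 0)⁻¹) ϑ)
    (hb : ContinuousAt (fun ϑ : Param => (M.lam (ϑ 1))⁻¹) ϑ) {p q : ℝ} (hp : |p| ≤ 1)
    (hq : |q| ≤ 1) : ContinuousAt (fun ϑ => M.mean ϑ (lin p q)) ϑ := by
  have hF := smooth_lin hθ hp hq
  have hm := hev.self_of_nhds
  have h0 : Tendsto (fun ϑ' : Param => Fr.meanConst θ * Fr.linConst θ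
      * (|(ϑ' 0)⁻¹ - (ϑ 0)⁻¹| + |(M.lam (ϑ' 1))⁻¹ - (M.lam (ϑ 1))⁻¹|)) (𝓝 ϑ) (𝓝 0) := by
    have h1 := (tendsto_sub_nhds_zero_iff.2 ha).abs
    have h2 := (tendsto_sub_nhds_zero_iff.2 hb).abs
    simpa using (h1.add h2).const_mul (Fr.meanConst θ * Fr.linConst θ)
  refine tendsto_sub_nhds_zero_iff.1 (squeeze_zero_norm' ?_ h0)
  filter_upwards [hev] with ϑ' hm'
  exact hF.abs_statMean_sub_le hθ hm' hm

/-- Differentiability of the stationary waiting time. -/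
theorem hasFDerivAt_mean_wait (hθ : Fr.Adm θ) (hev : ∀ᶠ ϑ' in 𝓝 ϑ, Fr.Good ϑ')
    {a' b' : Param →L[ℝ] ℝ} (ha : HasFDerivAt (fun ϑ : Param => (ϑ 0)⁻¹) a' ϑ)
    (hb : HasFDerivAt (fun ϑ : Param => (M.lam (ϑ 1))⁻¹) b' ϑ) :
    HasFDerivAt (fun ϑ => M.mean ϑ (lin 1 0)) ((M.mean ϑ (lin 1 1) / (ϑ 0)⁻¹) • a'
      + (-(M.mean ϑ (lin 0 1) / (M.lam (ϑ 1))⁻¹)) • b') ϑ := by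
  have hm := hev.self_of_nhds
  have hc := fun {p q : ℝ} (hp : |p| ≤ 1) (hq : |q| ≤ 1) =>
    continuousAt_mean hθ hev ha.continuousAt hb.continuousAt hp hq
  refine hasFDerivAt_of_subgradient (gα := fun ϑ => M.mean ϑ (lin 1 1) / (ϑ 0)⁻¹)
    (gβ := fun ϑ => -(M.mean ϑ (lin 0 1) / (M.lam (ϑ 1))⁻¹)) ha hb
    ((hc (by simp) (by simp)).div ha.continuousAt hm.a_pos.ne')
    ((hc (by simp) (by simp)).div hb.continuousAt hm.b_pos.ne').neg ?_ ?_
  · filter_upwards [hev] with ϑ' hm'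
    exact mean_subgradient hθ hm hm'
  · filter_upwards [hev] with ϑ' hm'
    exact mean_subgradient hθ hm' hm

end Frame

/-! ### Existence of a frame under light tails. -/

/-- The moment generating function of a variable with negative mean is below one near zero. -/
theorem exists_mgf_lt_one {Ω : Type*} [MeasurableSpace Ω] {P : Measure Ω} [IsProbabilityMeasure P]
    {X : Ω → ℝ} (h : 0 ∈ interior (integrableExpSet X P)) (hX : ∫ ω, X ω ∂P < 0) :
    ∃ t₁ > 0, ∀ t, 0 < t → t ≤ t₁ → mgf X P t < 1 := by
  have hd := hasDerivAt_mgf h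
  have hs := hd.tendsto_slope_zero_right
  simp only [zero_add, zero_mul, Real.exp_zero, mul_one, mgf_zero] at hs
  have hev := hs.eventually (gt_mem_nhds hX)
  obtain ⟨t₁, ht₁, hsub⟩ := (mem_nhdsGT_iff_exists_Ioc_subset).1 hev
  refine ⟨t₁, ht₁, fun t h0 h1 => ?_⟩
  have h2 : t⁻¹ • (mgf X P t - 1) < 0 := hsub ⟨h0, h1⟩
  rw [smul_eq_mul] at h2
  by_contra hge
  push Not at hge
  have : 0 ≤ t⁻¹ * (mgf X P t - 1) := mul_nonneg (inv_pos.2 h0).le (by linarith)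
  linarith

namespace LightTailed

variable (hT : M.LightTailed)
include hT

theorem noise_nonneg : ∀ᵐ s ∂M.noise, 0 ≤ s.1 ∧ 0 ≤ s.2 := by
  have h1 : ∀ᵐ s ∂M.noise, 0 ≤ s.1 := Measure.quasiMeasurePreserving_fst.ae hT.U_nonneg
  have h2 : ∀ᵐ s ∂M.noise, 0 ≤ s.2 := Measure.quasiMeasurePreserving_snd.ae hT.V_nonneg
  exact h1.and h2

theorem exists_integrable_exp :
    ∃ η > 0, Integrable (fun s : ℝ × ℝ => Real.exp (η * (s.1 + s.2))) M.noise := by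
  obtain ⟨η, hη, hU, hV, -⟩ := hT.exp_moments
  refine ⟨η, hη, ?_⟩
  have := hU.mul_prod hV
  simpa only [mul_add, Real.exp_add] using this

theorem integrable_U : Integrable (fun s : ℝ => s) M.lawU := by
  refine Integrable.of_integral_ne_zero ?_
  rw [hT.U_mean]; exact one_ne_zero

theorem integrable_V : Integrable (fun s : ℝ => s) M.lawV := by
  refine Integrable.of_integral_ne_zero ?_
  rw [hT.V_mean]; exact one_ne_zero

theorem integral_fst : ∫ s, s.1 ∂M.noise = 1 := by
  rw [integral_fun_fst (fun s : ℝ => s)]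
  simp [hT.U_mean]

theorem integral_snd : ∫ s, s.2 ∂M.noise = 1 := by
  rw [integral_fun_snd (fun s : ℝ => s)]
  simp [hT.V_mean]

theorem zero_mem_interior (k α β : ℝ) :
    0 ∈ interior (integrableExpSet (fun s : ℝ × ℝ => k + α * s.2 - β * s.1) M.noise) := by
  obtain ⟨η, hη, hi⟩ := hT.exists_integrable_exp
  set R := |α| + |β| + 1 with hR
  have hRpos : 0 < R := by positivity
  rw [mem_interior_iff_mem_nhds]
  have hδ : 0 < η / R := by positivity
  filter_upwards [Ioo_mem_nhds (neg_lt_zero.2 hδ) hδ] with t ht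
  have htabs : |t| * R ≤ η := by
    have := abs_lt.2 ht
    rw [lt_div_iff₀ hRpos] at this
    exact this.le
  refine (hi.const_mul (Real.exp (t * k))).mono' (by fun_prop) ?_
  filter_upwards [hT.noise_nonneg] with s hs
  rw [Real.norm_eq_abs, Real.abs_exp, ← Real.exp_add]
  refine Real.exp_le_exp.2 ?_
  have h1 : t * (α * s.2 - β * s.1) ≤ |t| * R * (s.1 + s.2) := by
    calc t * (α * s.2 - β * s.1) ≤ |t * (α * s.2 - β * s.1)| := le_abs_self _
      _ = |t| * |α * s.2 - β * s.1| := abs_mul _ _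
      _ ≤ |t| * (|α| * s.2 + |β| * s.1) := by
          refine mul_le_mul_of_nonneg_left ?_ (abs_nonneg t)
          refine (abs_sub _ _).trans ?_
          rw [abs_mul, abs_mul, abs_of_nonneg hs.1, abs_of_nonneg hs.2]
      _ ≤ |t| * (R * (s.1 + s.2)) := by
          refine mul_le_mul_of_nonneg_left ?_ (abs_nonneg t)
          rw [hR]
          nlinarith [mul_nonneg (abs_nonneg α) hs.1, mul_nonneg (abs_nonneg β) hs.2, hs.1, hs.2]
      _ = _ := by ring
  have h2 := mul_le_mul_of_nonneg_right htabs (add_nonneg hs.1 hs.2)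
  linarith

theorem exists_mgf_lt_one {k α β : ℝ} (h : k + α - β < 0) :
    ∃ t₁ > 0, ∀ t, 0 < t → t ≤ t₁ →
      ∫ s : ℝ × ℝ, Real.exp (t * (k + α * s.2 - β * s.1)) ∂M.noise < 1 := by
  refine QueueModel.exists_mgf_lt_one (hT.zero_mem_interior k α β) ?_
  have i1 : Integrable (fun s : ℝ × ℝ => s.1) M.noise := hT.integrable_U.comp_fst M.lawV
  have i2 : Integrable (fun s : ℝ × ℝ => s.2) M.noise := hT.integrable_V.comp_snd M.lawU
  have i3 : Integrable (fun s : ℝ × ℝ => k + α * s.2) M.noise :=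
    (integrable_const k).add (i2.const_mul α)
  rw [integral_sub i3 (i1.const_mul β),
    integral_add (integrable_const k) (i2.const_mul α), integral_const_mul, integral_const_mul,
    hT.integral_fst, hT.integral_snd]
  simpa using h

/-- The increment `aHi * V - (bLo + aHi) / 2 * U` has mean `(aHi - bLo) / 2 < 0`, so its moment
generating function is below one on some `(0, t₁]`. The second term in the minimum keeps the growth
bound within the available exponential moment. -/
theorem exists_frame {aLo aHi bLo bHi : ℝ} (h1 : 0 < aLo) (h2 : aLo ≤ aHi) (h3 : aHi < bLo)
    (h4 : bLo ≤ bHi) :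
    ∃ Fr : Frame M, Fr.aLo = aLo ∧ Fr.aHi = aHi ∧ Fr.bLo = bLo ∧ Fr.bHi = bHi := by
  obtain ⟨η, hη, hi⟩ := hT.exists_integrable_exp
  obtain ⟨t₁, ht₁, hlt⟩ := hT.exists_mgf_lt_one (k := 0) (α := aHi) (β := (bLo + aHi) / 2)
    (by linarith)
  obtain ⟨D, hD⟩ := hT.V_density
  have hB : 0 < aHi + bHi := by linarith
  refine ⟨⟨aLo, aHi, bLo, bHi, min t₁ (η / (aHi + bHi)), D, h1, h2, h3, h4,
    lt_min ht₁ (by positivity), hT.U_nonneg, hT.V_nonneg, hD, fun t h0 h => ?_, ?_⟩,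
    rfl, rfl, rfl, rfl⟩
  · have := hlt t h0 (h.trans (min_le_left _ _))
    simpa only [zero_add] using this
  · refine hi.mono' (by fun_prop) ?_
    filter_upwards [hT.noise_nonneg] with s hs
    rw [Real.norm_eq_abs, Real.abs_exp, ← mul_assoc]
    refine Real.exp_le_exp.2 (mul_le_mul_of_nonneg_right ?_ (add_nonneg hs.1 hs.2))
    calc _ ≤ η / (aHi + bHi) * (aHi + bHi) :=
          mul_le_mul_of_nonneg_right (min_le_right _ _) hB.le
      _ = η := div_mul_cancel₀ _ hB.ne'

end LightTailed

/-! ### Little's law for the expected time averages. -/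

theorem tendsto_sum_range_div {e : ℕ → ℝ} {l k : ℝ} (he : Tendsto e atTop (𝓝 l))
    {N : ℝ → ℕ} (hN : Tendsto N atTop atTop)
    (hk : Tendsto (fun T => (N T : ℝ) / T) atTop (𝓝 k)) :
    Tendsto (fun T => (∑ n ∈ Finset.range (N T), e n) / T) atTop (𝓝 (k * l)) := by
  refine (hk.mul (he.cesaro.comp hN)).congr fun T => ?_
  simp only [Function.comp_apply]
  by_cases h : N T = 0
  · simp [h]
  · have : (N T : ℝ) ≠ 0 := by exact_mod_cast h
    field_simp

/-- Averaging argument behind Little's law: the contributions `L T n` of the customers to the time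
integral over `[0, T]` are compared with the mean sojourn times `e n`. -/
theorem tendsto_tsum_div {L : ℝ → ℕ → ℝ} {e : ℕ → ℝ} {l b : ℝ} (hb : 0 < b)
    (he : Tendsto e atTop (𝓝 l)) (hL0 : ∀ T n, 0 ≤ L T n) (hLe : ∀ T n, L T n ≤ e n)
    (hup : ∀ ε > 0, ∃ q C : ℝ, 0 ≤ q ∧ q < 1 ∧ 0 ≤ C ∧ ∀ T > 0, ∀ n : ℕ, (1 + ε) * T ≤ n * b →
      L T n ≤ C * q ^ n)
    (hlo : ∀ ε > 0, ε < 1 → ∃ C : ℝ, ∀ T : ℝ, 1 ≤ T → ∀ n : ℕ, n * b ≤ (1 - ε) * T →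
      e n - C / √T ≤ L T n) :
    Tendsto (fun T => (∑' n, ENNReal.ofReal (L T n)).toReal / T) atTop (𝓝 (l / b)) := by
  have he0 : ∀ n, 0 ≤ e n := fun n => (hL0 0 n).trans (hLe 0 n)
  have hl : 0 ≤ l := ge_of_tendsto' he he0
  -- About `(1 + ε) T / b` customers are counted with their full mean sojourn time. The later ones
  -- add only a geometric tail, bounded uniformly in `T`.
  have hmain : ∀ ε > 0, ∃ C : ℝ, ∀ T > 0, Summable (L T) ∧
      ∑' n, L T n ≤ ∑ n ∈ Finset.range ⌈(1 + ε) / b * T⌉₊, e n + C := by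
    intro ε hε
    obtain ⟨q, C, hq0, hq1, hC, h⟩ := hup ε hε
    refine ⟨C * (1 - q)⁻¹, fun T hT => ?_⟩
    set N := ⌈(1 + ε) / b * T⌉₊
    have hs1 : HasSum (fun n => if n ∈ Finset.range N then e n else 0)
        (∑ n ∈ Finset.range N, e n) := by
      have : HasSum (fun n => if n ∈ Finset.range N then e n else 0)
          (∑ n ∈ Finset.range N, if n ∈ Finset.range N then e n else 0) :=
        hasSum_sum_of_ne_finset_zero fun n hn => if_neg hn
      rwa [Finset.sum_congr rfl fun n hn => if_pos hn] at this
    have hs := hs1.add ((hasSum_geometric_of_lt_one hq0 hq1).mul_left C)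
    have hle : ∀ n, L T n ≤ (if n ∈ Finset.range N then e n else 0) + C * q ^ n := by
      intro n
      have hp : 0 ≤ C * q ^ n := by positivity
      split_ifs with hn
      · linarith [hLe T n]
      · rw [zero_add]
        refine h T hT n ?_
        rw [Finset.mem_range, not_lt] at hn
        have h1 : (1 + ε) / b * T ≤ n := (Nat.le_ceil _).trans (by exact_mod_cast hn)
        rw [div_mul_eq_mul_div, div_le_iff₀ hb] at h1
        exact h1
    have hsum := Summable.of_nonneg_of_le (hL0 T) hle hs.summable
    exact ⟨hsum, (hsum.tsum_le_tsum hle hs.summable).trans hs.tsum_eq.le⟩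
  have hEq : ∀ T > 0, (∑' n, ENNReal.ofReal (L T n)).toReal = ∑' n, L T n := by
    intro T hT
    obtain ⟨C, h⟩ := hmain 1 one_pos
    rw [← ENNReal.ofReal_tsum_of_nonneg (hL0 T) (h T hT).1,
      ENNReal.toReal_ofReal (tsum_nonneg (hL0 T))]
  refine tendsto_order.2 ⟨fun u hu => ?_, fun u hu => ?_⟩
  -- Lower bound: the first `(1 - ε) T / b` customers lose at most `C / √T` each, which vanishes
  -- after division by `T`.
  · obtain ⟨ε, hε, hε1, hεu⟩ : ∃ ε > 0, ε < 1 ∧ u < (1 - ε) / b * l := by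
      have hc : Tendsto (fun ε : ℝ => (1 - ε) / b * l) (𝓝[>] 0) (𝓝 ((1 - 0) / b * l)) :=
        (Continuous.tendsto (by fun_prop) 0).mono_left nhdsWithin_le_nhds
      have h1 : u < (1 - 0) / b * l := by rw [sub_zero, one_div_mul_eq_div]; exact hu
      obtain ⟨ε, h2, h3⟩ := ((hc.eventually (lt_mem_nhds h1)).and
        (Ioo_mem_nhdsGT (zero_lt_one (α := ℝ)))).exists
      exact ⟨ε, h3.1, h3.2, h2⟩
    obtain ⟨C, hC⟩ := hlo ε hε hε1
    obtain ⟨C', hC'⟩ := hmain 1 one_pos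
    have hk : 0 < (1 - ε) / b := div_pos (by linarith) hb
    have hfl : Tendsto (fun T : ℝ => (⌊(1 - ε) / b * T⌋₊ : ℝ) / T) atTop (𝓝 ((1 - ε) / b)) :=
      tendsto_nat_floor_mul_div_atTop hk.le
    have h1 := tendsto_sum_range_div he (N := fun T => ⌊(1 - ε) / b * T⌋₊)
      (tendsto_nat_floor_atTop.comp (tendsto_id.const_mul_atTop hk)) hfl
    have h2 : Tendsto (fun T : ℝ => C / √T) atTop (𝓝 0) :=
      Real.tendsto_sqrt_atTop.const_div_atTop C
    have h3 := h1.sub (hfl.mul h2)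
    rw [mul_zero, sub_zero] at h3
    filter_upwards [h3.eventually (lt_mem_nhds hεu), eventually_ge_atTop 1] with T hT hT1
    have hT0 : 0 < T := by linarith
    refine hT.trans_le ?_
    rw [hEq T hT0]
    have h4 : ∑ n ∈ Finset.range ⌊(1 - ε) / b * T⌋₊, (e n - C / √T) ≤ ∑' n, L T n := by
      refine (Finset.sum_le_sum fun n hn => ?_).trans
        ((hC' T hT0).1.sum_le_tsum _ fun n _ => hL0 T n)
      refine hC T hT1 n ?_
      have h5 : (n : ℝ) ≤ (1 - ε) / b * T :=
        (Nat.le_floor_iff (by positivity)).1 (Finset.mem_range.1 hn).le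
      rw [div_mul_eq_mul_div, le_div_iff₀ hb] at h5
      exact h5
    rw [Finset.sum_sub_distrib, Finset.sum_const, Finset.card_range, nsmul_eq_mul] at h4
    refine le_trans (le_of_eq ?_) (div_le_div_of_nonneg_right h4 hT0.le)
    ring
  · obtain ⟨ε, hε, hεu⟩ : ∃ ε > 0, (1 + ε) / b * l < u := by
      have hc : Tendsto (fun ε : ℝ => (1 + ε) / b * l) (𝓝[>] 0) (𝓝 ((1 + 0) / b * l)) :=
        (Continuous.tendsto (by fun_prop) 0).mono_left nhdsWithin_le_nhds
      have h1 : (1 + 0) / b * l < u := by rw [add_zero, one_div_mul_eq_div]; exact hu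
      obtain ⟨ε, h2, h3⟩ := ((hc.eventually (gt_mem_nhds h1)).and
        (self_mem_nhdsWithin (s := Set.Ioi (0 : ℝ)))).exists
      exact ⟨ε, h3, h2⟩
    obtain ⟨C, hC⟩ := hmain ε hε
    have hk : 0 < (1 + ε) / b := by positivity
    have h1 := tendsto_sum_range_div he (N := fun T => ⌈(1 + ε) / b * T⌉₊)
      (tendsto_nat_ceil_atTop.comp (tendsto_id.const_mul_atTop hk))
      (tendsto_nat_ceil_mul_div_atTop hk.le)
    have h2 := h1.add ((tendsto_id (α := ℝ)).const_div_atTop C)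
    rw [add_zero] at h2
    filter_upwards [h2.eventually (gt_mem_nhds hεu), eventually_gt_atTop 0] with T hT hT0
    refine lt_of_le_of_lt ?_ hT
    rw [hEq T hT0]
    refine (div_le_div_of_nonneg_right (hC T hT0).2 hT0.le).trans (le_of_eq ?_)
    rw [add_div]
    rfl

/-- Time spent in the system by customer `n`. -/
def sojourn (M : QueueModel) (ϑ : Param) (s : ℕ → ℝ × ℝ) (n : ℕ) : ℝ :=
  (M.path ϑ s n).1 + (ϑ 0)⁻¹ * (s n).2

/-- Time spent in the system by customer `n` during `[0, T]`. -/
def contribution (M : QueueModel) (ϑ : Param) (T : ℝ) (n : ℕ) (s : ℕ → ℝ × ℝ) : ℝ :=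
  max (min T (M.departure ϑ s n) - max 0 (M.arrival ϑ s n)) 0

theorem departure_eq (M : QueueModel) (ϑ : Param) (s : ℕ → ℝ × ℝ) (n : ℕ) :
    M.departure ϑ s n = M.arrival ϑ s n + M.sojourn ϑ s n := by
  rw [departure, sojourn, div_eq_inv_mul, add_assoc]

theorem measurable_arrival (M : QueueModel) (ϑ : Param) (n : ℕ) :
    Measurable fun s => M.arrival ϑ s n := by
  unfold arrival; fun_prop

theorem measurable_sojourn (M : QueueModel) (ϑ : Param) (n : ℕ) :
    Measurable fun s => M.sojourn ϑ s n :=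
  (M.measurable_path ϑ n).fst.add (by fun_prop)

theorem measurable_contribution (M : QueueModel) (ϑ : Param) (T : ℝ) (n : ℕ) :
    Measurable (M.contribution ϑ T n) := by
  have h1 := M.measurable_arrival ϑ n
  have h2 := M.measurable_sojourn ϑ n
  unfold contribution
  simp only [departure_eq]
  fun_prop

theorem contribution_nonneg (M : QueueModel) (ϑ : Param) (T : ℝ) (n : ℕ) (s : ℕ → ℝ × ℝ) :
    0 ≤ M.contribution ϑ T n s := le_max_right _ _

/-- Summation over customers and integration over time are exchanged. Each customer contributes the
length of the part of the sojourn interval lying in `(0, T]`; endpoints do not matter. -/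
theorem lintegral_queueLength (M : QueueModel) (ϑ : Param) (T : ℝ) (s : ℕ → ℝ × ℝ) :
    ∫⁻ r in Set.Ioc 0 T, M.queueLength ϑ s r
      = ∑' n, ENNReal.ofReal (M.contribution ϑ T n s) := by
  classical
  have h1 : ∀ r, M.queueLength ϑ s r = ∑' n : ℕ,
      (Set.Ico (M.arrival ϑ s n) (M.departure ϑ s n)).indicator (fun _ => (1 : ENNReal)) r := by
    intro r
    unfold queueLength
    refine tsum_congr fun n => ?_
    simp only [Set.indicator_apply, Set.mem_Ico]
  simp only [h1]
  rw [lintegral_tsum fun n => (measurable_const.indicator measurableSet_Ico).aemeasurable]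
  refine tsum_congr fun n => ?_
  rw [lintegral_indicator_const measurableSet_Ico, one_mul,
    Measure.restrict_apply measurableSet_Ico,
    measure_congr (show (Set.Ico (M.arrival ϑ s n) (M.departure ϑ s n) ∩ Set.Ioc 0 T : Set ℝ)
      =ᵐ[volume] (Set.Ioc (M.arrival ϑ s n) (M.departure ϑ s n) ∩ Set.Ioc 0 T : Set ℝ) from
      Ico_ae_eq_Ioc.inter (ae_eq_refl _)), Set.Ioc_inter_Ioc, Real.volume_Ioc]
  rw [contribution, max_comm 0, min_comm T]
  rw [ENNReal.ofReal, ENNReal.ofReal]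
  congr 1
  ext
  simp [Real.coe_toNNReal']

theorem ae_seq {p : ℝ × ℝ → Prop} (h : ∀ᵐ s ∂M.noise, p s) : ∀ᵐ s ∂M.seqLaw, ∀ n, p (s n) := by
  rw [ae_all_iff]
  intro n
  rw [← M.map_seq n] at h
  exact ae_of_ae_map (measurable_pi_apply n).aemeasurable h

theorem integrable_seq {f : ℝ × ℝ → ℝ} (hf : Integrable f M.noise) (n : ℕ) :
    Integrable (fun s => f (s n)) M.seqLaw := by
  rw [← M.map_seq n] at hf
  exact hf.comp_measurable (measurable_pi_apply n)

theorem integral_seq {f : ℝ × ℝ → ℝ} (hf : Integrable f M.noise) (n : ℕ) :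
    ∫ s, f (s n) ∂M.seqLaw = ∫ s, f s ∂M.noise := by
  have h := hf
  rw [← M.map_seq n] at h
  rw [← integral_map (measurable_pi_apply n).aemeasurable h.aestronglyMeasurable, M.map_seq n]

theorem avgQueue_eq (ϑ : Param) (T : ℝ)
    (hi : ∀ n, Integrable (M.contribution ϑ T n) M.seqLaw) :
    M.avgQueue ϑ T
      = (∑' n, ENNReal.ofReal (∫ s, M.contribution ϑ T n s ∂M.seqLaw)).toReal / T := by
  unfold avgQueue
  simp only [lintegral_queueLength]
  rw [lintegral_tsum fun n => (M.measurable_contribution ϑ T n).ennreal_ofReal.aemeasurable]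
  congr 2
  refine tsum_congr fun n => ?_
  rw [ofReal_integral_eq_lintegral_ofReal (hi n)
    (ae_of_all _ fun s => M.contribution_nonneg ϑ T n s)]

theorem arrival_nonneg {ϑ : Param} (hb : 0 ≤ (M.lam (ϑ 1))⁻¹) {s : ℕ → ℝ × ℝ}
    (hs : ∀ n, 0 ≤ (s n).1 ∧ 0 ≤ (s n).2) (n : ℕ) : 0 ≤ M.arrival ϑ s n :=
  Finset.sum_nonneg fun i _ => by
    rw [div_eq_mul_inv]; exact mul_nonneg (hs i).1 hb

theorem sojourn_nonneg {ϑ : Param} (ha : 0 ≤ (ϑ 0)⁻¹) {s : ℕ → ℝ × ℝ}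
    (hs : ∀ n, 0 ≤ (s n).1 ∧ 0 ≤ (s n).2) (n : ℕ) : 0 ≤ M.sojourn ϑ s n :=
  add_nonneg (M.path_fst_nonneg ϑ s n) (mul_nonneg ha (hs n).2)

theorem contribution_le_sojourn {ϑ : Param} {s : ℕ → ℝ × ℝ} {n : ℕ}
    (hS : 0 ≤ M.sojourn ϑ s n) (T : ℝ) : M.contribution ϑ T n s ≤ M.sojourn ϑ s n := by
  unfold contribution
  rw [departure_eq]
  refine max_le ?_ hS
  linarith [min_le_right T (M.arrival ϑ s n + M.sojourn ϑ s n), le_max_right 0 (M.arrival ϑ s n)]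

/-- A positive contribution needs an arrival by time `T`, which forces `y ≥ 0`, so the exponential
is at least one. The inequality `S ≤ q S² + 1/q` separates the sojourn time from this rare event
without any appeal to independence. -/
theorem contribution_le_exp {ϑ : Param} {s : ℕ → ℝ × ℝ} {n : ℕ}
    (hS : 0 ≤ M.sojourn ϑ s n) (T : ℝ) {q δ y : ℝ} (hq : 0 < q)
    (hδ : 0 ≤ δ) (hy : T ≤ M.arrival ϑ s n + y) :
    M.contribution ϑ T n s ≤ q * M.sojourn ϑ s n ^ 2 + q⁻¹ * Real.exp (δ * y) := by
  have hq' := inv_pos.2 hq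
  rcases le_or_gt (M.arrival ϑ s n) T with h | h
  · have h1 : 1 ≤ Real.exp (δ * y) := Real.one_le_exp (mul_nonneg hδ (by linarith))
    have h2 : q⁻¹ ≤ q⁻¹ * Real.exp (δ * y) := le_mul_of_one_le_right hq'.le h1
    have h3 : M.sojourn ϑ s n ≤ q * M.sojourn ϑ s n ^ 2 + q⁻¹ := by
      have h4 : 0 ≤ q * (M.sojourn ϑ s n - q⁻¹) ^ 2 := by positivity
      have h5 : q * (M.sojourn ϑ s n - q⁻¹) ^ 2
          = q * M.sojourn ϑ s n ^ 2 - 2 * M.sojourn ϑ s n + q⁻¹ := by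
        field_simp
        ring
      linarith
    linarith [contribution_le_sojourn hS T]
  · have h1 : M.contribution ϑ T n s = 0 := by
      unfold contribution
      refine max_eq_right ?_
      linarith [min_le_left T (M.departure ϑ s n), le_max_right 0 (M.arrival ϑ s n)]
    rw [h1]
    positivity

/-- Part of the sojourn is lost only if the departure is after `T ≥ c + δ`; then `(A - c) + S > δ`,
and a Chebyshev-type bound applies. The loss is at most `S ≤ S² / R + R`, with `R` free to be
optimized. -/
theorem le_contribution {ϑ : Param} {s : ℕ → ℝ × ℝ} {n : ℕ}
    (hA : 0 ≤ M.arrival ϑ s n) {T c R δ : ℝ} (hR : 0 < R) (hδ : 0 < δ)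
    (hT : c + δ ≤ T) :
    M.sojourn ϑ s n - (M.sojourn ϑ s n ^ 2 / R
      + R * (2 / δ ^ 2) * ((M.arrival ϑ s n - c) ^ 2 + M.sojourn ϑ s n ^ 2))
      ≤ M.contribution ϑ T n s := by
  have hp : 0 ≤ M.sojourn ϑ s n ^ 2 / R
      + R * (2 / δ ^ 2) * ((M.arrival ϑ s n - c) ^ 2 + M.sojourn ϑ s n ^ 2) := by positivity
  unfold contribution
  rw [departure_eq, max_eq_right hA]
  generalize M.sojourn ϑ s n = S at *
  generalize M.arrival ϑ s n = A at *
  rcases le_or_gt (A + S) T with h | h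
  · rw [min_eq_right h]
    refine le_max_of_le_left ?_
    linarith
  · refine le_max_of_le_right ?_
    have h1 : 1 ≤ 2 / δ ^ 2 * ((A - c) ^ 2 + S ^ 2) := by
      rw [div_mul_eq_mul_div, le_div_iff₀ (by positivity)]
      nlinarith [sq_nonneg (A - c - S)]
    have h2 : R ≤ R * (2 / δ ^ 2) * ((A - c) ^ 2 + S ^ 2) := by
      rw [mul_assoc]; exact le_mul_of_one_le_right hR.le h1
    have h3 : S ≤ S ^ 2 / R + R := by
      rw [← sub_le_iff_le_add, le_div_iff₀ hR]
      nlinarith [sq_nonneg (S - R)]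
    linarith

namespace Frame

variable {Fr : Frame M} {θ : ℝ} {ϑ : Param}

theorem sq_le_exp_div {τ y : ℝ} (hτ : 0 < τ) (hy : 0 ≤ y) :
    y ^ 2 ≤ (2 / τ) ^ 2 * Real.exp (τ * y) := by
  have h := le_exp_div (y := y) (half_pos hτ)
  have h2 := pow_le_pow_left₀ hy h 2
  rw [div_pow, ← Real.exp_nat_mul] at h2
  refine h2.trans (le_of_eq ?_)
  rw [div_div_eq_mul_div, div_pow] at *
  field_simp
  push_cast
  ring_nf

theorem fst_sq_le_V (hθ : 0 < θ) (x : QState) : x.1 ^ 2 ≤ (2 / θ) ^ 2 * Fr.V θ x := by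
  have h1 := (le_max_left _ _).trans (Fr.abs_fst_le_gauge x x)
  have h2 := pow_le_pow_left₀ (abs_nonneg _) h1 2
  rw [sq_abs] at h2
  exact h2.trans (sq_le_exp_div hθ (Fr.gauge_nonneg x x))

theorem integrable_sq_of_le {f : ℝ × ℝ → ℝ} (hf : Measurable f)
    (hle : ∀ s : ℝ × ℝ, 0 ≤ s.1 → 0 ≤ s.2 → |f s| ≤ s.1 + s.2) (hθ : 0 < θ) (hθ' : θ ≤ Fr.t₀) :
    Integrable (fun s => f s ^ 2) M.noise := by
  have hB : 0 < Fr.aHi + Fr.bHi := add_pos Fr.aHi_pos Fr.bHi_pos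
  refine ((Fr.integrable_exp_growth hθ').const_mul ((2 / (θ * (Fr.aHi + Fr.bHi))) ^ 2)).mono'
    (hf.pow_const 2).aestronglyMeasurable ?_
  filter_upwards [Fr.noise_nonneg] with s hs
  rw [Real.norm_eq_abs, abs_of_nonneg (sq_nonneg _)]
  have h1 := pow_le_pow_left₀ (abs_nonneg _) (hle s hs.1 hs.2) 2
  rw [sq_abs] at h1
  refine h1.trans ((sq_le_exp_div (mul_pos hθ hB) (add_nonneg hs.1 hs.2)).trans (le_of_eq ?_))
  unfold growth
  ring_nf

theorem integrable_fst_sq (hθ : Fr.Adm θ) : Integrable (fun s => s.1 ^ 2) M.noise :=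
  integrable_sq_of_le (Fr := Fr) measurable_fst (fun s h1 h2 => by
    rw [abs_of_nonneg h1]; linarith) hθ.pos hθ.le'

theorem integrable_snd_sq (hθ : Fr.Adm θ) : Integrable (fun s => s.2 ^ 2) M.noise :=
  integrable_sq_of_le (Fr := Fr) measurable_snd (fun s h1 h2 => by
    rw [abs_of_nonneg h2]; linarith) hθ.pos hθ.le'

theorem exists_sojourn_sq_le (hθ : Fr.Adm θ) (hm : Fr.Good ϑ) : ∃ C : ℝ, 0 ≤ C ∧ ∀ n,
    Integrable (fun s => M.sojourn ϑ s n ^ 2) M.seqLaw ∧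
      ∫ s, M.sojourn ϑ s n ^ 2 ∂M.seqLaw ≤ C := by
  have hV := lintegral_V_le (Fr := Fr) (P := M.seqLaw) (ξ := fun n s => s n)
    (X := fun n s => M.path ϑ s n) (fun n => measurable_pi_apply n) M.map_seq
    (M.measurable_path ϑ) (M.indepFun_path ϑ) (fun _ => rfl)
    (fun n s => ⟨_, _, hm, step_eq_lindley M ϑ _ _⟩) hθ.pos hθ.le'
  have hr : 0 < 1 - Fr.rate θ := by linarith [Fr.rate_lt_one hθ.pos hθ.le']
  have h2 := integrable_snd_sq hθ
  refine ⟨2 * ((2 / θ) ^ 2 * (1 - Fr.rate θ)⁻¹) + 2 * ((ϑ 0)⁻¹ ^ 2 * ∫ s, s.2 ^ 2 ∂M.noise),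
    by positivity, fun n => ?_⟩
  have hW := integrable_and_integral_le_of_le_V (Y := fun s => (M.path ϑ s n).1 ^ 2)
    (M.measurable_path ϑ) hV hθ.pos hθ.le' n
    ((M.measurable_path ϑ n).fst.pow_const 2).aestronglyMeasurable (C := (2 / θ) ^ 2)
    (fun s => by rw [abs_of_nonneg (sq_nonneg _)]; exact fst_sq_le_V hθ.pos _)
  have hi : Integrable (fun s => 2 * (M.path ϑ s n).1 ^ 2
      + 2 * ((ϑ 0)⁻¹ ^ 2 * (s n).2 ^ 2)) M.seqLaw :=
    (hW.1.const_mul 2).add (((integrable_seq h2 n).const_mul _).const_mul 2)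
  have hle : ∀ s, M.sojourn ϑ s n ^ 2 ≤ 2 * (M.path ϑ s n).1 ^ 2
      + 2 * ((ϑ 0)⁻¹ ^ 2 * (s n).2 ^ 2) := by
    intro s
    unfold sojourn
    nlinarith [sq_nonneg ((M.path ϑ s n).1 - (ϑ 0)⁻¹ * (s n).2)]
  have hs : Integrable (fun s => M.sojourn ϑ s n ^ 2) M.seqLaw :=
    hi.mono' ((M.measurable_sojourn ϑ n).pow_const 2).aestronglyMeasurable (ae_of_all _ fun s => by
      rw [Real.norm_eq_abs, abs_of_nonneg (sq_nonneg _)]; exact hle s)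
  refine ⟨hs, (integral_mono hs hi hle).trans ?_⟩
  rw [integral_add (hW.1.const_mul 2) (((integrable_seq h2 n).const_mul _).const_mul 2),
    integral_const_mul, integral_const_mul, integral_const_mul, integral_seq h2]
  linarith [hW.2]

theorem integrable_sojourn (hT : M.LightTailed) (hθ : Fr.Adm θ) (hm : Fr.Good ϑ) (n : ℕ) :
    Integrable (fun s => M.sojourn ϑ s n) M.seqLaw := by
  have h1 := (smooth_lin hθ (p := 1) (q := 0) (by simp) (by simp)).toOsc.integrable_path
    hθ.pos.le hθ.le' hm n
  simp only [lin, one_mul, zero_mul, add_zero] at h1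
  exact h1.add ((integrable_seq (hT.integrable_V.comp_snd M.lawU) n).const_mul _)

theorem tendsto_integral_sojourn (hT : M.LightTailed) (hθ : Fr.Adm θ) (hm : Fr.Good ϑ) :
    Tendsto (fun n => ∫ s, M.sojourn ϑ s n ∂M.seqLaw) atTop
      (𝓝 (M.mean ϑ (lin 1 0) + (ϑ 0)⁻¹)) := by
  have hO := (smooth_lin hθ (p := 1) (q := 0) (by simp) (by simp)).toOsc
  have h := (hO.tendsto_integral_path hθ.pos hθ.le' hm).add_const (ϑ 0)⁻¹
  refine h.congr fun n => ?_
  have h1 := hO.integrable_path hθ.pos.le hθ.le' hm n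
  have h2 := hT.integrable_V.comp_snd M.lawU
  simp only [lin, one_mul, zero_mul, add_zero] at h1 ⊢
  unfold sojourn
  rw [integral_add h1 ((integrable_seq h2 n).const_mul _), integral_const_mul, integral_seq h2,
    hT.integral_snd, mul_one]

/-- The arrival time is a sum of independent terms with mean `n * b`, so its variance grows linearly
in `n`. -/
theorem arrival_sq_moment (hT : M.LightTailed) (hθ : Fr.Adm θ) (ϑ : Param) : ∃ C : ℝ, 0 ≤ C ∧ ∀ n : ℕ,
    Integrable (fun s => (M.arrival ϑ s n - n * (M.lam (ϑ 1))⁻¹) ^ 2) M.seqLaw ∧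
      ∫ s, (M.arrival ϑ s n - n * (M.lam (ϑ 1))⁻¹) ^ 2 ∂M.seqLaw ≤ n * C := by
  set b := (M.lam (ϑ 1))⁻¹ with hb
  set X : ℕ → (ℕ → ℝ × ℝ) → ℝ := fun i s => (s i).1 * b with hX
  have hXm : ∀ i, Measurable (X i) := fun i => by simp only [hX]; fun_prop
  have h2 := integrable_fst_sq hθ
  have hU : Integrable (fun s : ℝ × ℝ => s.1) M.noise := hT.integrable_U.comp_fst M.lawV
  have hX2 : ∀ i, Integrable (fun s => X i s ^ 2) M.seqLaw := fun i => by
    have := (integrable_seq h2 i).mul_const (b ^ 2)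
    simpa only [hX, mul_pow] using this
  have hXL : ∀ i, MemLp (X i) 2 M.seqLaw := fun i =>
    (memLp_two_iff_integrable_sq (hXm i).aestronglyMeasurable).2 (hX2 i)
  have hind : iIndepFun X M.seqLaw :=
    M.iIndepFun_seq.comp (fun _ s => s.1 * b) fun _ => by fun_prop
  have hA : ∀ n, (fun s => M.arrival ϑ s n) = ∑ i ∈ Finset.range n, X i := fun n => by
    funext s
    simp only [arrival, hX, Finset.sum_apply, div_eq_mul_inv, hb]
  have hmean : ∀ n : ℕ, ∫ s, M.arrival ϑ s n ∂M.seqLaw = n * b := fun n => by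
    have h3 : ∀ i, Integrable (X i) M.seqLaw := fun i => (integrable_seq hU i).mul_const b
    rw [show (fun s => M.arrival ϑ s n) = fun s => ∑ i ∈ Finset.range n, X i s by
      rw [hA n]; funext s; exact Finset.sum_apply _ _ _, integral_finsetSum _ fun i _ => h3 i]
    simp only [hX, integral_mul_const, integral_seq hU, hT.integral_fst]
    simp
  refine ⟨∫ s, (s.1 * b) ^ 2 ∂M.noise, integral_nonneg fun _ => sq_nonneg _, fun n => ?_⟩
  have hL : MemLp (fun s => M.arrival ϑ s n) 2 M.seqLaw := by
    rw [hA n]; exact memLp_finsetSum' _ fun i _ => hXL i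
  refine ⟨(hL.sub (memLp_const (n * b))).integrable_sq, ?_⟩
  have hv : variance (fun s => M.arrival ϑ s n) M.seqLaw
      = ∫ s, (M.arrival ϑ s n - n * b) ^ 2 ∂M.seqLaw := by
    rw [variance_eq_integral (M.measurable_arrival ϑ n).aemeasurable, hmean n]
  rw [← hv, hA n, IndepFun.variance_sum (fun i _ => hXL i)
    (fun i _ j _ hij => hind.indepFun hij)]
  refine (Finset.sum_le_card_nsmul _ _ (∫ s, (s.1 * b) ^ 2 ∂M.noise) fun i _ => ?_).trans ?_
  · refine (variance_le_expectation_sq (hXm i).aestronglyMeasurable).trans (le_of_eq ?_)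
    have h4 : Integrable (fun s : ℝ × ℝ => (s.1 * b) ^ 2) M.noise := by
      simpa only [mul_pow] using h2.mul_const (b ^ 2)
    exact integral_seq h4 i
  · rw [Finset.card_range, nsmul_eq_mul]

theorem exists_exp_arrival (hT : M.LightTailed) {ϑ : Param} (hb : 0 < (M.lam (ϑ 1))⁻¹) {ε : ℝ}
    (hε : 0 < ε) : ∃ δ q : ℝ, 0 < δ ∧ 0 < q ∧ q < 1 ∧ ∀ n : ℕ,
      Integrable (fun s => Real.exp (δ * (n * ((M.lam (ϑ 1))⁻¹ / (1 + ε)) - M.arrival ϑ s n)))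
        M.seqLaw ∧
      ∫ s, Real.exp (δ * (n * ((M.lam (ϑ 1))⁻¹ / (1 + ε)) - M.arrival ϑ s n)) ∂M.seqLaw
        = (q ^ 2) ^ n := by
  set b := (M.lam (ϑ 1))⁻¹ with hbdef
  obtain ⟨t₁, ht₁, h⟩ := hT.exists_mgf_lt_one (k := b / (1 + ε)) (α := 0) (β := b) (by
    have : b / (1 + ε) < b := div_lt_self hb (by linarith)
    linarith)
  have hint : ∃ δ > 0, δ ≤ t₁ ∧ Integrable (fun s : ℝ × ℝ =>
      Real.exp (δ * (b / (1 + ε) + 0 * s.2 - b * s.1))) M.noise := by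
    have h1 := mem_interior_iff_mem_nhds.1 (hT.zero_mem_interior (b / (1 + ε)) 0 b)
    obtain ⟨δ, h2, h3⟩ := Filter.nonempty_of_mem (Filter.inter_mem
      (mem_nhdsWithin_of_mem_nhds h1) (Ioo_mem_nhdsGT ht₁))
    exact ⟨δ, h3.1, h3.2.le, h2⟩
  obtain ⟨δ, hδ, hδ₁, hi⟩ := hint
  set ρ := ∫ s : ℝ × ℝ, Real.exp (δ * (b / (1 + ε) + 0 * s.2 - b * s.1)) ∂M.noise with hρ
  have hρ1 : ρ < 1 := h δ hδ hδ₁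
  have hρ0 : 0 < ρ := integral_exp_pos hi
  -- The square root is taken so that weighting the squared sojourn time by `q ^ n` and the
  -- exponential of mean `(q ^ 2) ^ n` by `(q ^ n)⁻¹` leaves `q ^ n` in both terms.
  refine ⟨δ, √ρ, hδ, Real.sqrt_pos.2 hρ0, by
    rw [Real.sqrt_lt' one_pos]; simpa using hρ1, fun n => ?_⟩
  set X : ℕ → (ℕ → ℝ × ℝ) → ℝ := fun i s => b / (1 + ε) + 0 * (s i).2 - b * (s i).1 with hX
  have hXm : ∀ i, Measurable (X i) := fun i => by simp only [hX]; fun_prop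
  have hind : iIndepFun X M.seqLaw :=
    M.iIndepFun_seq.comp (fun _ s => b / (1 + ε) + 0 * s.2 - b * s.1) fun _ => by fun_prop
  have hA : ∀ s, n * (b / (1 + ε)) - M.arrival ϑ s n = (∑ i ∈ Finset.range n, X i) s := fun s => by
    simp only [arrival, hX, Finset.sum_apply, div_eq_mul_inv, zero_mul, add_zero,
      Finset.sum_sub_distrib, Finset.sum_const, Finset.card_range, nsmul_eq_mul]
    congr 1
    exact Finset.sum_congr rfl fun i _ => mul_comm _ _
  simp only [hA]
  refine ⟨hind.integrable_exp_mul_sum hXm fun i _ => integrable_seq hi i, ?_⟩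
  have hmgf := hind.mgf_sum (t := δ) hXm (Finset.range n)
  have h5 : ∀ i, mgf (X i) M.seqLaw δ = ρ := fun i => integral_seq hi i
  simp only [h5, Finset.prod_const, Finset.card_range] at hmgf
  rw [Real.sq_sqrt hρ0.le, ← hmgf]
  rfl

/-- Little's law for the expected time averages of a queue started empty. -/
theorem tendsto_avgQueue (hT : M.LightTailed) (hθ : Fr.Adm θ) (hm : Fr.Good ϑ) :
    Tendsto (M.avgQueue ϑ) atTop
      (𝓝 (M.lam (ϑ 1) * (M.mean ϑ (lin 1 0) + (ϑ 0)⁻¹))) := by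
  have ha := hm.a_pos
  have hb := hm.b_pos
  obtain ⟨C₂, hC₂, hS2⟩ := exists_sojourn_sq_le hθ hm
  obtain ⟨CA, hCA, hA2⟩ := arrival_sq_moment hT hθ ϑ
  have hS1 := integrable_sojourn hT hθ hm
  have hpos := ae_seq Fr.noise_nonneg
  have hint : ∀ T n, Integrable (M.contribution ϑ T n) M.seqLaw := fun T n => by
    refine (hS1 n).mono' (M.measurable_contribution ϑ T n).aestronglyMeasurable ?_
    filter_upwards [hpos] with s hs
    rw [Real.norm_eq_abs, abs_of_nonneg (M.contribution_nonneg ϑ T n s)]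
    exact contribution_le_sojourn (sojourn_nonneg ha.le hs n) T
  have hlim := tendsto_tsum_div (L := fun T n => ∫ s, M.contribution ϑ T n s ∂M.seqLaw) hb
    (tendsto_integral_sojourn hT hθ hm)
    (fun T n => integral_nonneg fun s => M.contribution_nonneg ϑ T n s)
    (fun T n => by
      refine integral_mono_ae (hint T n) (hS1 n) ?_
      filter_upwards [hpos] with s hs
      exact contribution_le_sojourn (sojourn_nonneg ha.le hs n) T) ?_ ?_
  · rw [div_inv_eq_mul, mul_comm] at hlim
    refine hlim.congr fun T => ?_
    rw [avgQueue_eq ϑ T (hint T)]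
  · intro ε hε
    obtain ⟨δ, q, hδ, hq0, hq1, hq⟩ := exists_exp_arrival hT hb hε
    refine ⟨q, C₂ + 1, hq0.le, hq1, by positivity, fun T hT0 n hn => ?_⟩
    have hqn : 0 < q ^ n := pow_pos hq0 n
    have hTle : T ≤ n * ((M.lam (ϑ 1))⁻¹ / (1 + ε)) := by
      rw [← mul_div_assoc, le_div_iff₀ (by linarith)]
      linarith
    have h1 : ∫ s, M.contribution ϑ T n s ∂M.seqLaw ≤ ∫ s, (q ^ n * M.sojourn ϑ s n ^ 2
        + (q ^ n)⁻¹ * Real.exp (δ * (n * ((M.lam (ϑ 1))⁻¹ / (1 + ε)) - M.arrival ϑ s n)))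
          ∂M.seqLaw := by
      refine integral_mono_ae (hint T n)
        (((hS2 n).1.const_mul _).add ((hq n).1.const_mul _)) ?_
      filter_upwards [hpos] with s hs
      exact contribution_le_exp (sojourn_nonneg ha.le hs n) T hqn hδ.le (by linarith)
    rw [integral_add ((hS2 n).1.const_mul _) ((hq n).1.const_mul _), integral_const_mul,
      integral_const_mul, (hq n).2] at h1
    have h2 : (q ^ n)⁻¹ * (q ^ 2) ^ n = q ^ n := by
      rw [← pow_mul, mul_comm 2 n, pow_mul, sq, inv_mul_cancel_left₀ hqn.ne']
    have h3 := mul_le_mul_of_nonneg_left (hS2 n).2 hqn.le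
    rw [h2] at h1
    linarith
  · intro ε hε hε1
    set b := (M.lam (ϑ 1))⁻¹ with hbdef
    -- The loss bound is used with `R = √T`, `δ = ε T` and `c = n b`. Since `n ≤ T / b`, the arrival
    -- variance is at most `T * (CA / b)`, so every term is of order `1 / √T`.
    refine ⟨C₂ + (2 / ε ^ 2) * (CA / b + C₂), fun T hT1 n hn => ?_⟩
    have hT0 : 0 < T := by linarith
    have hR : 1 ≤ √T := Real.one_le_sqrt.2 hT1
    have hR0 : 0 < √T := by linarith
    have hRT : √T * √T = T := Real.mul_self_sqrt hT0.le
    have hi1 : Integrable (fun s => M.sojourn ϑ s n ^ 2 / √T) M.seqLaw := (hS2 n).1.div_const _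
    have hi2 : Integrable (fun s => √T * (2 / (ε * T) ^ 2) * ((M.arrival ϑ s n - n * b) ^ 2
      + M.sojourn ϑ s n ^ 2)) M.seqLaw := ((hA2 n).1.add (hS2 n).1).const_mul _
    have hi12 : Integrable (fun s => M.sojourn ϑ s n ^ 2 / √T + √T * (2 / (ε * T) ^ 2)
      * ((M.arrival ϑ s n - n * b) ^ 2 + M.sojourn ϑ s n ^ 2)) M.seqLaw := hi1.add hi2
    have h1 : ∫ s, (M.sojourn ϑ s n - (M.sojourn ϑ s n ^ 2 / √T
        + √T * (2 / (ε * T) ^ 2) * ((M.arrival ϑ s n - n * b) ^ 2 + M.sojourn ϑ s n ^ 2)))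
        ∂M.seqLaw ≤ ∫ s, M.contribution ϑ T n s ∂M.seqLaw := by
      refine integral_mono_ae ((hS1 n).sub hi12) (hint T n) ?_
      filter_upwards [hpos] with s hs
      exact le_contribution (arrival_nonneg hb.le hs n) hR0 (mul_pos hε hT0) (by linarith)
    refine le_trans ?_ h1
    rw [integral_sub (hS1 n) hi12, integral_add hi1 hi2, integral_div,
      integral_const_mul, integral_add (hA2 n).1 (hS2 n).1]
    have h2 : (n : ℝ) ≤ T / b := by
      rw [le_div_iff₀ hb]
      nlinarith
    have h3 := (hA2 n).2
    have h4 := (hS2 n).2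
    have h5 : (∫ s, (M.arrival ϑ s n - n * b) ^ 2 ∂M.seqLaw)
        + ∫ s, M.sojourn ϑ s n ^ 2 ∂M.seqLaw ≤ T * (CA / b + C₂) := by
      have h6 := mul_le_mul_of_nonneg_right h2 hCA
      have h7 : C₂ ≤ T * C₂ := le_mul_of_one_le_left hC₂ hT1
      have h8 : T / b * CA = T * (CA / b) := by ring
      linarith
    have h9 : √T * (2 / (ε * T) ^ 2) * (T * (CA / b + C₂))
        ≤ (2 / ε ^ 2) * (CA / b + C₂) / √T := by
      have e : ∀ R X : ℝ, 0 < R →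
          R * (2 / (ε * (R * R)) ^ 2) * ((R * R) * X) = 2 / ε ^ 2 * X / R := by
        intro R X hR
        field_simp
      have e := e (√T) (CA / b + C₂) hR0
      rw [hRT] at e
      exact e.le
    have h10 := mul_le_mul_of_nonneg_left h5
      (show 0 ≤ √T * (2 / (ε * T) ^ 2) by positivity)
    have h11 := div_le_div_of_nonneg_right h4 hR0.le
    rw [add_div]
    linarith

end Frame

/-! ### The gradient of the objective and the reduction of `U` to a scalar potential. -/

/-- Sensitivity of the gradient estimator to the state. -/
def slope (M : QueueModel) (ϑ : Param) : Param :=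
  !₂[-(M.h₀ * (M.lam (ϑ 1) / ϑ 0)), M.h₀ * deriv M.lam (ϑ 1)]

/-- The estimator depends on the state only through `w + y`, and affinely. All statements about `H`,
`U` and `P U` thus reduce to `lin 1 1` times a fixed vector. -/
theorem H_eq (M : QueueModel) (ϑ : Param) (x : QState) :
    M.H ϑ x = M.H ϑ (0, 0) + Frame.lin 1 1 x • M.slope ϑ := by
  ext i
  fin_cases i <;> simp [H, slope, Frame.lin] <;> ring

namespace Frame

variable {Fr : Frame M} {θ : ℝ} {ϑ : Param}

theorem meanQueue_eq (hT : M.LightTailed) (hθ : Fr.Adm θ) (hm : Fr.Good ϑ) :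
    M.meanQueue ϑ = M.lam (ϑ 1) * (M.mean ϑ (lin 1 0) + (ϑ 0)⁻¹) :=
  (tendsto_avgQueue hT hθ hm).limUnder_eq

/-- The stationary mean of the gradient estimator is the gradient of the objective. -/
theorem hasGradientAt_objective (hR : M.Regular) (hT : M.LightTailed) (hθ : Fr.Adm θ)
    (hϑ : ϑ ∈ M.box) (hev : ∀ᶠ ϑ' in 𝓝 ϑ, Fr.Good ϑ') :
    HasGradientAt M.objective (M.H ϑ (M.mean ϑ (lin 1 1), 0)) ϑ := by
  have hm := hev.self_of_nhds
  have hμ : ϑ 0 ≠ 0 := (inv_pos.1 hm.a_pos).ne'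
  have hl : M.lam (ϑ 1) ≠ 0 := (inv_pos.1 hm.b_pos).ne'
  have d0 : HasFDerivAt (fun ϑ : Param => ϑ 0) (EuclideanSpace.proj 0 : Param →L[ℝ] ℝ) ϑ :=
    (EuclideanSpace.proj 0 : Param →L[ℝ] ℝ).hasFDerivAt
  have d1 : HasFDerivAt (fun ϑ : Param => ϑ 1) (EuclideanSpace.proj 1 : Param →L[ℝ] ℝ) ϑ :=
    (EuclideanSpace.proj 1 : Param →L[ℝ] ℝ).hasFDerivAt
  have hlam : HasDerivAt M.lam (deriv M.lam (ϑ 1)) (ϑ 1) :=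
    ((hR.lam_contDiff _ hϑ.2).differentiableAt one_ne_zero).hasDerivAt
  have hcost : HasDerivAt M.cost (deriv M.cost (ϑ 0)) (ϑ 0) :=
    ((hR.cost_contDiff _ hϑ.1).differentiableAt one_ne_zero).hasDerivAt
  have da := (hasDerivAt_inv hμ).comp_hasFDerivAt (f := fun ϑ : Param => ϑ 0) ϑ d0
  have dl := hlam.comp_hasFDerivAt (f := fun ϑ : Param => ϑ 1) ϑ d1
  have db := (hlam.inv hl).comp_hasFDerivAt (f := fun ϑ : Param => ϑ 1) ϑ d1
  have dc := hcost.comp_hasFDerivAt (f := fun ϑ : Param => ϑ 0) ϑ d0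
  have dw := hasFDerivAt_mean_wait hθ hev da db
  have dobj := (((dl.mul (dw.add da)).const_mul M.h₀).add dc).sub (d1.mul dl)
  -- Differentiation needs the closed form on a full neighbourhood, also at boundary points of the
  -- box. This is why good parameters are required nearby and not only at `ϑ`.
  have heq : M.objective =ᶠ[𝓝 ϑ] fun ϑ => M.h₀ * (M.lam (ϑ 1) *
      (M.mean ϑ (lin 1 0) + (ϑ 0)⁻¹)) + M.cost (ϑ 0) - ϑ 1 * M.lam (ϑ 1) := by
    filter_upwards [hev] with ϑ' hm'
    rw [objective, meanQueue_eq hT hθ hm']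
  rw [hasGradientAt_iff_hasFDerivAt]
  refine (dobj.congr_of_eventuallyEq heq).congr_fderiv ?_
  have hz := mean_lin_eq hθ hm
  ext v
  simp [H, hz, PiLp.inner_apply, Fin.sum_univ_two]
  field_simp
  ring

theorem gradient_objective (hR : M.Regular) (hT : M.LightTailed) (hθ : Fr.Adm θ)
    (hϑ : ϑ ∈ M.box) (hev : ∀ᶠ ϑ' in 𝓝 ϑ, Fr.Good ϑ') :
    gradient M.objective ϑ = M.H ϑ (0, 0) + M.mean ϑ (lin 1 1) • M.slope ϑ := by
  rw [(hasGradientAt_objective hR hT hθ hϑ hev).gradient, H_eq]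
  simp [lin]

theorem bias_eq (hR : M.Regular) (hT : M.LightTailed) (hθ : Fr.Adm θ)
    (hϑ : ϑ ∈ M.box) (hev : ∀ᶠ ϑ' in 𝓝 ϑ, Fr.Good ϑ') (x : QState) (n : ℕ) :
    Integrable (M.H ϑ) ((M.kernel ϑ ^ n) x) ∧ M.bias ϑ x n
      = ((M.T (ϑ 0)⁻¹ (M.lam (ϑ 1))⁻¹)^[n] (lin 1 1) x - M.mean ϑ (lin 1 1)) • M.slope ϑ := by
  have hO := (smooth_lin hθ (p := 1) (q := 1) (by simp) (by simp)).toOsc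
  have h := hO.integrable_kernel_pow_and_integral hθ.pos.le hθ.le' hev.self_of_nhds n x
  have hH : M.H ϑ = fun x => M.H ϑ (0, 0) + lin 1 1 x • M.slope ϑ := funext (M.H_eq ϑ)
  have hprob : IsProbabilityMeasure ((M.kernel ϑ ^ n) x) := by
    have : IsMarkovKernel (M.kernel ϑ ^ n) := by
      induction n with
      | zero => exact inferInstanceAs (IsMarkovKernel (Kernel.id : Kernel QState QState))
      | succ n ih =>
        have := ih ((hO.integrable_kernel_pow_and_integral hθ.pos.le hθ.le' hev.self_of_nhds n x))
        rw [pow_succ]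
        exact inferInstanceAs (IsMarkovKernel ((M.kernel ϑ ^ n) ∘ₖ M.kernel ϑ))
    infer_instance
  have hi := (integrable_const (M.H ϑ (0, 0))).add (h.1.smul_const (M.slope ϑ))
  rw [bias, gradient_objective hR hT hθ hϑ hev]
  refine ⟨by rw [hH]; exact hi, ?_⟩
  have h2 : ∫ z, M.H ϑ z ∂(M.kernel ϑ ^ n) x
      = ∫ z, (M.H ϑ (0, 0) + lin 1 1 z • M.slope ϑ) ∂(M.kernel ϑ ^ n) x :=
    integral_congr_ae (ae_of_all _ (M.H_eq ϑ))
  rw [h2, integral_add (integrable_const _) (h.1.smul_const _), integral_smul_const, h.2]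
  simp [sub_smul]

variable (M) in
/-- Potential of the total content `w + y`. -/
abbrev pot (ϑ : Param) : QState → ℝ := M.potential (ϑ 0)⁻¹ (M.lam (ϑ 1))⁻¹ (lin 1 1)

theorem U_eq (hR : M.Regular) (hT : M.LightTailed) (hθ : Fr.Adm θ)
    (hϑ : ϑ ∈ M.box) (hev : ∀ᶠ ϑ' in 𝓝 ϑ, Fr.Good ϑ') (x : QState) :
    M.U ϑ x = pot M ϑ x • M.slope ϑ := by
  have hO := (smooth_lin hθ (p := 1) (q := 1) (by simp) (by simp)).toOsc
  have hs := (hO.summable hθ.pos hθ.le' hev.self_of_nhds x).of_abs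
  simp only [U, (bias_eq hR hT hθ hϑ hev x _).2]
  exact hs.tsum_smul_const _

theorem PU_eq (hR : M.Regular) (hT : M.LightTailed) (hθ : Fr.Adm θ)
    (hϑ : ϑ ∈ M.box) (hev : ∀ᶠ ϑ' in 𝓝 ϑ, Fr.Good ϑ') (x : QState) :
    M.PU ϑ x = (pot M ϑ x - (lin 1 1 x - M.mean ϑ (lin 1 1))) • M.slope ϑ := by
  have hO := (smooth_lin hθ (p := 1) (q := 1) (by simp) (by simp)).toOsc
  have hm := hev.self_of_nhds
  have hP := hO.potential hθ.pos hθ.le' hm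
  simp only [PU, U_eq hR hT hθ hϑ hev]
  rw [integral_smul_const, integral_kernel ϑ x hP.meas, T_potential hO hθ.pos hθ.le' hm]

theorem wellPosed (hR : M.Regular) (hT : M.LightTailed) (hθ : Fr.Adm θ)
    (hϑ : ϑ ∈ M.box) (hev : ∀ᶠ ϑ' in 𝓝 ϑ, Fr.Good ϑ') : M.WellPosed ϑ := by
  have hO := (smooth_lin hθ (p := 1) (q := 1) (by simp) (by simp)).toOsc
  have hm := hev.self_of_nhds
  have hP := hO.potential hθ.pos hθ.le' hm
  refine ⟨?_, (hasGradientAt_objective hR hT hθ hϑ hev).differentiableAt,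
    fun x _ n => (bias_eq hR hT hθ hϑ hev x n).1, fun x _ => ?_, fun x _ => ?_, fun x _ => ?_⟩
  · rw [meanQueue_eq hT hθ hm]
    exact tendsto_avgQueue hT hθ hm
  · simp only [(bias_eq hR hT hθ hϑ hev x _).2, norm_smul, Real.norm_eq_abs]
    exact (hO.summable hθ.pos hθ.le' hm x).mul_right _
  · rw [funext (U_eq hR hT hθ hϑ hev)]
    exact (hP.integrable_kernel hθ.pos.le hθ.le' hm x).smul_const _
  · rw [PU_eq hR hT hθ hϑ hev, U_eq hR hT hθ hϑ hev, gradient_objective hR hT hθ hϑ hev, H_eq]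
    module

end Frame

/-! ### Lipschitz coefficients on the box, and a frame covering a neighbourhood of it. -/

/-- Bounded Lipschitz functions of the parameters in the box. -/
def BL (M : QueueModel) (g : Param → ℝ) : Prop :=
  ∃ C : ℝ, 0 ≤ C ∧ (∀ ϑ ∈ M.box, |g ϑ| ≤ C) ∧
    ∀ ϑ ∈ M.box, ∀ ϑ' ∈ M.box, |g ϑ - g ϑ'| ≤ C * ‖ϑ - ϑ'‖

namespace BL

variable {g g' : Param → ℝ}

theorem const (k : ℝ) : M.BL fun _ => k :=
  ⟨|k|, abs_nonneg k, fun _ _ => le_rfl, fun _ _ _ _ => by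
    rw [sub_self, abs_zero]; positivity⟩

theorem mul (h : M.BL g) (h' : M.BL g') : M.BL fun ϑ => g ϑ * g' ϑ := by
  obtain ⟨C, hC, h1, h2⟩ := h
  obtain ⟨C', hC', h1', h2'⟩ := h'
  refine ⟨2 * (C * C') , by positivity, fun ϑ hϑ => ?_, fun ϑ hϑ ϑ' hϑ' => ?_⟩
  · rw [abs_mul]
    have := mul_le_mul (h1 ϑ hϑ) (h1' ϑ hϑ) (abs_nonneg _) hC
    have : 0 ≤ C * C' := by positivity
    linarith
  · calc _ = |g ϑ * (g' ϑ - g' ϑ') + (g ϑ - g ϑ') * g' ϑ'| := by ring_nf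
      _ ≤ |g ϑ| * |g' ϑ - g' ϑ'| + |g ϑ - g ϑ'| * |g' ϑ'| := by
          rw [← abs_mul, ← abs_mul]; exact abs_add_le _ _
      _ ≤ C * (C' * ‖ϑ - ϑ'‖) + (C * ‖ϑ - ϑ'‖) * C' := by
          have := h1 ϑ hϑ
          have := h1' ϑ' hϑ'
          have := h2 ϑ hϑ ϑ' hϑ'
          have := h2' ϑ hϑ ϑ' hϑ'
          gcongr
      _ = _ := by ring

theorem sub (h : M.BL g) (h' : M.BL g') : M.BL fun ϑ => g ϑ - g' ϑ := by
  obtain ⟨C, hC, h1, h2⟩ := h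
  obtain ⟨C', hC', h1', h2'⟩ := h'
  refine ⟨C + C', by positivity, fun ϑ hϑ => ?_, fun ϑ hϑ ϑ' hϑ' => ?_⟩
  · exact (abs_sub _ _).trans (add_le_add (h1 ϑ hϑ) (h1' ϑ hϑ))
  · calc _ = |(g ϑ - g ϑ') - (g' ϑ - g' ϑ')| := by ring_nf
      _ ≤ _ := (abs_sub _ _).trans (by linarith [h2 ϑ hϑ ϑ' hϑ', h2' ϑ hϑ ϑ' hϑ'])

theorem neg (h : M.BL g) : M.BL fun ϑ => -g ϑ := by
  simpa using (const (M := M) 0).sub h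

theorem add (h : M.BL g) (h' : M.BL g') : M.BL fun ϑ => g ϑ + g' ϑ := by
  simpa using h.sub h'.neg

theorem inv (h : M.BL g) {k : ℝ} (hk : 0 < k) (hg : ∀ ϑ ∈ M.box, k ≤ g ϑ) :
    M.BL fun ϑ => (g ϑ)⁻¹ := by
  obtain ⟨C, hC, h1, h2⟩ := h
  refine ⟨k⁻¹ + C / (k * k), by positivity, fun ϑ hϑ => ?_, fun ϑ hϑ ϑ' hϑ' => ?_⟩
  · have h3 : 0 < g ϑ := hk.trans_le (hg ϑ hϑ)
    rw [abs_of_pos (inv_pos.2 h3)]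
    have := inv_anti₀ hk (hg ϑ hϑ)
    have : 0 ≤ C / (k * k) := by positivity
    linarith
  · have h3 : 0 < g ϑ := hk.trans_le (hg ϑ hϑ)
    have h4 : 0 < g ϑ' := hk.trans_le (hg ϑ' hϑ')
    rw [inv_sub_inv h3.ne' h4.ne', abs_div, abs_of_pos (mul_pos h3 h4), abs_sub_comm]
    calc |g ϑ - g ϑ'| / (g ϑ * g ϑ') ≤ C * ‖ϑ - ϑ'‖ / (k * k) := by
          have := h2 ϑ hϑ ϑ' hϑ'
          have := hg ϑ hϑ
          have := hg ϑ' hϑ'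
          gcongr
      _ = C / (k * k) * ‖ϑ - ϑ'‖ := by ring
      _ ≤ _ := by
          have : 0 ≤ k⁻¹ := by positivity
          gcongr
          linarith

theorem comp_coord {f : ℝ → ℝ} {lo hi : ℝ} (hf : ∃ K, LipschitzOnWith K f (Set.Icc lo hi))
    (i : Fin 2) (hi : ∀ ϑ ∈ M.box, ϑ i ∈ Set.Icc lo hi) : M.BL fun ϑ => f (ϑ i) := by
  obtain ⟨K, hK⟩ := hf
  obtain ⟨C, hC⟩ := isCompact_Icc.exists_bound_of_continuousOn hK.continuousOn
  refine ⟨|C| + K, by positivity, fun ϑ hϑ => ?_, fun ϑ hϑ ϑ' hϑ' => ?_⟩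
  · have := hC _ (hi ϑ hϑ)
    rw [Real.norm_eq_abs] at this
    linarith [le_abs_self C, K.coe_nonneg]
  · have h1 := hK.dist_le_mul _ (hi ϑ hϑ) _ (hi ϑ' hϑ')
    rw [Real.dist_eq, Real.dist_eq] at h1
    have h2 : |ϑ i - ϑ' i| ≤ ‖ϑ - ϑ'‖ := PiLp.norm_apply_le (ϑ - ϑ') i
    calc _ ≤ _ := h1
      _ ≤ (|C| + K) * ‖ϑ - ϑ'‖ := by
        have := abs_nonneg C
        gcongr
        linarith

end BL

theorem norm_param_le (v : Param) : ‖v‖ ≤ |v 0| + |v 1| := by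
  rw [EuclideanSpace.norm_eq, Fin.sum_univ_two, Real.norm_eq_abs, Real.norm_eq_abs]
  refine Real.sqrt_le_iff.2 ⟨by positivity, ?_⟩
  nlinarith [mul_nonneg (abs_nonneg (v 0)) (abs_nonneg (v 1))]

theorem BL.vector {g : Param → Param} (hg0 : M.BL fun ϑ => g ϑ 0) (hg1 : M.BL fun ϑ => g ϑ 1) :
    ∃ C : ℝ, 0 ≤ C ∧ (∀ ϑ ∈ M.box, ‖g ϑ‖ ≤ C) ∧
      ∀ ϑ ∈ M.box, ∀ ϑ' ∈ M.box, ‖g ϑ - g ϑ'‖ ≤ C * ‖ϑ - ϑ'‖ := by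
  obtain ⟨C, hC, h1, h2⟩ := hg0
  obtain ⟨C', hC', h1', h2'⟩ := hg1
  refine ⟨C + C', by positivity, fun ϑ hϑ => ?_, fun ϑ hϑ ϑ' hϑ' => ?_⟩
  · exact (norm_param_le _).trans (add_le_add (h1 ϑ hϑ) (h1' ϑ hϑ))
  · refine (norm_param_le _).trans ?_
    have := h2 ϑ hϑ ϑ' hϑ'
    have := h2' ϑ hϑ ϑ' hϑ'
    simp only [PiLp.sub_apply]
    linarith

/-- Facts about the box of a regular model. -/
structure BoxFacts (M : QueueModel) : Prop where
  mu_le : M.muLo ≤ M.muHi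
  p_le : M.pLo ≤ M.pHi
  mu_pos : 0 < M.muLo
  lam_min_pos : 0 < M.lam M.pHi
  lam_le : ∀ p ∈ Set.Icc M.pLo M.pHi, M.lam M.pHi ≤ M.lam p ∧ M.lam p ≤ M.lam M.pLo

theorem Regular.boxFacts (hR : M.Regular) {ϑ : Param} (hϑ : ϑ ∈ M.box) : M.BoxFacts := by
  have hp : M.pLo ≤ M.pHi := hϑ.2.1.trans hϑ.2.2
  have hlo : M.pLo ∈ Set.Icc M.pLo M.pHi := ⟨le_rfl, hp⟩
  have hhi : M.pHi ∈ Set.Icc M.pLo M.pHi := ⟨hp, le_rfl⟩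
  exact ⟨hϑ.1.1.trans hϑ.1.2, hp, (hR.lam_pos _ hlo).trans hR.stable, hR.lam_pos _ hhi,
    fun p h => ⟨hR.lam_anti h hhi h.2, hR.lam_anti hlo h h.1⟩⟩

theorem Regular.exists_frame (hR : M.Regular) (hT : M.LightTailed) (hB : M.BoxFacts) :
    ∃ Fr : Frame M, ∀ ϑ ∈ M.box, ∀ᶠ ϑ' in 𝓝 ϑ, Fr.Good ϑ' := by
  have hμ := hB.mu_pos
  have hμH : 0 < M.muHi := hμ.trans_le hB.mu_le
  have hl := hB.lam_min_pos
  have hL : 0 < M.lam M.pLo := hl.trans_le (hB.lam_le _ ⟨le_rfl, hB.p_le⟩).1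
  have hst : M.muLo⁻¹ < (M.lam M.pLo)⁻¹ := inv_strictAnti₀ hL hR.stable
  have hLl : (M.lam M.pLo)⁻¹ ≤ (M.lam M.pHi)⁻¹ :=
    inv_anti₀ hl (hB.lam_le _ ⟨le_rfl, hB.p_le⟩).1
  have hmm : M.muHi⁻¹ ≤ M.muLo⁻¹ := inv_anti₀ hμ hB.mu_le
  have p1 := inv_pos.2 hμH
  have p2 := inv_pos.2 hL
  -- The gap between `1/muLo` and `1/lam pLo` is cut into thirds, and the outer bounds are halved
  -- and doubled. The box then lies strictly inside the rectangle, which leaves room for a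
  -- neighbourhood of each of its points.
  obtain ⟨Fr, e1, e2, e3, e4⟩ := hT.exists_frame (aLo := M.muHi⁻¹ / 2)
    (aHi := (2 * M.muLo⁻¹ + (M.lam M.pLo)⁻¹) / 3) (bLo := (M.muLo⁻¹ + 2 * (M.lam M.pLo)⁻¹) / 3)
    (bHi := 2 * (M.lam M.pHi)⁻¹) (by positivity) (by linarith) (by linarith) (by linarith)
  refine ⟨Fr, fun ϑ hϑ => ?_⟩
  have hϑ0 : 0 < ϑ 0 := hμ.trans_le hϑ.1.1
  have hlϑ : 0 < M.lam (ϑ 1) := hR.lam_pos _ hϑ.2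
  have ca : ContinuousAt (fun ϑ : Param => (ϑ 0)⁻¹) ϑ :=
    ContinuousAt.inv₀ (by fun_prop) hϑ0.ne'
  have cb : ContinuousAt (fun ϑ : Param => (M.lam (ϑ 1))⁻¹) ϑ :=
    ContinuousAt.inv₀ (ContinuousAt.comp (f := fun ϑ : Param => ϑ 1)
      (hR.lam_contDiff _ hϑ.2).continuousAt (by fun_prop)) hlϑ.ne'
  have b1 : M.muHi⁻¹ ≤ (ϑ 0)⁻¹ := inv_anti₀ hϑ0 hϑ.1.2
  have b2 : (ϑ 0)⁻¹ ≤ M.muLo⁻¹ := inv_anti₀ hμ hϑ.1.1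
  have b3 : (M.lam M.pLo)⁻¹ ≤ (M.lam (ϑ 1))⁻¹ := inv_anti₀ hlϑ (hB.lam_le _ hϑ.2).2
  have b4 : (M.lam (ϑ 1))⁻¹ ≤ (M.lam M.pHi)⁻¹ := inv_anti₀ hl (hB.lam_le _ hϑ.2).1
  filter_upwards [ca.eventually (Ioo_mem_nhds (a := Fr.aLo) (b := Fr.aHi) (by rw [e1]; linarith)
      (by rw [e2]; linarith)),
    cb.eventually (Ioo_mem_nhds (a := Fr.bLo) (b := Fr.bHi) (by rw [e3]; linarith)
      (by rw [e4]; linarith))] with ϑ' h1 h2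
  exact ⟨h1.1.le, h1.2.le, h2.1.le, h2.2.le⟩

theorem Regular.exists_lipschitz_lam (hR : M.Regular) :
    ∃ K, LipschitzOnWith K M.lam (Set.Icc M.pLo M.pHi) := by
  obtain ⟨K, hK⟩ := hR.lam_deriv_lipschitz
  obtain ⟨C, hC⟩ := isCompact_Icc.exists_bound_of_continuousOn hK.continuousOn
  refine ⟨C.toNNReal, Convex.lipschitzOnWith_of_nnnorm_deriv_le
    (fun p hp => (hR.lam_contDiff p hp).differentiableAt one_ne_zero) (fun p hp => ?_)
    (convex_Icc _ _)⟩
  rw [← NNReal.coe_le_coe, coe_nnnorm]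
  exact (hC p hp).trans (Real.le_coe_toNNReal C)

section Coefficients

variable (hR : M.Regular) (hB : M.BoxFacts)
include hR

theorem Regular.bl_lam : M.BL fun ϑ => M.lam (ϑ 1) :=
  BL.comp_coord hR.exists_lipschitz_lam 1 fun _ h => h.2

theorem Regular.bl_deriv_lam : M.BL fun ϑ => deriv M.lam (ϑ 1) :=
  BL.comp_coord hR.lam_deriv_lipschitz 1 fun _ h => h.2

theorem Regular.bl_deriv_cost : M.BL fun ϑ => deriv M.cost (ϑ 0) :=
  BL.comp_coord hR.cost_deriv_lipschitz 0 fun _ h => h.1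

omit hR in
theorem bl_price : M.BL fun ϑ => ϑ 1 :=
  BL.comp_coord (f := id) ⟨1, LipschitzWith.id.lipschitzOnWith⟩ 1 fun _ h => h.2

include hB in
omit hR in
theorem bl_inv_mu : M.BL fun ϑ => (ϑ 0)⁻¹ :=
  (BL.comp_coord (f := id) ⟨1, LipschitzWith.id.lipschitzOnWith⟩ 0 fun _ h => h.1).inv
    hB.mu_pos fun _ h => h.1.1

include hB in
theorem Regular.bl_inv_lam : M.BL fun ϑ => (M.lam (ϑ 1))⁻¹ :=
  hR.bl_lam.inv hB.lam_min_pos fun _ h => (hB.lam_le _ h.2).1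

include hB in
theorem Regular.exists_slope_bound : ∃ C : ℝ, 0 ≤ C ∧ (∀ ϑ ∈ M.box, ‖M.slope ϑ‖ ≤ C) ∧
    ∀ ϑ ∈ M.box, ∀ ϑ' ∈ M.box, ‖M.slope ϑ - M.slope ϑ'‖ ≤ C * ‖ϑ - ϑ'‖ := by
  refine BL.vector ?_ ?_
  · simp only [slope, div_eq_mul_inv]
    exact ((BL.const _).mul (hR.bl_lam.mul (bl_inv_mu hB))).neg
  · exact (BL.const _).mul hR.bl_deriv_lam

include hB in
theorem Regular.exists_H_bound : ∃ C : ℝ, 0 ≤ C ∧ (∀ ϑ ∈ M.box, ‖M.H ϑ (0, 0)‖ ≤ C) ∧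
    ∀ ϑ ∈ M.box, ∀ ϑ' ∈ M.box, ‖M.H ϑ (0, 0) - M.H ϑ' (0, 0)‖ ≤ C * ‖ϑ - ϑ'‖ := by
  refine BL.vector ?_ ?_
  · simp only [H, div_eq_mul_inv]
    exact hR.bl_deriv_cost.sub (((BL.const _).mul (hR.bl_lam.mul (bl_inv_mu hB))).mul
      ((BL.const _).add ((BL.const _).mul (bl_inv_mu hB))))
  · simp only [H, div_eq_mul_inv]
    exact (hR.bl_lam.neg.sub (bl_price.mul hR.bl_deriv_lam)).add
      (((BL.const _).mul hR.bl_deriv_lam).mul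
        ((BL.const _).add ((BL.const _).mul (bl_inv_mu hB))))

end Coefficients

/-! ### Weighted bounds and Lipschitz estimates for `H` and `P U`. -/

/-- Families of functions of the state which are, with weight `W`, bounded and Lipschitz in the
parameters. -/
def WBL {E : Type*} [NormedAddCommGroup E] (M : QueueModel) (W : QState → ℝ) (C : ℝ)
    (F : Param → QState → E) : Prop :=
  ∀ ϑ ∈ M.box, ∀ x, ‖F ϑ x‖ ≤ C * W x ∧
    ∀ ϑ' ∈ M.box, ‖F ϑ x - F ϑ' x‖ ≤ C * W x * ‖ϑ - ϑ'‖

namespace WBL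

variable {E : Type*} [NormedAddCommGroup E] {W : QState → ℝ} {C C' : ℝ} {F G : Param → QState → E}

theorem mono (h : M.WBL W C F) (hW : ∀ x, 1 ≤ W x) (hC : C ≤ C') : M.WBL W C' F := by
  refine fun ϑ hϑ x => ⟨(h ϑ hϑ x).1.trans ?_, fun ϑ' hϑ' => ((h ϑ hϑ x).2 ϑ' hϑ').trans ?_⟩ <;>
  · have := hW x
    gcongr

theorem add (h : M.WBL W C F) (h' : M.WBL W C' G) :
    M.WBL W (C + C') fun ϑ x => F ϑ x + G ϑ x := by
  refine fun ϑ hϑ x => ⟨(norm_add_le _ _).trans ?_, fun ϑ' hϑ' => ?_⟩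
  · linarith [(h ϑ hϑ x).1, (h' ϑ hϑ x).1]
  · rw [add_sub_add_comm]
    refine (norm_add_le _ _).trans ?_
    linarith [(h ϑ hϑ x).2 ϑ' hϑ', (h' ϑ hϑ x).2 ϑ' hϑ']

theorem smul [NormedSpace ℝ E] {g : Param → QState → ℝ} {v : Param → E} (hg : M.WBL W C g)
    (hC : 0 ≤ C) (hW : ∀ x, 1 ≤ W x) (hC' : 0 ≤ C') (h1 : ∀ ϑ ∈ M.box, ‖v ϑ‖ ≤ C')
    (h2 : ∀ ϑ ∈ M.box, ∀ ϑ' ∈ M.box, ‖v ϑ - v ϑ'‖ ≤ C' * ‖ϑ - ϑ'‖) :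
    M.WBL W (2 * (C * C')) fun ϑ x => g ϑ x • v ϑ := by
  refine fun ϑ hϑ x => ?_
  have hWx : 0 ≤ W x := zero_le_one.trans (hW x)
  have hpos : 0 ≤ C * C' * W x := by positivity
  refine ⟨?_, fun ϑ' hϑ' => ?_⟩
  · rw [norm_smul]
    have := mul_le_mul (hg ϑ hϑ x).1 (h1 ϑ hϑ) (norm_nonneg _) (by positivity)
    linarith
  · have e : g ϑ x • v ϑ - g ϑ' x • v ϑ' = g ϑ x • (v ϑ - v ϑ') + (g ϑ x - g ϑ' x) • v ϑ' := by
      module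
    rw [e]
    refine (norm_add_le _ _).trans ?_
    rw [norm_smul, norm_smul]
    have a1 := mul_le_mul (hg ϑ hϑ x).1 (h2 ϑ hϑ ϑ' hϑ') (norm_nonneg _) (by positivity)
    have a2 := mul_le_mul ((hg ϑ hϑ x).2 ϑ' hϑ') (h1 ϑ' hϑ') (norm_nonneg _) (by positivity)
    linarith

theorem of_const {v : Param → E} (hW : ∀ x, 1 ≤ W x) (hC : 0 ≤ C) (h1 : ∀ ϑ ∈ M.box, ‖v ϑ‖ ≤ C)
    (h2 : ∀ ϑ ∈ M.box, ∀ ϑ' ∈ M.box, ‖v ϑ - v ϑ'‖ ≤ C * ‖ϑ - ϑ'‖) :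
    M.WBL W C fun ϑ _ => v ϑ := by
  refine fun ϑ hϑ x => ⟨(h1 ϑ hϑ).trans ?_, fun ϑ' hϑ' => (h2 ϑ hϑ ϑ' hϑ').trans ?_⟩
  · exact le_mul_of_one_le_right hC (hW x)
  · gcongr
    exact le_mul_of_one_le_right hC (hW x)

end WBL

namespace Frame

variable {Fr : Frame M} {θ : ℝ}

theorem one_le_V_two (hθ : Fr.Adm θ) (x : QState) : 1 ≤ Fr.V (2 * (Fr.kap * θ)) x :=
  Fr.one_le_V hθ.two_pos.le x

theorem abs_lin_le (hθ : Fr.Adm θ) (x : QState) :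
    |lin 1 1 x| ≤ Fr.linConst θ * Fr.V (2 * (Fr.kap * θ)) x := by
  have h := (smooth_lin hθ (p := 1) (q := 1) (by simp) (by simp)).toOsc.abs_le hθ.pos.le x
  have h0 : lin 1 1 ((0, 0) : QState) = 0 := by simp [lin]
  rw [h0, abs_zero, zero_add] at h
  exact h.trans (mul_le_mul_of_nonneg_left (Fr.V_mono hθ.le_two x) (linConst_nonneg hθ))

theorem wbl_H (hR : M.Regular) (hB : M.BoxFacts) (hθ : Fr.Adm θ) :
    ∃ C, M.WBL (Fr.V (2 * (Fr.kap * θ))) C M.H := by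
  obtain ⟨C, hC, h1, h2⟩ := hR.exists_H_bound hB
  obtain ⟨C', hC', h1', h2'⟩ := hR.exists_slope_bound hB
  have hl : M.WBL (Fr.V (2 * (Fr.kap * θ))) (Fr.linConst θ) fun _ x => lin 1 1 x :=
    fun ϑ _ x => ⟨abs_lin_le hθ x, fun ϑ' _ => by
      have := linConst_nonneg hθ
      have := Fr.V_pos (2 * (Fr.kap * θ)) x
      rw [sub_self, norm_zero]; positivity⟩
  have := (WBL.of_const (one_le_V_two hθ) hC h1 h2).add
    (hl.smul (linConst_nonneg hθ) (one_le_V_two hθ) hC' h1' h2')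
  exact ⟨_, by simpa only [← H_eq] using this⟩

/-- By `PU_eq`, `P U` is a scalar factor times `slope`. In the difference of two scalar factors the
term `w + y` cancels, leaving potentials and stationary means. These are Lipschitz in `(a, b)`,
hence in the parameter. -/
theorem wbl_PU (hR : M.Regular) (hT : M.LightTailed) (hB : M.BoxFacts) (hθ : Fr.Adm θ)
    (hev : ∀ ϑ ∈ M.box, ∀ᶠ ϑ' in 𝓝 ϑ, Fr.Good ϑ') :
    ∃ C, M.WBL (Fr.V (2 * (Fr.kap * θ))) C M.PU := by
  obtain ⟨C', hC', h1', h2'⟩ := hR.exists_slope_bound hB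
  obtain ⟨Ca, hCa, -, ha⟩ := bl_inv_mu hB
  obtain ⟨Cb, hCb, -, hb⟩ := hR.bl_inv_lam hB
  have hS := smooth_lin hθ (p := 1) (q := 1) (by simp) (by simp)
  have hl := linConst_nonneg hθ
  have hmc := meanConst_nonneg hθ
  have hr := Fr.rate_lt_one hθ.pos hθ.le'
  have hr' : 0 < (1 - Fr.rate θ)⁻¹ := inv_pos.2 (by linarith)
  have hcc := Fr.convConst_nonneg hθ.pos hθ.le'
  set W := Fr.V (2 * (Fr.kap * θ)) with hWdef
  have hW : ∀ x, 1 ≤ W x := one_le_V_two hθ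
  have hθW : ∀ x, Fr.V θ x ≤ W x := Fr.V_mono hθ.le_two
  set K₁ := Fr.linConst θ * Fr.convConst θ * (1 - Fr.rate θ)⁻¹ + Fr.linConst θ
    + Fr.linConst θ * (1 - Fr.rate θ)⁻¹
  set K₂ := (|Fr.potConst θ| + Fr.meanConst θ) * Fr.linConst θ * (Ca + Cb)
  have hK₁ : 0 ≤ K₁ := by positivity
  have hK₂ : 0 ≤ K₂ := by positivity
  have hg : M.WBL W (K₁ + K₂)
      fun ϑ x => pot M ϑ x - (lin 1 1 x - M.mean ϑ (lin 1 1)) := by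
    refine fun ϑ hϑ x => ⟨?_, fun ϑ' hϑ' => ?_⟩
    · have hm := (hev ϑ hϑ).self_of_nhds
      have e1 : |pot M ϑ x| ≤ Fr.linConst θ * Fr.convConst θ * (1 - Fr.rate θ)⁻¹ * W x :=
        (hS.toOsc.abs_potential_le hθ.pos hθ.le' hm x).trans
          (mul_le_mul_of_nonneg_left (hθW x) (by positivity))
      have e2 : |M.mean ϑ (lin 1 1)| ≤ Fr.linConst θ * (1 - Fr.rate θ)⁻¹ := by
        refine abs_statMean_le hS.meas hθ.pos hθ.le' hm fun y => ?_
        have := hS.toOsc.abs_le hθ.pos.le y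
        simpa [lin] using this
      have e3 : Fr.linConst θ * (1 - Fr.rate θ)⁻¹ ≤ Fr.linConst θ * (1 - Fr.rate θ)⁻¹ * W x :=
        le_mul_of_one_le_right (by positivity) (hW x)
      have e4 := abs_lin_le hθ x
      have e5 : 0 ≤ K₂ * W x := mul_nonneg hK₂ (zero_le_one.trans (hW x))
      rw [Real.norm_eq_abs]
      calc _ ≤ |pot M ϑ x| + (|lin 1 1 x| + |M.mean ϑ (lin 1 1)|) :=
            (abs_sub _ _).trans (add_le_add_right (abs_sub _ _) _)
        _ ≤ (Fr.linConst θ * Fr.convConst θ * (1 - Fr.rate θ)⁻¹ + Fr.linConst θ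
            + Fr.linConst θ * (1 - Fr.rate θ)⁻¹) * W x := by linarith
        _ ≤ _ := by
          rw [add_mul K₁]
          exact le_add_of_nonneg_right e5
    · have hm := (hev ϑ hϑ).self_of_nhds
      have hm' := (hev ϑ' hϑ').self_of_nhds
      have hW0 := zero_le_one.trans (hW x)
      set Δ := |(ϑ 0)⁻¹ - (ϑ' 0)⁻¹| + |(M.lam (ϑ 1))⁻¹ - (M.lam (ϑ' 1))⁻¹| with hΔ
      have hΔ0 : 0 ≤ Δ := by positivity
      have hΔle : Δ ≤ (Ca + Cb) * ‖ϑ - ϑ'‖ := by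
        rw [add_mul]
        exact add_le_add (ha ϑ hϑ ϑ' hϑ') (hb ϑ hϑ ϑ' hϑ')
      have e1 : |pot M ϑ x - pot M ϑ' x| ≤ |Fr.potConst θ| * Fr.linConst θ * Δ * W x := by
        refine (hS.abs_potential_sub_le hθ hm hm' x).trans ?_
        gcongr
        exact le_abs_self _
      have e2 : |M.mean ϑ (lin 1 1) - M.mean ϑ' (lin 1 1)|
          ≤ Fr.meanConst θ * Fr.linConst θ * Δ * W x :=
        (hS.abs_statMean_sub_le hθ hm hm').trans
          (le_mul_of_one_le_right (by positivity) (hW x))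
      have e : pot M ϑ x - (lin 1 1 x - M.mean ϑ (lin 1 1))
          - (pot M ϑ' x - (lin 1 1 x - M.mean ϑ' (lin 1 1)))
          = (pot M ϑ x - pot M ϑ' x) + (M.mean ϑ (lin 1 1) - M.mean ϑ' (lin 1 1)) := by ring
      rw [e, Real.norm_eq_abs]
      calc _ ≤ |Fr.potConst θ| * Fr.linConst θ * Δ * W x
            + Fr.meanConst θ * Fr.linConst θ * Δ * W x :=
            (abs_add_le _ _).trans (add_le_add e1 e2)
        _ = (|Fr.potConst θ| + Fr.meanConst θ) * Fr.linConst θ * Δ * W x := by ring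
        _ ≤ (|Fr.potConst θ| + Fr.meanConst θ) * Fr.linConst θ
            * ((Ca + Cb) * ‖ϑ - ϑ'‖) * W x := by gcongr
        _ = K₂ * W x * ‖ϑ - ϑ'‖ := by ring
        _ ≤ _ := by
          gcongr
          linarith
  have hs := hg.smul (by positivity) hW hC' h1' h2'
  refine ⟨2 * ((K₁ + K₂) * C'), fun ϑ hϑ x => ⟨?_, fun ϑ' hϑ' => ?_⟩⟩
  · rw [PU_eq hR hT hθ hϑ (hev ϑ hϑ)]
    exact (hs ϑ hϑ x).1
  · rw [PU_eq hR hT hθ hϑ (hev ϑ hϑ), PU_eq hR hT hθ hϑ' (hev ϑ' hϑ')]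
    exact (hs ϑ hϑ x).2 ϑ' hϑ'

theorem measurable_H (M : QueueModel) (ϑ : Param) : Measurable (M.H ϑ) := by
  rw [funext (M.H_eq ϑ)]
  unfold lin
  fun_prop

theorem measurable_PU (hR : M.Regular) (hT : M.LightTailed) (hθ : Fr.Adm θ) {ϑ : Param}
    (hϑ : ϑ ∈ M.box) (hev : ∀ᶠ ϑ' in 𝓝 ϑ, Fr.Good ϑ') : Measurable (M.PU ϑ) := by
  have hO := (smooth_lin hθ (p := 1) (q := 1) (by simp) (by simp)).toOsc
  rw [funext (PU_eq hR hT hθ hϑ hev)]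
  exact ((hO.potential hθ.pos hθ.le' hev.self_of_nhds).meas.sub
    (hO.meas.sub_const _)).smul_const _

/-- Mean square Lipschitz bound of the gradient estimator after one step. -/
theorem sqrt_integral_H_sub_le {C t : ℝ} (hC : 0 ≤ C) (ht : 0 < t) (ht' : 2 * t ≤ Fr.t₀)
    (hH : M.WBL (Fr.V t) C M.H) {ϑs ϑ : Param} (hs : ϑs ∈ M.box) (hϑ : ϑ ∈ M.box)
    (hm : Fr.Good ϑ) (x : QState) :
    Integrable (fun z => ‖M.H ϑs z - M.H ϑ z‖ ^ 2) (M.kernel ϑ x) ∧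
      √(∫ z, ‖M.H ϑs z - M.H ϑ z‖ ^ 2 ∂(M.kernel ϑ x)) ≤ 2 * C * Fr.V t x * ‖ϑ - ϑs‖ := by
  -- The square of `V t` is `V (2 * t)`, whose mean after one step is at most `1 + rate * V ≤ 2 *
  -- V`.
  have h2 : (0 : ℝ) ≤ 2 * t := by linarith
  have hmeas : Measurable fun z => ‖M.H ϑs z - M.H ϑ z‖ ^ 2 :=
    ((measurable_H M ϑs).sub (measurable_H M ϑ)).norm.pow_const 2
  have hle : ∀ z, ‖M.H ϑs z - M.H ϑ z‖ ^ 2 ≤ (C * ‖ϑ - ϑs‖) ^ 2 * Fr.V (2 * t) z := fun z => by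
    have h := (hH ϑs hs z).2 ϑ hϑ
    have e : Fr.V (2 * t) z = Fr.V t z ^ 2 := by rw [V_pow]; norm_num
    rw [e, ← mul_pow, norm_sub_rev ϑ]
    refine pow_le_pow_left₀ (norm_nonneg _) (h.trans (le_of_eq (by ring))) 2
  have hV : Integrable (fun z => (C * ‖ϑ - ϑs‖) ^ 2 * Fr.V (2 * t) z) (M.kernel ϑ x) :=
    ((osc_V h2).integrable_kernel h2 ht' hm x).const_mul _
  have hi : Integrable (fun z => ‖M.H ϑs z - M.H ϑ z‖ ^ 2) (M.kernel ϑ x) :=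
    hV.mono' hmeas.aestronglyMeasurable (ae_of_all _ fun z => by
      rw [Real.norm_eq_abs, abs_of_nonneg (by positivity)]
      exact hle z)
  refine ⟨hi, Real.sqrt_le_iff.2 ⟨?_, (integral_mono hi hV hle).trans ?_⟩⟩
  · have := Fr.V_pos t x
    positivity
  · rw [integral_const_mul, integral_kernel ϑ x (Fr.measurable_V _)]
    have h3 := T_V_le h2 ht' hm x
    have h4 := Fr.rate_lt_one (by linarith : 0 < 2 * t) ht'
    have h5 := Fr.one_le_V h2 x
    have e : Fr.V (2 * t) x = Fr.V t x ^ 2 := by rw [V_pow]; norm_num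
    calc _ ≤ (C * ‖ϑ - ϑs‖) ^ 2 * (2 * Fr.V (2 * t) x) := by
          refine mul_le_mul_of_nonneg_left ?_ (sq_nonneg _)
          nlinarith
      _ ≤ (C * ‖ϑ - ϑs‖) ^ 2 * (4 * Fr.V (2 * t) x) := by
          refine mul_le_mul_of_nonneg_left ?_ (sq_nonneg _)
          linarith
      _ = _ := by rw [e]; ring

end Frame

/-! ### Measurability and uniform moments of the algorithm's trajectories. -/

theorem measurable_vec {α : Type*} [MeasurableSpace α] {f g : α → ℝ} (hf : Measurable f)
    (hg : Measurable g) : Measurable fun a => (!₂[f a, g a] : Param) :=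
  (WithLp.measurable_toLp 2 _).comp (measurable_pi_iff.2 (Fin.forall_fin_two.2 ⟨hf, hg⟩))

theorem measurable_coord (i : Fin 2) : Measurable fun ϑ : Param => ϑ i :=
  (EuclideanSpace.proj i : Param →L[ℝ] ℝ).continuous.measurable

theorem measurable_proj (M : QueueModel) : Measurable M.proj := by
  have h0 := measurable_coord 0
  have h1 := measurable_coord 1
  exact measurable_vec (measurable_const.max (measurable_const.min h0))
    (measurable_const.max (measurable_const.min h1))

theorem measurable_lindley_joint {α : Type*} [MeasurableSpace α] {a b : α → ℝ} {x : α → QState}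
    {s : α → ℝ × ℝ} (ha : Measurable a) (hb : Measurable b) (hx : Measurable x)
    (hs : Measurable s) : Measurable fun i => lindley (a i) (b i) (x i) (s i) := by
  have h : Measurable fun i => (x i).1 - b i * (s i).1 + a i * (s i).2 :=
    (hx.fst.sub (hb.mul hs.fst)).add (ha.mul hs.snd)
  exact (h.max measurable_const).prodMk (Measurable.ite (measurableSet_lt measurable_const h)
    (hx.snd.add (hb.mul hs.fst)) measurable_const)

/-- The demand rate on the price range coincides with a measurable function. -/
theorem Regular.exists_measurable_lam (hR : M.Regular) (hB : M.BoxFacts) :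
    ∃ L : ℝ → ℝ, Measurable L ∧ ∀ p ∈ Set.Icc M.pLo M.pHi, L p = M.lam p := by
  have hc : ContinuousOn M.lam (Set.Icc M.pLo M.pHi) := fun p hp =>
    (hR.lam_contDiff p hp).continuousAt.continuousWithinAt
  exact ⟨Set.IccExtend hB.p_le ((Set.Icc M.pLo M.pHi).domRestrict M.lam),
    (continuousOn_iff_continuous_domRestrict.1 hc).Icc_extend'.measurable,
    fun p hp => Set.IccExtend_of_mem _ _ hp⟩

namespace IsSAMCMC

variable {Ω : Type u} [MeasurableSpace Ω] {P : Measure Ω} {Us Vs : ℕ → Ω → ℝ} {η : ℕ → ℝ}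
  {ϑ : ℕ → Ω → Param} {x : ℕ → Ω → QState}

theorem param_mem (h : M.IsSAMCMC P Us Vs η ϑ x) (hB : M.BoxFacts) (t : ℕ) (ω : Ω) :
    ϑ t ω ∈ M.box := by
  cases t with
  | zero =>
    obtain ⟨ϑ₀, h₀, e⟩ := h.init_param
    rw [e]
    exact h₀
  | succ t =>
    rcases h.param_step with e | e <;>
    · rw [e]
      exact (M.proj_nearest hB.mu_le hB.p_le _).1

/-- The state is measurable and independent of the next noise. -/
theorem measurable_and_indepFun (h : M.IsSAMCMC P Us Vs η ϑ x) (hR : M.Regular)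
    (hB : M.BoxFacts) (t : ℕ) :
    Measurable (x t) ∧ IndepFun (x t) (fun ω => (Us t ω, Vs t ω)) P := by
  -- Nothing is assumed about `lam` outside the price range. As the iterates stay in the box, a
  -- measurable function agreeing with it there may replace it.
  obtain ⟨L, hL, hLe⟩ := hR.exists_measurable_lam hB
  obtain ⟨ϑ₀, -, e₀⟩ := h.init_param
  let St : (Param × QState) × (ℝ × ℝ) → QState :=
    fun z => lindley (z.1.1 0)⁻¹ (L (z.1.1 1))⁻¹ z.1.2 z.2
  let Hm : Param × QState → Param := fun z =>
    !₂[deriv M.cost (z.1 0) - M.h₀ * (L (z.1 1) / z.1 0) * (z.2.1 + z.2.2 + 1 / z.1 0),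
      -L (z.1 1) - z.1 1 * deriv M.lam (z.1 1)
        + M.h₀ * deriv M.lam (z.1 1) * (z.2.1 + z.2.2 + 1 / z.1 0)]
  have c0 : Measurable fun z : Param × QState => z.1 0 := (measurable_coord 0).comp measurable_fst
  have c1 : Measurable fun z : Param × QState => z.1 1 := (measurable_coord 1).comp measurable_fst
  have hL1 := hL.comp c1
  have hSt : Measurable St := measurable_lindley_joint (c0.comp measurable_fst).inv
    (hL1.comp measurable_fst).inv measurable_fst.snd measurable_snd
  have hd0 := (measurable_deriv M.cost).comp c0
  have hd1 := (measurable_deriv M.lam).comp c1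
  have hcont : Measurable fun z : Param × QState => z.2.1 + z.2.2 + 1 / z.1 0 :=
    (measurable_snd.fst.add measurable_snd.snd).add (measurable_const.div c0)
  have hHm : Measurable Hm := measurable_vec
    (hd0.sub ((measurable_const.mul (hL1.div c0)).mul hcont))
    ((hL1.neg.sub (c1.mul hd1)).add ((measurable_const.mul hd1).mul hcont))
  have hSe : ∀ n ω, x (n + 1) ω = St ((ϑ n ω, x n ω), (Us n ω, Vs n ω)) := fun n ω => by
    rw [h.state_step, step_eq_lindley]
    simp only [St, hLe _ (h.param_mem hB n ω).2]
  have hHe : ∀ n ω y, M.H (ϑ n ω) y = Hm (ϑ n ω, y) := fun n ω y => by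
    simp only [Hm, H, hLe _ (h.param_mem hB n ω).2]
  have hp := M.measurable_proj
  have hξ : ∀ n, Measurable fun ω => (Us n ω, Vs n ω) := fun n =>
    (h.measurable_U n).prodMk (h.measurable_V n)
  -- The function `R` selects the state at which `H` is evaluated, the old one or the new one, so
  -- one argument serves both schedules. The pair of parameter and state is then a recursive process
  -- driven by the noise.
  have key : ∀ R : (Param × QState) × (ℝ × ℝ) → QState, Measurable R →
      (∀ n ω, ϑ (n + 1) ω = M.proj (ϑ n ω
        - η n • Hm (ϑ n ω, R ((ϑ n ω, x n ω), (Us n ω, Vs n ω))))) →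
      Measurable (x t) ∧ IndepFun (x t) (fun ω => (Us t ω, Vs t ω)) P := by
    intro R hRm he
    let g : ℕ → (Param × QState) × (ℝ × ℝ) → Param × QState := fun n z =>
      (M.proj (z.1.1 - η n • Hm (z.1.1, R z)), St z)
    have hg : ∀ n, Measurable (g n) := fun n =>
      (hp.comp (measurable_fst.fst.sub
        ((hHm.comp (measurable_fst.fst.prodMk hRm)).const_smul (η n)))).prodMk hSt
    have hZ : ∀ n ω, (ϑ (n + 1) ω, x (n + 1) ω)
        = g n ((ϑ n ω, x n ω), (Us n ω, Vs n ω)) := fun n ω => Prod.ext (he n ω) (hSe n ω)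
    have hZ0 : ∀ ω, (ϑ 0 ω, x 0 ω) = (ϑ₀, ((0, 0) : QState)) := fun ω => by
      rw [e₀, h.init_state]
    have m := measurable_of_adapted (Z := fun n ω => (ϑ n ω, x n ω)) hξ hZ0 hg hZ t
    have i := indepFun_of_adapted (Z := fun n ω => (ϑ n ω, x n ω)) hξ h.indep hZ0 hg hZ t
    exact ⟨measurable_snd.comp m, i.comp measurable_snd measurable_id⟩
  rcases h.param_step with e | e
  · exact key (fun z => z.1.2) measurable_fst.snd fun n ω => by rw [e, hHe]
  · exact key St hSt fun n ω => by rw [e, hHe, hSe]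

/-- Uniform moment bounds along the trajectory for functions dominated by the Lyapunov function. -/
theorem integral_pow_le [IsProbabilityMeasure P] (h : M.IsSAMCMC P Us Vs η ϑ x)
    (hR : M.Regular) (hB : M.BoxFacts) {Fr : Frame M} (hgood : ∀ ϑ ∈ M.box, Fr.Good ϑ)
    {τ C : ℝ} (hτ : 0 < τ) (hτ' : 4 * τ ≤ Fr.t₀) (hC : 0 ≤ C) {Y : QState → ℝ}
    (hY : Measurable Y) (hY0 : ∀ x, 0 ≤ Y x) (hYV : ∀ x, Y x ≤ C * Fr.V τ x) {α : ℕ}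
    (hα : α ∈ Finset.Icc 1 4) (t : ℕ) :
    Integrable (fun ω => Y (x t ω) ^ α) P ∧
      ∫ ω, Y (x t ω) ^ α ∂P ≤ (C * (1 - Fr.rate (4 * τ))⁻¹) ^ α := by
  obtain ⟨hα1, hα4⟩ := Finset.mem_Icc.1 hα
  have h4 : 0 < 4 * τ := by linarith
  have hx := fun n => (h.measurable_and_indepFun hR hB n).1
  have hind := fun n => (h.measurable_and_indepFun hR hB n).2
  have hV := Frame.lintegral_V_le (Fr := Fr) (fun n => (h.measurable_U n).prodMk (h.measurable_V n))
    h.law hx hind h.init_state (fun n ω => ⟨_, _, hgood _ (h.param_mem hB n ω), by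
      rw [h.state_step, step_eq_lindley]⟩) h4 hτ'
  have hr0 := Fr.rate_nonneg (4 * τ)
  have hr1 := Fr.rate_lt_one h4 hτ'
  have hR1 : 1 ≤ (1 - Fr.rate (4 * τ))⁻¹ := (one_le_inv₀ (by linarith)).2 (by linarith)
  have hb : ∀ ω, |Y (x t ω) ^ α| ≤ C ^ α * Fr.V (4 * τ) (x t ω) := fun ω => by
    rw [abs_of_nonneg (pow_nonneg (hY0 _) _)]
    calc _ ≤ (C * Fr.V τ (x t ω)) ^ α := pow_le_pow_left₀ (hY0 _) (hYV _) α
      _ = C ^ α * Fr.V (α * τ) (x t ω) := by rw [mul_pow, Frame.V_pow]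
      _ ≤ _ := by
        refine mul_le_mul_of_nonneg_left (Fr.V_mono ?_ _) (by positivity)
        have : (α : ℝ) ≤ 4 := by exact_mod_cast hα4
        gcongr
  obtain ⟨hi, hle⟩ := Frame.integrable_and_integral_le_of_le_V hx hV h4 hτ' t
    ((hY.comp (hx t)).pow_const α).aestronglyMeasurable hb
  refine ⟨hi, hle.trans ?_⟩
  rw [mul_pow]
  -- The Lyapunov bound enters to the first power only. It is at least one, so raising it to the
  -- power `α ≥ 1` only weakens the estimate.
  exact mul_le_mul_of_nonneg_left (le_self_pow₀ hR1 (by omega)) (by positivity)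

end IsSAMCMC

end QueueModel

end

/-! ### Choice of the exponents and assembly of the constants. -/

theorem proposition2 (M : QueueModel) (hR : M.Regular) (hT : M.LightTailed)
    (θs : Param) (hθ : M.IsOptimal θs) :
    -- the solution of the Poisson equation is well defined
    (∀ ϑ ∈ M.box, M.WellPosed ϑ) ∧
    ∃ (LH LU : QState → ℝ) (CH CU σH σU : ℝ),
      Measurable LH ∧ Measurable LU ∧ (∀ x, 0 ≤ LH x) ∧ (∀ x, 0 ≤ LU x) ∧
      0 < CH ∧ 0 < CU ∧ 0 < σH ∧ 0 < σU ∧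
      -- (a)
      (∀ x ∈ stateSpace, ∀ ϑ ∈ M.box,
        Integrable (fun z => ‖M.H θs z - M.H ϑ z‖ ^ 2) (M.kernel ϑ x) ∧
        √(∫ z, ‖M.H θs z - M.H ϑ z‖ ^ 2 ∂(M.kernel ϑ x)) ≤ LH x * ‖ϑ - θs‖) ∧
      -- (b)
      (∀ x ∈ stateSpace, ∀ ϑ ∈ M.box, ∀ ϑ' ∈ M.box,
        ‖M.PU ϑ x - M.PU ϑ' x‖ ≤ LU x * ‖ϑ - ϑ'‖) ∧
      -- (c) and (d), with constants that depend neither on the step sizes nor on the trajectory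
      ∀ (Ω : Type u) [MeasurableSpace Ω] (P : Measure Ω) [IsProbabilityMeasure P]
        (Us Vs : ℕ → Ω → ℝ) (η : ℕ → ℝ) (ϑ : ℕ → Ω → Param) (x : ℕ → Ω → QState),
        M.IsSAMCMC P Us Vs η ϑ x →
        ∀ α ∈ Finset.Icc 1 4, ∀ t : ℕ,
          (Integrable (fun ω => LH (x t ω) ^ α) P ∧ ∫ ω, LH (x t ω) ^ α ∂P ≤ CH ^ α) ∧
          (Integrable (fun ω => LU (x t ω) ^ α) P ∧ ∫ ω, LU (x t ω) ^ α ∂P ≤ CU ^ α) ∧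
          (Integrable (fun ω => ‖M.H θs (x t ω)‖ ^ α) P ∧
            ∫ ω, ‖M.H θs (x t ω)‖ ^ α ∂P ≤ σH ^ α) ∧
          (Integrable (fun ω => ‖M.PU θs (x t ω)‖ ^ α) P ∧
            ∫ ω, ‖M.PU θs (x t ω)‖ ^ α ∂P ≤ σU ^ α) := by
  have hs : θs ∈ M.box := hθ.1
  have hB := hR.boxFacts hs
  obtain ⟨Fr, hev⟩ := hR.exists_frame hT hB
  have hgood : ∀ ϑ ∈ M.box, Fr.Good ϑ := fun ϑ hϑ => (hev ϑ hϑ).self_of_nhds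
  have hκ := Fr.kap_pos
  have ht₀ := Fr.t₀_pos
  -- The exponent `θ` is chosen so that the weight in the bounds for `H` and `P U` has exponent `t₀
  -- / 4`. Its fourth power then has exponent `t₀`, still covered by the drift inequality.
  have hτ : 2 * (Fr.kap * (Fr.t₀ / (8 * Fr.kap))) = Fr.t₀ / 4 := by
    field_simp
    norm_num
  have hA : Fr.Adm (Fr.t₀ / (8 * Fr.kap)) := ⟨by positivity, by rw [hτ]; linarith⟩
  have hW := QueueModel.Frame.one_le_V_two hA
  obtain ⟨C₁, hH⟩ := QueueModel.Frame.wbl_H hR hB hA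
  obtain ⟨C₂, hPU⟩ := QueueModel.Frame.wbl_PU hR hT hB hA hev
  rw [hτ] at hH hPU hW
  set τ := Fr.t₀ / 4 with hτdef
  have hτ0 : 0 < τ := by positivity
  have hτ4 : 4 * τ = Fr.t₀ := by rw [hτdef]; ring
  set C := |C₁| + |C₂| + 1
  have hC : 0 < C := by positivity
  replace hH := hH.mono hW (show C₁ ≤ C by linarith [le_abs_self C₁, abs_nonneg C₂])
  replace hPU := hPU.mono hW (show C₂ ≤ C by linarith [le_abs_self C₂, abs_nonneg C₁])
  have hR0 : 0 < (1 - Fr.rate (4 * τ))⁻¹ :=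
    inv_pos.2 (by linarith [Fr.rate_lt_one (by linarith : 0 < 4 * τ) hτ4.le])
  have hLm : Measurable fun x => 2 * C * Fr.V τ x := (Fr.measurable_V τ).const_mul _
  have hL0 : ∀ x, 0 ≤ 2 * C * Fr.V τ x := fun x => by
    have := Fr.V_pos τ x
    positivity
  have hVle : ∀ x, C * Fr.V τ x ≤ 2 * C * Fr.V τ x := fun x => by linarith [hL0 x]
  -- One constant serves all four moment bounds. The factor two comes from the mean square estimate
  -- of part (a).
  set S := 2 * C * (1 - Fr.rate (4 * τ))⁻¹
  have hS : 0 < S := by positivity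
  refine ⟨fun ϑ hϑ => QueueModel.Frame.wellPosed hR hT hA hϑ (hev ϑ hϑ),
    fun x => 2 * C * Fr.V τ x, fun x => 2 * C * Fr.V τ x, S, S, S, S, hLm, hLm, hL0, hL0,
    hS, hS, hS, hS, fun x _ ϑ hϑ => ?_, fun x _ ϑ hϑ ϑ' hϑ' => ?_, ?_⟩
  · exact QueueModel.Frame.sqrt_integral_H_sub_le hC.le hτ0 (by linarith) hH hs hϑ (hgood ϑ hϑ) x
  · exact ((hPU ϑ hϑ x).2 ϑ' hϑ').trans
      (mul_le_mul_of_nonneg_right (hVle x) (norm_nonneg _))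
  · intro Ω _ P _ Us Vs η ϑ x h α hα t
    have key : ∀ Y : QState → ℝ, Measurable Y → (∀ x, 0 ≤ Y x) →
        (∀ x, Y x ≤ 2 * C * Fr.V τ x) →
        Integrable (fun ω => Y (x t ω) ^ α) P ∧ ∫ ω, Y (x t ω) ^ α ∂P ≤ S ^ α :=
      fun Y hY hY0 hYV => h.integral_pow_le hR hB hgood hτ0 hτ4.le (by positivity) hY hY0 hYV hα t
    exact ⟨key _ hLm hL0 fun _ => le_rfl, key _ hLm hL0 fun _ => le_rfl,
      key (fun z => ‖M.H θs z‖) (QueueModel.Frame.measurable_H M θs).norm (fun _ => norm_nonneg _)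
        fun z => (hH θs hs z).1.trans (hVle z),
      key (fun z => ‖M.PU θs z‖)
        (QueueModel.Frame.measurable_PU hR hT hA hs (hev θs hs)).norm (fun _ => norm_nonneg _)
        fun z => (hPU θs hs z).1.trans (hVle z)⟩
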